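/- Let $n\ge 2$, $B(x,y)=x_ny_n-x_{n-1}y_{n-1}-\dots-x_1y_1$ on $\mathbb{R}^n$, $\Lambda=\{x : B(x,x)>0,\ x_n>0\}$ the forward light cone, $\mathrm{Det}(x)=\sqrt{B(x,x)}$ and $e=(0,\dots,0,1)^T\in\Lambda$. Let $H=\mathbb{R}_+AN=\{\gamma a_tn_c : \gamma>0,\ t\in\mathbb{R},\ c\in\mathbb{R}^{n-2}\}$, where $$a_t=\begin{pmatrix}\cosh t&0&\sinh t\\0&I_{n-2}&0\\\sinh t&0&\cosh t\end{pmatrix},\qquad n_c=\begin{pmatrix}1-|c|^2/2&-c^T&|c|^2/2\\c&I_{n-2}&-c\\-|c|^2/2&-c^T&1+|c|^2/2\end{pmatrix};$$ $H$ acts simply transitively on $\Lambda$ by matrix multiplication. Put $\widetilde f(w)=(2\pi)^{-n/2}\int_{\mathbb{R}^n} f(x)e^{-iB(x,w)}\,dx$, let $\mathcal{S}_\Lambda=\{f\in\mathcal{S}(\mathbb{R}^n) : \mathrm{supp}\,\widetilde f\subseteq\overline\Lambda\}$ with the topology of $\mathcal{S}(\mathbb{R}^n)$, and let $\mathcal{S}_\Lambda'$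 be its conjugate dual (continuous conjugate-linear functionals). Coorbit spaces. The group $G=H\ltimes\mathbb{R}^n$ acts on $\mathcal{S}_\Lambda$ by $\pi(h,b)f(x)=\gamma^{-n/2}f(h^{-1}(x-b))$ for $h=\gamma a_tn_c$. For $u\in\mathcal{S}_\Lambda$ and $\Phi\in\mathcal{S}_\Lambda'$ let $W_u(\Phi)(h,b)=\langle\Phi,\pi(h,b)u\rangle$. For $1\le p,q<\infty$ and $s\in\mathbb{R}$ let $L^{p,q}_s(G)$ be the space of measurable $F$ on $G$ with $$\|F\|_{L^{p,q}_s}=\Big(\int_{\mathbb{R}_+\times\mathbb{R}\times\mathbb{R}^{n-2}}\Big(\int_{\mathbb{R}^n}|F(\gamma a_tn_c,b)|^p\,db\Big)^{q/p}\gamma^{s}\,\frac{d\gamma\,dt\,dc}{\gamma^{n+1}}\Big)^{1/q}<\infty ,$$ and let $\mathrm{Co}^u_{\mathcal{S}_\Lambda}L^{p,q}_s(G)=\{\Phi\in\mathcal{S}_\Lambda' : W_u(\Phi)\in L^{p,q}_s(G)\}$ with the norm $\|W_u(\Phi)\|_{L^{p,q}_s}$. Besov spaces. Let $K=\{\mathrm{diag}(\sigma,1):\sigma\in\mathrm{SO}(n-1)\}$.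 For $r>0$ let $B_r(e)=\{k\,e^{\alpha}a_\tau e : k\in K,\ \alpha^2+\tau^2<r^2\}$ and $B_r(he)=hB_r(e)$ for $h\in H$. For $\delta>0$, a Whitney cover of $\Lambda$ with lattice points $w_j\in\Lambda$ $(j\in\mathbb{N})$ consists of balls $B_\delta(w_j)$ that cover $\Lambda$, such that the balls $B_{\delta/2}(w_j)$ are pairwise disjoint and, for some $N$, each point of $\Lambda$ lies in at most $N$ of the $B_\delta(w_j)$. Write $w_j=g_je$ with $g_j\in H$. A Littlewood--Paley decomposition subordinate to this cover is a sequence $\psi_j\in\mathcal{S}_\Lambda$ with $\widetilde\psi_j=\varphi_j/\sum_k\varphi_k$ on $\Lambda$ and $\widetilde\psi_j=0$ off $\Lambda$, where $\varphi_j(w)=\varphi(g_j^{-1}w)$ for a smooth $\varphi:\mathbb{R}^n\to[0,1]$ with $\mathrm{supp}\,\varphi\subseteq B_{2\delta}(e)$ and $\varphi=1$ on $B_\delta(e)$. For $\sigma\in\mathbb{R}$ let $B^{p,q}_\sigma$ be the space of $f\in\mathcal{S}_\Lambda'$ with $$\|f\|_{B^{p,q}_\sigma}=\Big(\sum_j\mathrm{Det}(w_j)^{-\sigma}\,\|f*\psi_j\|_p^q\Big)^{1/q}<\infty,\qquad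 (f*\psi)(x)=\langle f,\overline{\psi(x-\cdot)}\rangle .$$ Theorem. Let $1\le p,q<\infty$, $s\in\mathbb{R}$, and let $u\in\mathcal{S}_\Lambda$ be nonzero with $\mathrm{supp}\,\widetilde u$ a compact subset of $\Lambda$. Then, for every Littlewood--Paley decomposition of $\Lambda$ subordinate to a Whitney cover, $$B^{p,q}_{s+nq/2-n}=\mathrm{Co}^u_{\mathcal{S}_\Lambda}L^{p,q}_s(G)$$ as subspaces of $\mathcal{S}_\Lambda'$, with equivalent norms: there is a constant $C>0$ such that $\|f\|_{B^{p,q}_{s+nq/2-n}}\le C\|W_u(f)\|_{L^{p,q}_s}$ and $\|W_u(f)\|_{L^{p,q}_s}\le C\|f\|_{B^{p,q}_{s+nq/2-n}}$ for all $f$ in this space. -/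

import Mathlib

open MeasureTheory Matrix
open scoped SchwartzMap ENNReal ContDiff

noncomputable section

namespace LightCone

/-! ### The forward light cone in `ℝⁿ`, `n = d + 2`

The coordinates `x₁, x₂, …, x_{n-1}, x_n` of the text are
`x 0`, `x i.castSucc.succ` (for `i : Fin d`) and `x (Fin.last (d + 1))`. -/

/-- Euclidean space `ℝⁿ` with `n = d + 2`. -/
abbrev E (d : ℕ) : Type := EuclideanSpace ℝ (Fin (d + 2))

/-- `B(x, y) = xₙ yₙ - x_{n-1} y_{n-1} - ⋯ - x₁ y₁`. -/
def lorentzForm {d : ℕ} (x y : E d) : ℝ :=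
  x (Fin.last (d + 1)) * y (Fin.last (d + 1)) -
    ∑ i : Fin (d + 1), x i.castSucc * y i.castSucc

/-- The forward light cone `Λ`. -/
def cone (d : ℕ) : Set (E d) :=
  {x | 0 < lorentzForm x x ∧ 0 < x (Fin.last (d + 1))}

/-- The determinant `√B(x, x)` of the cone. -/
def coneDet {d : ℕ} (x : E d) : ℝ := Real.sqrt (lorentzForm x x)

/-- The base point `e = (0, …, 0, 1)`. -/
def basePoint (d : ℕ) : E d := EuclideanSpace.single (Fin.last (d + 1)) 1

/-! ### The group `H = ℝ₊ A N` -/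

/-- The column `(a, v, b)` with blocks of size `1, d, 1`. -/
def blk {α : Type} {d : ℕ} (a : α) (v : Fin d → α) (b : α) : Fin (d + 2) → α :=
  Fin.cons a (Fin.snoc (α := fun _ => α) v b)

/-- The matrix `a_t`. -/
def aMat (d : ℕ) (t : ℝ) : Matrix (Fin (d + 2)) (Fin (d + 2)) ℝ :=
  Matrix.of (blk
    (blk (Real.cosh t) 0 (Real.sinh t))
    (fun i => blk 0 (Pi.single i 1) 0)
    (blk (Real.sinh t) 0 (Real.cosh t)))

/-- The matrix `n_c`. -/
def nMat {d : ℕ} (c : EuclideanSpace ℝ (Fin d)) : Matrix (Fin (d + 2)) (Fin (d + 2)) ℝ :=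
  Matrix.of (blk
    (blk (1 - ‖c‖ ^ 2 / 2) (fun i => -c i) (‖c‖ ^ 2 / 2))
    (fun i => blk (c i) (Pi.single i 1) (-c i))
    (blk (-(‖c‖ ^ 2 / 2)) (fun i => -c i) (1 + ‖c‖ ^ 2 / 2)))

/-- The matrix `k_σ`. -/
def kMat {d : ℕ} (σ : Matrix (Fin (d + 1)) (Fin (d + 1)) ℝ) :
    Matrix (Fin (d + 2)) (Fin (d + 2)) ℝ :=
  Matrix.of (Fin.snoc (α := fun _ => Fin (d + 2) → ℝ)
    (fun i => Fin.snoc (α := fun _ => ℝ) (σ i) 0) (Fin.snoc (α := fun _ => ℝ) 0 1))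

/-- The group `H = ℝ₊ A N` in the coordinates `(γ, t, c)` of its elements `γ a_t n_c`
(each element has exactly one such triple). -/
abbrev H (d : ℕ) : Type := {γ : ℝ // 0 < γ} × ℝ × EuclideanSpace ℝ (Fin d)

/-- The dilation part `γ` of `γ a_t n_c`. -/
def H.scale {d : ℕ} (h : H d) : ℝ := h.1

lemma H.scale_pos {d : ℕ} (h : H d) : 0 < h.scale := h.1.2

/-- Lebesgue measure `dγ dt dc` in the coordinates of `H`. -/
def H.lebesgue (d : ℕ) : Measure (H d) :=
  (Measure.comap (Subtype.val : {γ : ℝ // 0 < γ} → ℝ) volume).prod volume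

/-- The matrix `γ a_t n_c`. -/
def H.mat {d : ℕ} (h : H d) : Matrix (Fin (d + 2)) (Fin (d + 2)) ℝ :=
  h.scale • (aMat d h.2.1 * nMat h.2.2)

section aux

variable {d : ℕ}

@[simp] lemma blk_zero {α : Type} (a : α) (v : Fin d → α) (b : α) : blk a v b 0 = a := rfl

@[simp] lemma blk_last {α : Type} (a : α) (v : Fin d → α) (b : α) :
    blk a v b (Fin.last (d + 1)) = b := by
  rw [← Fin.succ_last]; simp [blk]

@[simp] lemma blk_mid {α : Type} (a : α) (v : Fin d → α) (b : α) (i : Fin d) :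
    blk a v b i.castSucc.succ = v i := by
  simp [blk]

lemma blk_ext {α : Type} {f g : Fin (d + 2) → α} (h0 : f 0 = g 0)
    (hm : ∀ i : Fin d, f i.castSucc.succ = g i.castSucc.succ)
    (hl : f (Fin.last (d + 1)) = g (Fin.last (d + 1))) : f = g := by
  funext i
  refine Fin.cases h0 (fun j => ?_) i
  refine Fin.lastCases ?_ (fun k => ?_) j
  · rw [Fin.succ_last]; exact hl
  · exact hm k

lemma sum_blk (f : Fin (d + 2) → ℝ) :
    ∑ i, f i = f 0 + ∑ i : Fin d, f i.castSucc.succ + f (Fin.last (d + 1)) := by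
  rw [Fin.sum_univ_succ, Fin.sum_univ_castSucc, Fin.succ_last]; ring

lemma lorentzForm_eq (x y : E d) : lorentzForm x y =
    x (Fin.last (d + 1)) * y (Fin.last (d + 1)) - x 0 * y 0
      - ∑ i : Fin d, x i.castSucc.succ * y i.castSucc.succ := by
  unfold lorentzForm
  rw [Fin.sum_univ_succ]
  simp only [Fin.castSucc_zero, ← Fin.succ_castSucc]
  ring

lemma aMat_mulVec (t : ℝ) (x : Fin (d + 2) → ℝ) :
    aMat d t *ᵥ x = blk (Real.cosh t * x 0 + Real.sinh t * x (Fin.last (d + 1)))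
      (fun i => x i.castSucc.succ) (Real.sinh t * x 0 + Real.cosh t * x (Fin.last (d + 1))) := by
  refine blk_ext ?_ (fun i => ?_) ?_ <;>
    simp [Matrix.mulVec, dotProduct, sum_blk, aMat, Pi.single_apply]

lemma nMat_mulVec (c : EuclideanSpace ℝ (Fin d)) (x : Fin (d + 2) → ℝ) :
    nMat c *ᵥ x = blk
      (x 0 + ‖c‖ ^ 2 / 2 * (x (Fin.last (d + 1)) - x 0) - ∑ i, c i * x i.castSucc.succ)
      (fun i => x i.castSucc.succ - c i * (x (Fin.last (d + 1)) - x 0))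
      (x (Fin.last (d + 1)) + ‖c‖ ^ 2 / 2 * (x (Fin.last (d + 1)) - x 0)
        - ∑ i, c i * x i.castSucc.succ) := by
  refine blk_ext ?_ (fun i => ?_) ?_ <;>
    simp [Matrix.mulVec, dotProduct, sum_blk, nMat, Pi.single_apply] <;> ring

lemma norm_sq_eq (c : EuclideanSpace ℝ (Fin d)) : ‖c‖ ^ 2 = ∑ i, c i * c i := by
  rw [EuclideanSpace.real_norm_sq_eq]; simp [sq]

lemma aMat_mul_neg (t : ℝ) : aMat d t * aMat d (-t) = 1 := by
  refine Matrix.ext_of_mulVec_single fun i => ?_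
  rw [← Matrix.mulVec_mulVec, Matrix.one_mulVec]
  generalize (Pi.single i 1 : Fin (d + 2) → ℝ) = x
  rw [aMat_mulVec, aMat_mulVec]
  have h := Real.cosh_sq t
  refine blk_ext ?_ (fun i => ?_) ?_ <;> simp
  · linear_combination x 0 * h
  · linear_combination x (Fin.last (d + 1)) * h

lemma nMat_mul_neg (c : EuclideanSpace ℝ (Fin d)) : nMat c * nMat (-c) = 1 := by
  refine Matrix.ext_of_mulVec_single fun i => ?_
  rw [← Matrix.mulVec_mulVec, Matrix.one_mulVec]
  generalize (Pi.single i 1 : Fin (d + 2) → ℝ) = x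
  rw [nMat_mulVec, nMat_mulVec]
  have h := norm_sq_eq c
  refine blk_ext ?_ (fun i => ?_) ?_ <;>
    simp [mul_add, Finset.sum_add_distrib, ← mul_assoc, ← Finset.sum_mul] <;>
    rw [← h] <;> ring

lemma H.isUnit_mat (h : H d) : IsUnit h.mat.det := by
  have ha := congrArg Matrix.det (aMat_mul_neg (d := d) h.2.1)
  have hn := congrArg Matrix.det (nMat_mul_neg h.2.2)
  rw [Matrix.det_mul, Matrix.det_one] at ha hn
  have h1 := left_ne_zero_of_mul_eq_one ha
  have h2 := left_ne_zero_of_mul_eq_one hn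
  rw [H.mat, Matrix.det_smul, Matrix.det_mul, isUnit_iff_ne_zero]
  have := h.scale_pos.ne'
  positivity

end aux

/-- The left action of `γ a_t n_c` on `ℝⁿ` by matrix multiplication. -/
def H.act {d : ℕ} (h : H d) : E d ≃L[ℝ] E d :=
  LinearEquiv.toContinuousLinearEquiv
    (LinearEquiv.ofLinearMap (Matrix.toEuclideanLin h.mat) (Matrix.toEuclideanLin h.mat⁻¹)
      (by rw [← Matrix.toLpLin_mul_same, Matrix.mul_nonsing_inv _ h.isUnit_mat,
            Matrix.toLpLin_one])
      (by rw [← Matrix.toLpLin_mul_same, Matrix.nonsing_inv_mul _ h.isUnit_mat,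
            Matrix.toLpLin_one]))

section aux

variable {d : ℕ}

lemma H.act_apply (h : H d) (x : E d) : h.act x = WithLp.toLp 2 (h.mat *ᵥ x.ofLp) := rfl

lemma lorentzForm_act (h : H d) (x y : E d) :
    lorentzForm (h.act x) (h.act y) = h.scale ^ 2 * lorentzForm x y := by
  have hc := Real.cosh_sq h.2.1
  have hn := norm_sq_eq h.2.2
  rw [lorentzForm_eq, lorentzForm_eq]
  simp only [H.act_apply, H.mat, Matrix.smul_mulVec, ← Matrix.mulVec_mulVec, aMat_mulVec,
    nMat_mulVec, Pi.smul_apply, smul_eq_mul, blk_zero, blk_mid, blk_last]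
  have hs : ∑ i : Fin d, h.scale * (x i.castSucc.succ
        - h.2.2 i * (x (Fin.last (d + 1)) - x 0)) * (h.scale * (y i.castSucc.succ
        - h.2.2 i * (y (Fin.last (d + 1)) - y 0)))
      = h.scale ^ 2 * (∑ i : Fin d, x i.castSucc.succ * y i.castSucc.succ
        - (y (Fin.last (d + 1)) - y 0) * ∑ i, h.2.2 i * x i.castSucc.succ
        - (x (Fin.last (d + 1)) - x 0) * ∑ i, h.2.2 i * y i.castSucc.succ
        + (x (Fin.last (d + 1)) - x 0) * (y (Fin.last (d + 1)) - y 0) * ‖h.2.2‖ ^ 2) := by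
    rw [hn]
    simp only [Finset.mul_sum, ← Finset.sum_sub_distrib, ← Finset.sum_add_distrib]
    exact Finset.sum_congr rfl fun i _ => by ring
  rw [hs]
  generalize ∑ i, h.2.2 i * x i.castSucc.succ = p
  generalize ∑ i, h.2.2 i * y i.castSucc.succ = q
  generalize ∑ i : Fin d, x i.castSucc.succ * y i.castSucc.succ = r
  generalize Real.cosh h.2.1 = C at *
  generalize Real.sinh h.2.1 = S at *
  generalize x 0 = x₀
  generalize x (Fin.last (d + 1)) = x₁
  generalize y 0 = y₀
  generalize y (Fin.last (d + 1)) = y₁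
  generalize ‖h.2.2‖ ^ 2 = N
  linear_combination h.scale ^ 2 * ((x₁ + N / 2 * (x₁ - x₀) - p) * (y₁ + N / 2 * (y₁ - y₀) - q)
    - (x₀ + N / 2 * (x₁ - x₀) - p) * (y₀ + N / 2 * (y₁ - y₀) - q)) * hc

lemma mem_cone_iff (x : E d) :
    x ∈ cone d ↔ 0 < lorentzForm x x ∧ 0 < x (Fin.last (d + 1)) - x 0 := by
  have h0 : 0 ≤ ∑ i : Fin d, x i.castSucc.succ * x i.castSucc.succ :=
    Finset.sum_nonneg fun i _ => mul_self_nonneg _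
  have h := lorentzForm_eq x x
  simp only [cone, Set.mem_ofPred_eq]
  constructor <;> rintro ⟨h1, h2⟩ <;> refine ⟨h1, ?_⟩ <;> nlinarith

lemma act_mem_cone (h : H d) {x : E d} (hx : x ∈ cone d) : h.act x ∈ cone d := by
  rw [mem_cone_iff] at hx ⊢
  have hg := h.scale_pos
  refine ⟨by rw [lorentzForm_act]; exact mul_pos (by positivity) hx.1, ?_⟩
  have hcs : 0 < Real.cosh h.2.1 - Real.sinh h.2.1 := by
    rw [Real.cosh_sub_sinh]; exact Real.exp_pos _
  have : (h.act x) (Fin.last (d + 1)) - (h.act x) 0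
      = h.scale * (Real.cosh h.2.1 - Real.sinh h.2.1) * (x (Fin.last (d + 1)) - x 0) := by
    simp only [H.act_apply, H.mat, Matrix.smul_mulVec, ← Matrix.mulVec_mulVec, aMat_mulVec,
      nMat_mulVec, Pi.smul_apply, smul_eq_mul, blk_zero, blk_last]
    ring
  rw [this]
  exact mul_pos (mul_pos hg hcs) hx.2

lemma act_mem_closure (h : H d) {x : E d} (hx : x ∈ closure (cone d)) :
    h.act x ∈ closure (cone d) :=
  map_mem_closure h.act.continuous hx fun _ => act_mem_cone h

lemma smul_mem_closure {r : ℝ} (hr : 0 < r) {x : E d} (hx : x ∈ closure (cone d)) :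
    r • x ∈ closure (cone d) := by
  refine map_mem_closure (continuous_const_smul r) hx fun y hy => ?_
  have : lorentzForm (r • y) (r • y) = r ^ 2 * lorentzForm y y := by
    simp only [lorentzForm_eq, PiLp.smul_apply, smul_eq_mul, mul_sub, Finset.mul_sum]
    congr 1
    · ring
    · exact Finset.sum_congr rfl fun i _ => by ring
  refine ⟨by rw [this]; exact mul_pos (by positivity) hy.1, ?_⟩
  exact mul_pos hr hy.2

end aux

/-! ### The Fourier transform of the form `B` and the space `S_Λ` -/

/-- `f̃(w) = (2π)^{-n/2} ∫ f(x) e^{-i B(x, w)} dx`. -/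
def lorentzFourier {d : ℕ} (f : E d → ℂ) (w : E d) : ℂ :=
  ((Real.sqrt (2 * Real.pi) ^ (d + 2) : ℝ) : ℂ)⁻¹ *
    ∫ x, f x * Complex.exp (-(Complex.I * (lorentzForm x w : ℂ)))

section aux

variable {d : ℕ}

lemma continuous_lorentzForm (w : E d) : Continuous fun x : E d => lorentzForm x w := by
  unfold lorentzForm; fun_prop

lemma norm_exp_form (r : ℝ) : ‖Complex.exp (-(Complex.I * (r : ℂ)))‖ = 1 := by
  rw [Complex.norm_exp]; simp

lemma integrable_mul_exp (f : 𝓢(E d, ℂ)) (w : E d) :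
    Integrable fun x => f x * Complex.exp (-(Complex.I * (lorentzForm x w : ℂ))) := by
  refine (f.integrable (μ := volume)).mul_bdd (c := 1) ?_ ?_
  · have := continuous_lorentzForm w
    exact Continuous.aestronglyMeasurable (by fun_prop)
  · exact Filter.Eventually.of_forall fun x => (norm_exp_form _).le

lemma tsupport_fourier_iff (f : E d → ℂ) :
    tsupport (lorentzFourier f) ⊆ closure (cone d) ↔
      ∀ w ∉ closure (cone d), lorentzFourier f w = 0 := by
  rw [tsupport, isClosed_closure.closure_subset_iff, Function.support_subset_iff']

end aux

/-- `S_Λ`: Schwartz functions `f` with `supp f̃` in the closure of `Λ`, with the topology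
of the Schwartz space. -/
def ConeSchwartz (d : ℕ) : Submodule ℂ 𝓢(E d, ℂ) where
  carrier := {f | tsupport (lorentzFourier f) ⊆ closure (cone d)}
  zero_mem' := by
    simp [tsupport_fourier_iff, lorentzFourier]
  add_mem' := by
    intro f g hf hg
    simp only [Set.mem_ofPred_eq, tsupport_fourier_iff] at hf hg ⊢
    intro w hw
    have : lorentzFourier (f + g : 𝓢(E d, ℂ)) w = lorentzFourier f w + lorentzFourier g w := by
      simp only [lorentzFourier, _root_.add_apply, add_mul]
      rw [integral_add (integrable_mul_exp f w) (integrable_mul_exp g w), mul_add]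
    rw [this, hf w hw, hg w hw, add_zero]
  smul_mem' := by
    intro a f hf
    simp only [Set.mem_ofPred_eq, tsupport_fourier_iff] at hf ⊢
    intro w hw
    have : lorentzFourier (a • f : 𝓢(E d, ℂ)) w = a * lorentzFourier f w := by
      simp only [lorentzFourier, _root_.smul_apply, smul_eq_mul, mul_assoc]
      rw [integral_const_mul]; ring
    rw [this, hf w hw, mul_zero]

/-- The conjugate dual of `S_Λ`: continuous conjugate-linear functionals. -/
abbrev ConeDual (d : ℕ) : Type := ConeSchwartz d →L⋆[ℂ] ℂ

/-! ### The representation `π` of `G = H ⋉ ℝⁿ` on `S_Λ` -/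

/-- `π(h, b) f(x) = γ^{-n/2} f(h⁻¹(x - b))` on the Schwartz space, `h = γ a_t n_c`. -/
def schwartzRep {d : ℕ} (h : H d) (b : E d) : 𝓢(E d, ℂ) →L[ℂ] 𝓢(E d, ℂ) :=
  ((h.scale ^ (-((d : ℝ) + 2) / 2) : ℝ) : ℂ) •
    (SchwartzMap.compSubConstCLM ℂ b ∘L
      SchwartzMap.compCLMOfContinuousLinearEquiv ℂ h.act.symm)

section aux

variable {d : ℕ}

lemma schwartzRep_apply (h : H d) (b : E d) (f : 𝓢(E d, ℂ)) (x : E d) :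
    schwartzRep h b f x =
      ((h.scale ^ (-((d : ℝ) + 2) / 2) : ℝ) : ℂ) * f (h.act.symm (x - b)) := rfl

lemma integral_comp_act (h : H d) (g : E d → ℂ) (hg : ∫ y, g (h.act y) = 0) :
    ∫ x, g x = 0 := by
  have hdet : LinearMap.det (h.act.toLinearEquiv : E d →ₗ[ℝ] E d) ≠ 0 :=
    (LinearEquiv.isUnit_det' h.act.toLinearEquiv).ne_zero
  have hm := Measure.map_linearMap_addHaar_eq_smul_addHaar (volume : Measure (E d)) hdet
  have h2 : ∫ y, g (h.act y) = ∫ x, g x ∂(Measure.map h.act volume) :=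
    (h.act.toHomeomorph.measurableEmbedding.integral_map g).symm
  have h3 : Measure.map (h.act) (volume : Measure (E d)) =
      ENNReal.ofReal |(LinearMap.det (h.act.toLinearEquiv : E d →ₗ[ℝ] E d))⁻¹| • volume := hm
  rw [h2, h3, integral_smul_measure, smul_eq_zero] at hg
  refine hg.resolve_left ?_
  rw [ENNReal.toReal_ofReal (abs_nonneg _)]
  exact abs_ne_zero.mpr (inv_ne_zero hdet)

lemma lorentzForm_add_left (x y w : E d) :
    lorentzForm (x + y) w = lorentzForm x w + lorentzForm y w := by
  simp only [lorentzForm, PiLp.add_apply, add_mul, Finset.sum_add_distrib]; ring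

lemma lorentzForm_neg_left (x w : E d) : lorentzForm (-x) w = -lorentzForm x w := by
  simp only [lorentzForm, PiLp.neg_apply, neg_mul, Finset.sum_neg_distrib]; ring

lemma lorentzForm_smul_right (r : ℝ) (x w : E d) :
    lorentzForm x (r • w) = r * lorentzForm x w := by
  simp only [lorentzForm, PiLp.smul_apply, smul_eq_mul, mul_sub, Finset.mul_sum]
  congr 1
  · ring
  · exact Finset.sum_congr rfl fun i _ => by ring

lemma const_ne_zero (d : ℕ) : ((Real.sqrt (2 * Real.pi) ^ (d + 2) : ℝ) : ℂ)⁻¹ ≠ 0 := by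
  have : 0 < Real.sqrt (2 * Real.pi) ^ (d + 2) := by positivity
  exact inv_ne_zero (by exact_mod_cast this.ne')

lemma schwartzRep_mem (h : H d) (b : E d) {f : 𝓢(E d, ℂ)} (hf : f ∈ ConeSchwartz d) :
    schwartzRep h b f ∈ ConeSchwartz d := by
  change tsupport _ ⊆ _ at hf
  change tsupport _ ⊆ _
  rw [tsupport_fourier_iff] at hf ⊢
  intro w hw
  set v := h.act.symm w with hv
  have hg := h.scale_pos
  have hv' : h.scale ^ 2 • v ∉ closure (cone d) := fun hmem => hw <| by
    have := smul_mem_closure (inv_pos.mpr (pow_pos hg 2)) (act_mem_closure h hmem)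
    rwa [map_smul, inv_smul_smul₀ (pow_pos hg 2).ne', hv,
      ContinuousLinearEquiv.apply_symm_apply] at this
  have h0 := (mul_eq_zero.mp (hf _ hv')).resolve_left (const_ne_zero d)
  unfold lorentzFourier
  rw [mul_eq_zero]
  right
  rw [← integral_add_right_eq_self _ b]
  refine integral_comp_act h _ ?_
  have key : ∀ y : E d, schwartzRep h b f (h.act y + b) *
      Complex.exp (-(Complex.I * (lorentzForm (h.act y + b) w : ℂ))) =
      (((h.scale ^ (-((d : ℝ) + 2) / 2) : ℝ) : ℂ) *
        Complex.exp (-(Complex.I * (lorentzForm b w : ℂ)))) *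
      (f y * Complex.exp (-(Complex.I * (lorentzForm y (h.scale ^ 2 • v) : ℂ)))) := by
    intro y
    have hB : lorentzForm (h.act y) w = lorentzForm y (h.scale ^ 2 • v) := by
      rw [lorentzForm_smul_right, ← lorentzForm_act, hv, ContinuousLinearEquiv.apply_symm_apply]
    rw [schwartzRep_apply, lorentzForm_add_left, hB, add_sub_cancel_right,
      ContinuousLinearEquiv.symm_apply_apply]
    rw [Complex.ofReal_add, mul_add, neg_add (Complex.I * _), Complex.exp_add]
    ring
  simp_rw [key]
  rw [integral_const_mul, h0, mul_zero]

end aux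

/-- The restriction of `π(h, b)` to `S_Λ`. -/
def rep {d : ℕ} (h : H d) (b : E d) : ConeSchwartz d →L[ℂ] ConeSchwartz d :=
  (schwartzRep h b ∘L (ConeSchwartz d).subtypeL).codRestrict (ConeSchwartz d) fun f => schwartzRep_mem h b f.2

/-- The voice transform `W_u(Φ)(h, b) = ⟨Φ, π(h, b) u⟩`. -/
def voice {d : ℕ} (u : ConeSchwartz d) (Φ : ConeDual d) : H d × E d → ℂ :=
  fun g => Φ (rep g.1 g.2 u)

/-! ### `L^{p,q}_s(G)` and the coorbit spaces -/

/-- `‖F‖_{L^{p,q}_s} = (∫_H (∫ |F(γ a_t n_c, b)|^p db)^{q/p} γ^s γ^{-(n+1)} dγ dt dc)^{1/q}`. -/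
def mixedNorm {d : ℕ} (p q s : ℝ) (F : H d × E d → ℂ) : ℝ≥0∞ :=
  (∫⁻ h : H d, (∫⁻ b : E d, ‖F (h, b)‖ₑ ^ p) ^ (q / p) *
    ENNReal.ofReal (h.scale ^ s / h.scale ^ (d + 3)) ∂(H.lebesgue d)) ^ (1 / q)

/-- The space `L^{p,q}_s(G)` of measurable functions of finite norm. -/
def mixedLp (d : ℕ) (p q s : ℝ) : Set (H d × E d → ℂ) :=
  {F | Measurable F ∧ mixedNorm p q s F < ⊤}

/-- The norm `‖W_u(Φ)‖_{L^{p,q}_s}` of the coorbit space. -/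
def coorbitNorm {d : ℕ} (u : ConeSchwartz d) (p q s : ℝ) (Φ : ConeDual d) : ℝ≥0∞ :=
  mixedNorm p q s (voice u Φ)

/-- The coorbit space `Co_{S_Λ}^u L^{p,q}_s(G)`. -/
def coorbitSpace {d : ℕ} (u : ConeSchwartz d) (p q s : ℝ) : Set (ConeDual d) :=
  {Φ | voice u Φ ∈ mixedLp d p q s}

/-! ### Whitney covers and Littlewood–Paley decompositions -/

/-- The `K`-invariant ball `B_r(e) = K exp(V_r) e`, with `exp(σ, τ) = e^σ a_τ` and
`V_r` the disc of radius `r`. -/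
def baseBall (d : ℕ) (r : ℝ) : Set (E d) :=
  {x | ∃ k ∈ Matrix.specialOrthogonalGroup (Fin (d + 1)) ℝ, ∃ σ τ : ℝ, σ ^ 2 + τ ^ 2 < r ^ 2 ∧
    x = Matrix.toEuclideanLin (kMat k * (Real.exp σ • aMat d τ)) (basePoint d)}

/-- The ball `B_r(w) = h B_r(e)`, where `w = h e` with `h ∈ H`. -/
def coneBall {d : ℕ} (r : ℝ) (w : E d) : Set (E d) :=
  {x | ∃ h : H d, h.act (basePoint d) = w ∧ x ∈ h.act '' baseBall d r}

/-- The balls `B_δ(w_j)` form a Whitney cover of the cone with lattice points `w_j`. -/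
structure IsWhitneyCover {d : ℕ} (δ : ℝ) (w : ℕ → E d) : Prop where
  mem : ∀ j, w j ∈ cone d
  disjoint : Pairwise fun i j => Disjoint (coneBall (δ / 2) (w i)) (coneBall (δ / 2) (w j))
  cover : cone d ⊆ ⋃ j, coneBall δ (w j)
  finite_overlap : ∃ N : ℕ, ∀ x ∈ cone d, {j | x ∈ coneBall δ (w j)}.encard ≤ N

/-- The `ψ_j ∈ S_Λ` form a Littlewood–Paley decomposition subordinate to the Whitney cover:
`ψ̃_j = φ_j / ∑_k φ_k` with `φ_j(x) = φ(g_j⁻¹ x)` and `w_j = g_j e`, for some smooth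
`φ` with values in `[0, 1]`, supported in `B_{2δ}(e)` and equal to `1` on `B_δ(e)`. -/
def IsLittlewoodPaley {d : ℕ} (δ : ℝ) (w : ℕ → E d) (ψ : ℕ → ConeSchwartz d) : Prop :=
  ∃ (φ : E d → ℝ) (g : ℕ → H d),
    ContDiff ℝ ∞ φ ∧ (∀ x, 0 ≤ φ x ∧ φ x ≤ 1) ∧
    tsupport φ ⊆ baseBall d (2 * δ) ∧ (∀ x ∈ baseBall d δ, φ x = 1) ∧
    (∀ j, (g j).act (basePoint d) = w j) ∧
    ∀ j x, lorentzFourier (ψ j : 𝓢(E d, ℂ)) x =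
      ((φ ((g j).act.symm x) / ∑' k, φ ((g k).act.symm x) : ℝ) : ℂ)

/-! ### Convolution and the Besov spaces -/

/-- The Schwartz function `y ↦ conj (ψ (x - y))`. -/
def schwartzReflect {d : ℕ} (x : E d) (ψ : 𝓢(E d, ℂ)) : 𝓢(E d, ℂ) :=
  SchwartzMap.postcompCLM (𝕜 := ℝ) (Complex.conjCLE : ℂ →L[ℝ] ℂ)
    (SchwartzMap.compSubConstCLM ℝ x
      (SchwartzMap.compCLMOfContinuousLinearEquiv ℝ (ContinuousLinearEquiv.neg ℝ) ψ))

section aux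

variable {d : ℕ}

lemma schwartzReflect_apply (x : E d) (ψ : 𝓢(E d, ℂ)) (y : E d) :
    schwartzReflect x ψ y = (starRingEnd ℂ) (ψ (x - y)) := by
  rw [← neg_sub y x]; rfl

lemma schwartzReflect_mem (x : E d) {ψ : 𝓢(E d, ℂ)} (hψ : ψ ∈ ConeSchwartz d) :
    schwartzReflect x ψ ∈ ConeSchwartz d := by
  change tsupport _ ⊆ _ at hψ
  change tsupport _ ⊆ _
  rw [tsupport_fourier_iff] at hψ ⊢
  intro w hw
  have h0 := (mul_eq_zero.mp (hψ w hw)).resolve_left (const_ne_zero d)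
  unfold lorentzFourier
  rw [mul_eq_zero]
  right
  rw [← integral_sub_left_eq_self _ volume x]
  have key : ∀ y : E d, schwartzReflect x ψ (x - y) *
      Complex.exp (-(Complex.I * (lorentzForm (x - y) w : ℂ))) =
      Complex.exp (-(Complex.I * (lorentzForm x w : ℂ))) *
      (starRingEnd ℂ) (ψ y * Complex.exp (-(Complex.I * (lorentzForm y w : ℂ)))) := by
    intro y
    rw [schwartzReflect_apply, sub_sub_cancel, sub_eq_add_neg, lorentzForm_add_left,
      lorentzForm_neg_left, map_mul, ← Complex.exp_conj]
    push_cast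
    rw [mul_add, neg_add, Complex.exp_add]
    simp only [map_neg, map_mul, Complex.conj_I, Complex.conj_ofReal]
    ring_nf
  simp_rw [key]
  rw [integral_const_mul, integral_conj, h0, map_zero, mul_zero]

end aux

/-- The convolution of `f ∈ S_Λ'` with `ψ ∈ S_Λ`:
`(f * ψ)(x) = ⟨f, conj (ψ (x - ·))⟩`, that is `∫ f(y) ψ(x - y) dy` for a function `f`. -/
def convolve {d : ℕ} (f : ConeDual d) (ψ : ConeSchwartz d) (x : E d) : ℂ :=
  f ⟨schwartzReflect x ψ, schwartzReflect_mem x ψ.2⟩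

/-- `‖f‖_{B^{p,q}_s} = (∑_j Det(w_j)^{-s} ‖f * ψ_j‖_p^q)^{1/q}`. -/
def besovNorm {d : ℕ} (w : ℕ → E d) (ψ : ℕ → ConeSchwartz d) (p q s : ℝ) (f : ConeDual d) : ℝ≥0∞ :=
  (∑' j, ENNReal.ofReal (coneDet (w j) ^ (-s)) *
    eLpNorm (convolve f (ψ j)) (ENNReal.ofReal p) volume ^ q) ^ (1 / q)

/-- The Besov space `B^{p,q}_s` on the cone. -/
def besovSpace {d : ℕ} (w : ℕ → E d) (ψ : ℕ → ConeSchwartz d) (p q s : ℝ) : Set (ConeDual d) :=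
  {f | besovNorm w ψ p q s f < ⊤}

end LightCone

end

open LightCone

open LightCone

noncomputable section

open Filter Topology FourierTransform

/-! Everything is moved to the frequency side. After conjugation, Hahn–Banach and the inverse
transform, a functional `f` on `S_Λ` has the form f(u) = L(conj ũ) with `L` continuous and linear on
the whole Schwartz space (`exists_functional`). Write `multiplier L m` for the function x ↦
L(e^{iB(x,·)} m). Then f * ψ_j is the multiplier with symbol ψ̃_j = `partitionFn φ g j`. With v =
conj ũ, W_u(f)(h, ·) is γ^{n/2} times the multiplier with symbol v ∘ q⁻¹, where q = γ⁻¹ a_t n_c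
(`convolve_eq_multiplier`, `voice_eq_multiplier`). In the variable q the measure dγ dt dc / γ is a
left Haar measure, and the remaining powers of γ collect to Det(qe)^{-σ} with σ = s + nq/2 - n. The
theorem thus compares the integral over q of Det(qe)^{-σ} ‖multiplier of v ∘ q⁻¹‖_p^q with the same
expression summed over the partition of unity.

One analytic fact drives both inequalities (`eLpNorm_multiplier_mul_act_le`): multiplying a symbol
by m ∘ q⁻¹ convolves with the image of an L¹ function under a linear map, so the L^p norm grows at
most by the L¹ norm of that function, which does not depend on q. The members of the partition sum
to 1 on the cone, so v ∘ q⁻¹ is controlled by those members with g_j⁻¹ q in a fixed compact set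
(`exists_translate_le`). Conversely, a member is a sum over l of v ∘ (g_j r l)⁻¹ times a quotient
with denominator Σ |v ∘ k⁻¹|². After translation by g_j these quotients form a relatively compact
family of Schwartz functions, so one constant serves all j (`exists_partitionFn_le`).

The disjoint half-balls bound the number of relevant j (`exists_card_le`). Hölder's inequality,
invariance of Haar measure and multiplicativity of the weight then pass from the local bounds to the
norms (`exists_lintegral_le_tsum`, `exists_tsum_le_lintegral`). The extension `L` is not unique, but
no constant depends on it. -/

namespace LightCone

/-! ### Continuous functionals on the Schwartz space commute with integrals. -/

section Exchange

variable {X : Type*} [NormedAddCommGroup X] [NormedSpace ℝ X]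

/-- The values of `l`-th derivatives, as a normed space. -/
def DerivSpace (X : Type*) [NormedAddCommGroup X] [NormedSpace ℝ X] (l : ℕ) : Type _ :=
  X [×l]→L[ℝ] ℂ

instance (l : ℕ) : NormedAddCommGroup (DerivSpace X l) :=
  inferInstanceAs (NormedAddCommGroup (X [×l]→L[ℝ] ℂ))

instance (l : ℕ) : NormedSpace ℝ (DerivSpace X l) :=
  inferInstanceAs (NormedSpace ℝ (X [×l]→L[ℝ] ℂ))

instance (l : ℕ) : NormedSpace ℂ (DerivSpace X l) :=
  inferInstanceAs (NormedSpace ℂ (X [×l]→L[ℝ] ℂ))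

instance (l : ℕ) : CompleteSpace (DerivSpace X l) :=
  inferInstanceAs (CompleteSpace (X [×l]→L[ℝ] ℂ))

/-- The `l`-th derivative. -/
def nthDeriv (l : ℕ) (g : X → ℂ) (x : X) : DerivSpace X l := iteratedFDeriv ℝ l g x

lemma continuous_nthDeriv (l : ℕ) (g : 𝓢(X, ℂ)) : Continuous (nthDeriv l g) :=
  (g.smooth ⊤).continuous_iteratedFDeriv (m := l) (by exact_mod_cast le_top)

lemma nthDeriv_add (l : ℕ) (f g : 𝓢(X, ℂ)) (x : X) :
    nthDeriv l ⇑(f + g) x = nthDeriv l f x + nthDeriv l g x := by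
  rw [FunLike.coe_add]
  exact iteratedFDeriv_add_apply ((f.smooth ⊤).contDiffAt.of_le (by exact_mod_cast le_top))
    ((g.smooth ⊤).contDiffAt.of_le (by exact_mod_cast le_top))

lemma nthDeriv_smul (l : ℕ) (a : ℂ) (f : 𝓢(X, ℂ)) (x : X) :
    nthDeriv l ⇑(a • f) x = a • nthDeriv l f x := by
  rw [FunLike.coe_smul]
  exact iteratedFDeriv_const_smul_apply
    ((f.smooth ⊤).contDiffAt.of_le (by exact_mod_cast le_top))

/-- The derivative of the `l`-th derivative, as an `(l+1)`-st derivative. -/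
def derivCurry (l : ℕ) : (X →L[ℝ] DerivSpace X l) ≃ₗᵢ[ℝ] DerivSpace X (l + 1) :=
  (continuousMultilinearCurryLeftEquiv ℝ (fun _ : Fin (l + 1) => X) ℂ).symm

/-- Values as derivatives of order zero. -/
def derivZero : ℂ ≃ₗᵢ[ℝ] DerivSpace X 0 := (continuousMultilinearCurryFin0 ℝ X ℂ).symm

lemma nthDeriv_zero (g : X → ℂ) (x : X) : nthDeriv 0 g x = derivZero (g x) := rfl

lemma nthDeriv_succ (l : ℕ) (g : X → ℂ) (x : X) :
    nthDeriv (l + 1) g x = derivCurry l (fderiv ℝ (nthDeriv l g) x) := rfl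

/-- The bounded function `x ↦ ‖x‖ ^ k • D^l g (x)`. -/
def jetComponent (i : ℕ × ℕ) :
    𝓢(X, ℂ) →L[ℂ] BoundedContinuousFunction X (DerivSpace X i.2) :=
  SchwartzMap.mkCLMtoNormedSpace
    (fun g => BoundedContinuousFunction.ofNormedAddCommGroup
      (fun x => ‖x‖ ^ i.1 • nthDeriv i.2 g x)
      ((continuous_norm.pow _).smul (continuous_nthDeriv _ g))
      (SchwartzMap.seminorm ℂ i.1 i.2 g) (fun x => by
        rw [norm_smul, norm_pow, norm_norm]
        exact g.le_seminorm ℂ i.1 i.2 x))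
    (fun f g => by
      ext1 x
      change ‖x‖ ^ i.1 • nthDeriv i.2 (⇑(f + g)) x =
        ‖x‖ ^ i.1 • nthDeriv i.2 f x + ‖x‖ ^ i.1 • nthDeriv i.2 g x
      rw [nthDeriv_add, smul_add])
    (fun a f => by
      ext1 x
      change ‖x‖ ^ i.1 • nthDeriv i.2 (⇑(a • f)) x = a • (‖x‖ ^ i.1 • nthDeriv i.2 f x)
      rw [nthDeriv_smul, smul_comm])
    ⟨{i}, 1, zero_le_one, fun f => by
      rw [Finset.sup_singleton, one_mul]
      exact BoundedContinuousFunction.norm_ofNormedAddCommGroup_le _ (apply_nonneg _ _) _⟩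

lemma jetComponent_apply (i : ℕ × ℕ) (g : 𝓢(X, ℂ)) (x : X) :
    jetComponent i g x = ‖x‖ ^ i.1 • nthDeriv i.2 g x := rfl

lemma seminorm_le_norm_jetComponent (i : ℕ × ℕ) (g : 𝓢(X, ℂ)) :
    schwartzSeminormFamily ℂ X ℂ i g ≤ ‖jetComponent i g‖ := by
  refine g.seminorm_le_bound ℂ i.1 i.2 (norm_nonneg _) fun x => ?_
  have := (jetComponent i g).norm_coe_le_norm x
  rwa [jetComponent_apply, norm_smul, norm_pow, norm_norm] at this

lemma norm_jetComponent_le (i : ℕ × ℕ) (g : 𝓢(X, ℂ)) :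
    ‖jetComponent i g‖ ≤ SchwartzMap.seminorm ℂ i.1 i.2 g := by
  refine (BoundedContinuousFunction.norm_le (apply_nonneg _ _)).2 fun x => ?_
  rw [jetComponent_apply, norm_smul, norm_pow, norm_norm]
  exact g.le_seminorm ℂ i.1 i.2 x

/-- Finitely many weighted derivatives of a Schwartz function. -/
def jet (s : Finset (ℕ × ℕ)) :
    𝓢(X, ℂ) →L[ℂ] ((i : s) → BoundedContinuousFunction X (DerivSpace X i.1.2)) :=
  ContinuousLinearMap.pi fun i => jetComponent i.1

/-- A continuous functional on the Schwartz space factors through finitely many weighted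
derivatives. -/
lemma exists_eq_comp_jet (L : 𝓢(X, ℂ) →L[ℂ] ℂ) :
    ∃ (s : Finset (ℕ × ℕ))
      (g : ((i : s) → BoundedContinuousFunction X (DerivSpace X i.1.2)) →L[ℂ] ℂ),
      ∀ u, L u = g (jet s u) := by
  -- Continuity of `L` means a bound by finitely many Schwartz seminorms, and each of these is
  -- dominated by the sup norm of a component of the jet.
  obtain ⟨s, C, -, hC⟩ := Seminorm.bound_of_continuous (schwartz_withSeminorms ℂ X ℂ)
    L.toSeminorm L.continuous.norm
  have hb : ∀ u, ‖L u‖ ≤ C * ‖jet s u‖ := fun u => by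
    refine (hC u).trans ?_
    change (C : ℝ) * _ ≤ _
    refine mul_le_mul_of_nonneg_left ?_ C.2
    refine Seminorm.finset_sup_apply_le (norm_nonneg _) fun i hi => ?_
    exact (seminorm_le_norm_jetComponent i u).trans (norm_le_pi_norm (jet s u) ⟨i, hi⟩)
  -- The bound makes `L` vanish on the kernel of the jet, so it factors algebraically through it.
  -- Hahn–Banach then replaces the factor by one that is bounded on the whole Banach space.
  have hker : (L : 𝓢(X, ℂ) →ₗ[ℂ] ℂ) ∈ LinearMap.range
      (LinearMap.dualMap (jet (X := X) s).toLinearMap) := by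
    rw [LinearMap.range_dualMap_eq_dualAnnihilator_ker, Submodule.mem_dualAnnihilator]
    intro u hu
    have hu' : jet s u = 0 := hu
    have := hb u
    rw [hu', norm_zero, mul_zero] at this
    exact norm_le_zero_iff.1 this
  obtain ⟨g₀, hg₀⟩ := hker
  have hg₀' : ∀ u, g₀ (jet s u) = L u := fun u => LinearMap.congr_fun hg₀ u
  obtain ⟨g, hg, hgb⟩ := Module.Dual.exists_extension_of_le_seminorm (𝕜 := ℂ)
    (LinearMap.range (jet (X := X) s).toLinearMap)
    (g₀.domRestrict _) (p := C • normSeminorm ℂ _) (by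
      rintro ⟨_, u, rfl⟩
      change ‖g₀ (jet s u)‖ ≤ C * ‖jet s u‖
      rw [hg₀']
      exact hb u)
  refine ⟨s, g.mkContinuous C hgb, fun u => ?_⟩
  rw [← hg₀']
  exact (hg ⟨jet s u, u, rfl⟩).symm

variable {Y : Type*} [TopologicalSpace Y] [MeasurableSpace Y]
  [OpensMeasurableSpace Y] [SecondCountableTopology Y] {μ : Measure Y}

lemma integrable_jetComponent {Φ : Y → 𝓢(X, ℂ)} (hc : Continuous Φ)
    (hi : ∀ i : ℕ × ℕ, ∃ b : Y → ℝ, Integrable b μ ∧ ∀ y, SchwartzMap.seminorm ℂ i.1 i.2 (Φ y) ≤ b y)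
    (i : ℕ × ℕ) : Integrable (fun y => jetComponent i (Φ y)) μ := by
  obtain ⟨b, hb, hb'⟩ := hi i
  refine hb.mono' ((jetComponent i).continuous.comp hc).aestronglyMeasurable ?_
  exact Eventually.of_forall fun y => (norm_jetComponent_le i _).trans (hb' y)

/-- Induction on the order, differentiating under the integral sign. The bound for the seminorm of
index `(0, l + 1)` is uniform in `x`, hence dominates the differentiated integrand. -/
lemma nthDeriv_integral {Φ : Y → 𝓢(X, ℂ)} (hc : Continuous Φ)
    (hi : ∀ i : ℕ × ℕ, ∃ b : Y → ℝ, Integrable b μ ∧ ∀ y, SchwartzMap.seminorm ℂ i.1 i.2 (Φ y) ≤ b y)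
    (l : ℕ) (x : X) : nthDeriv l (fun x => ∫ y, Φ y x ∂μ) x = ∫ y, nthDeriv l (Φ y) x ∂μ := by
  have hcl : ∀ (l : ℕ) (x : X), Continuous fun y => nthDeriv l (Φ y) x := fun l x => by
    have h1 := ((jetComponent (0, l)).continuous.comp hc)
    have h2 := (BoundedContinuousFunction.evalCLM ℝ (β := DerivSpace X l) x).continuous.comp h1
    refine h2.congr fun y => ?_
    change jetComponent (0, l) (Φ y) x = _
    rw [jetComponent_apply, pow_zero, one_smul]
  have hbd : ∀ (l : ℕ) (g : 𝓢(X, ℂ)) (x : X), ‖nthDeriv l g x‖ ≤ SchwartzMap.seminorm ℂ 0 l g :=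
    fun l g x => g.norm_iteratedFDeriv_le_seminorm ℂ l x
  have hil : ∀ (l : ℕ) (x : X), Integrable (fun y => nthDeriv l (Φ y) x) μ := fun l x => by
    obtain ⟨b, hb, hb'⟩ := hi (0, l)
    exact hb.mono' (hcl l x).aestronglyMeasurable
      (Eventually.of_forall fun y => (hbd l _ x).trans (hb' y))
  induction l generalizing x with
  | zero =>
    simp only [nthDeriv_zero]
    exact (derivZero.toContinuousLinearEquiv.integral_comp_comm _).symm
  | succ l ih =>
    rw [nthDeriv_succ, funext ih]
    obtain ⟨b, hb, hb'⟩ := hi (0, l + 1)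
    have hfd : ∀ y x, HasFDerivAt (nthDeriv l (Φ y)) (fderiv ℝ (nthDeriv l (Φ y)) x) x :=
      fun y x => ((((Φ y).smooth ⊤).differentiable_iteratedFDeriv (m := l)
        (by exact_mod_cast WithTop.coe_lt_top _)) x).hasFDerivAt
    have hff : ∀ x, (fun y => fderiv ℝ (nthDeriv l (Φ y)) x)
        = fun y => (derivCurry l).symm (nthDeriv (l + 1) (Φ y) x) := fun x => by
      ext1 y; rw [nthDeriv_succ, LinearIsometryEquiv.symm_apply_apply]
    have key := hasFDerivAt_integral_of_dominated_of_fderiv_le (μ := μ) (𝕜 := ℝ)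
      (F := fun x y => nthDeriv l (Φ y) x)
      (F' := fun x y => fderiv ℝ (nthDeriv l (Φ y)) x) (x₀ := x) (s := Set.univ)
      (bound := b) Filter.univ_mem
      (Eventually.of_forall fun x => (hcl l x).aestronglyMeasurable) (hil l x)
      (by rw [hff]
          exact ((derivCurry l).symm.continuous.comp (hcl (l + 1) x)).aestronglyMeasurable)
      (Eventually.of_forall fun y x _ => by
        have := (hbd (l + 1) (Φ y) x).trans (hb' y)
        rwa [nthDeriv_succ, LinearIsometryEquiv.norm_map] at this) hb
      (Eventually.of_forall fun y x _ => hfd y x)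
    rw [key.fderiv]
    simp only [nthDeriv_succ]
    exact ((derivCurry l).toContinuousLinearEquiv.integral_comp_comm _).symm

/-- Continuous functionals on the Schwartz space commute with weak integrals. -/
lemma functional_integral (L : 𝓢(X, ℂ) →L[ℂ] ℂ) {Φ : Y → 𝓢(X, ℂ)} (hc : Continuous Φ)
    (hi : ∀ i : ℕ × ℕ, ∃ b : Y → ℝ, Integrable b μ ∧ ∀ y, SchwartzMap.seminorm ℂ i.1 i.2 (Φ y) ≤ b y)
    (Ψ : 𝓢(X, ℂ)) (hΨ : ∀ x, Ψ x = ∫ y, Φ y x ∂μ) : L Ψ = ∫ y, L (Φ y) ∂μ := by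
  obtain ⟨s, g, hg⟩ := exists_eq_comp_jet L
  -- The Bochner integral is taken in the Banach space of jets, where it commutes with `g`. It
  -- remains to identify its components with the weighted derivatives of `Ψ`.
  have hint : Integrable (fun y => jet s (Φ y)) μ :=
    Integrable.of_eval fun i => integrable_jetComponent hc hi i.1
  simp only [hg]
  rw [g.integral_comp_comm hint]
  congr 1
  ext i x : 2
  have h1 : (∫ y, jet s (Φ y) ∂μ) i = ∫ y, jetComponent i.1 (Φ y) ∂μ :=
    ((ContinuousLinearMap.proj (R := ℂ)
      (φ := fun i : s => BoundedContinuousFunction X (DerivSpace X i.1.2)) i).integral_comp_comm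
      hint).symm
  have h2 : (∫ y, jetComponent i.1 (Φ y) ∂μ) x = ∫ y, jetComponent i.1 (Φ y) x ∂μ :=
    ((BoundedContinuousFunction.evalCLM ℝ (β := DerivSpace X i.1.2) x).integral_comp_comm
      (integrable_jetComponent hc hi i.1)).symm
  rw [h1, h2]
  change jetComponent i.1 Ψ x = _
  simp only [jetComponent_apply]
  rw [integral_smul]
  have h3 : (Ψ : X → ℂ) = fun x => ∫ y, Φ y x ∂μ := funext hΨ
  rw [h3, nthDeriv_integral hc hi]

end Exchange

/-! ### Smooth compactly supported families as continuous families of Schwartz functions. -/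

section Smooth

variable {X : Type*} [NormedAddCommGroup X] [NormedSpace ℝ X]

open Classical in
/-- A smooth compactly supported function as a Schwartz function (`0` for other functions). -/
def toSchwartz (m : X → ℂ) : 𝓢(X, ℂ) :=
  if h : HasCompactSupport m ∧ ContDiff ℝ ∞ m then h.1.toSchwartzMap h.2 else 0

lemma toSchwartz_apply {m : X → ℂ} (h : HasCompactSupport m) (h' : ContDiff ℝ ∞ m) (x : X) :
    toSchwartz m x = m x := by
  rw [toSchwartz, dif_pos ⟨h, h'⟩]; rfl

lemma coe_toSchwartz {m : X → ℂ} (h : HasCompactSupport m) (h' : ContDiff ℝ ∞ m) :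
    ⇑(toSchwartz m) = m := funext (toSchwartz_apply h h')

variable {V : Type*} [NormedAddCommGroup V] [NormedSpace ℝ V]

lemma contDiff_slice {M : V × X → ℂ} (hM : ContDiff ℝ ∞ M) (p : V) :
    ContDiff ℝ ∞ fun w => M (p, w) :=
  hM.comp (contDiff_const.prodMk contDiff_id)

/-- The partial derivatives are the full derivatives of `M` restricted to the second factor, and
these are jointly continuous. -/
lemma continuous_iteratedFDeriv_slice {M : V × X → ℂ} (hM : ContDiff ℝ ∞ M) (l : ℕ) :
    Continuous fun z : V × X => iteratedFDeriv ℝ l (fun w => M (z.1, w)) z.2 := by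
  have key : ∀ z : V × X, iteratedFDeriv ℝ l (fun w => M (z.1, w)) z.2 =
      (iteratedFDeriv ℝ l M z).compContinuousLinearMap
        (fun _ => ContinuousLinearMap.inr ℝ V X) := by
    rintro ⟨p, w⟩
    have h1 : (fun w => M (p, w)) = (fun z => M ((p, 0) + z)) ∘ ContinuousLinearMap.inr ℝ V X := by
      ext w; simp
    have h2 : ContDiff ℝ l fun z : V × X => M ((p, 0) + z) :=
      (hM.of_le (by exact_mod_cast le_top)).comp (contDiff_const.add contDiff_id)
    rw [h1, ContinuousLinearMap.iteratedFDeriv_comp_right _ h2 _ le_rfl,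
      iteratedFDeriv_comp_add_left]
    simp
  simp only [key]
  exact (ContinuousMultilinearMap.compContinuousLinearMapL (F := ℂ)
    (fun _ : Fin l => ContinuousLinearMap.inr ℝ V X)).continuous.comp
    (hM.continuous_iteratedFDeriv (by exact_mod_cast le_top))

/-- A jointly smooth family of functions with locally uniformly compact supports is a continuous
family of Schwartz functions. -/
lemma continuous_toSchwartz {Y : Type*} [TopologicalSpace Y] {M : V × X → ℂ}
    (hM : ContDiff ℝ ∞ M) {α : Y → V} (hα : Continuous α)
    (hK : ∀ y₀, ∃ K : Set X, IsCompact K ∧ ∀ᶠ y in 𝓝 y₀, ∀ w ∉ K, M (α y, w) = 0) :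
    Continuous fun y => toSchwartz fun w => M (α y, w) := by
  rw [continuous_iff_continuousAt]
  intro y₀
  obtain ⟨K, hKc, hKs⟩ := hK y₀
  have hcs : ∀ y, (∀ w ∉ K, M (α y, w) = 0) → HasCompactSupport fun w => M (α y, w) :=
    fun y hy => HasCompactSupport.intro hKc hy
  rw [ContinuousAt, (schwartz_withSeminorms ℂ X ℂ).tendsto_nhds]
  rintro ⟨k, l⟩ ε hε
  obtain ⟨R, hR0, hR⟩ : ∃ R : ℝ, 0 < R ∧ ∀ w ∈ K, ‖w‖ ^ k ≤ R := by
    obtain ⟨R, hR⟩ := (hKc.image (continuous_norm.pow k)).bddAbove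
    refine ⟨max R 1, by positivity, fun w hw => (hR ⟨w, hw, rfl⟩).trans (le_max_left _ _)⟩
  let D : Y → X → X [×l]→L[ℝ] ℂ := fun y w => iteratedFDeriv ℝ l (fun w => M (α y, w)) w
  have hD : Continuous fun z : Y × X => D z.1 z.2 :=
    (continuous_iteratedFDeriv_slice hM l).comp
      ((hα.comp continuous_fst).prodMk continuous_snd)
  -- The difference vanishes at `y = y₀`, so compactness of `K` makes it uniformly small for `y`
  -- near `y₀`. The factor `R` pays for the weight `‖w‖ ^ k` on `K`; off `K` both derivatives
  -- vanish.
  have hunif : ∀ᶠ y in 𝓝 y₀, ∀ w ∈ K, ‖D y w - D y₀ w‖ < ε / (2 * R) := by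
    refine hKc.eventually_forall_of_forall_eventually fun w _ => ?_
    have h1 : Continuous fun z : Y × X => ‖D z.1 z.2 - D y₀ z.2‖ :=
      (hD.sub (hD.comp (continuous_const.prodMk continuous_snd))).norm
    have h2 := h1.continuousAt (x := (y₀, w))
    refine h2.eventually_lt continuousAt_const ?_
    simp only [sub_self, norm_zero]
    positivity
  filter_upwards [hKs, hunif] with y hy hu
  have hy₀ := hKs.self_of_nhds
  have hd : ∀ w, iteratedFDeriv ℝ l (⇑(toSchwartz (fun w => M (α y, w)) -
      toSchwartz (fun w => M (α y₀, w)))) w = D y w - D y₀ w := fun w => by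
    rw [FunLike.coe_sub, iteratedFDeriv_sub_apply,
      coe_toSchwartz (hcs y hy) (contDiff_slice hM _),
      coe_toSchwartz (hcs y₀ hy₀) (contDiff_slice hM _)]
    · exact ((SchwartzMap.smooth _ ⊤).contDiffAt.of_le (by exact_mod_cast le_top))
    · exact ((SchwartzMap.smooth _ ⊤).contDiffAt.of_le (by exact_mod_cast le_top))
  have hz : ∀ y, (∀ w ∉ K, M (α y, w) = 0) → ∀ w ∉ K, D y w = 0 := fun y hy w hw => by
    have hsup : tsupport (fun w => M (α y, w)) ⊆ K :=
      closure_minimal (fun w hw => by_contra fun h => hw (hy w h)) hKc.isClosed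
    by_contra h
    exact hw (hsup (support_iteratedFDeriv_subset l h))
  refine lt_of_le_of_lt (SchwartzMap.seminorm_le_bound ℂ k l _ (M := ε / 2) (by positivity)
    fun w => ?_) (half_lt_self hε)
  rw [hd]
  by_cases hw : w ∈ K
  · calc ‖w‖ ^ k * ‖D y w - D y₀ w‖ ≤ R * (ε / (2 * R)) :=
        mul_le_mul (hR w hw) (hu w hw).le (norm_nonneg _) hR0.le
      _ = ε / 2 := by field_simp
  · rw [hz y hy w hw, hz y₀ hy₀ w hw, sub_zero, norm_zero, mul_zero]
    positivity

end Smooth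

/-! ### Young's inequality along a map. -/

section Young

/-- This is Jensen's inequality for the measure with density `a`, unnormalised: the exponent `p - 1`
falls on its total mass. -/
lemma rpow_lintegral_mul_le {Y : Type*} [MeasurableSpace Y] {μ : Measure Y} {p : ℝ} (hp : 1 ≤ p)
    {a b : Y → ℝ≥0∞} (ha : Measurable a) (hb : Measurable b) :
    (∫⁻ y, a y * b y ∂μ) ^ p ≤ (∫⁻ y, a y ∂μ) ^ (p - 1) * ∫⁻ y, a y * b y ^ p ∂μ := by
  have hp0 : 0 < p := by linarith
  have h := eLpNorm'_le_eLpNorm'_mul_rpow_measure_univ (μ := μ.withDensity a) (f := b)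
    zero_lt_one hp hb.aestronglyMeasurable
  simp only [eLpNorm', enorm_eq_self, ENNReal.rpow_one, div_one, one_div,
    withDensity_apply _ MeasurableSet.univ, Measure.restrict_univ] at h
  rw [lintegral_withDensity_eq_lintegral_mul _ ha hb,
    lintegral_withDensity_eq_lintegral_mul _ ha (hb.pow_const p)] at h
  simp only [Pi.mul_apply] at h
  refine (ENNReal.rpow_le_rpow h hp0.le).trans_eq ?_
  rw [ENNReal.mul_rpow_of_nonneg _ _ hp0.le, ← ENNReal.rpow_mul, ← ENNReal.rpow_mul,
    inv_mul_cancel₀ hp0.ne', ENNReal.rpow_one, mul_comm, sub_mul, one_mul,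
    inv_mul_cancel₀ hp0.ne']

lemma eLpNorm_ofReal {X : Type*} [MeasurableSpace X] {μ : Measure X} {p : ℝ} (hp : 1 ≤ p)
    (F : X → ℂ) : eLpNorm F (ENNReal.ofReal p) μ = (∫⁻ x, ‖F x‖ₑ ^ p ∂μ) ^ (1 / p) := by
  have hp0 : 0 < p := by linarith
  rw [eLpNorm_eq_lintegral_rpow_enorm_toReal (by simpa using hp0) ENNReal.ofReal_ne_top,
    ENNReal.toReal_ofReal hp0.le]

/-- Young's inequality for the convolution with an integrable function along a map `G`. -/
lemma eLpNorm_integral_translate_le {X Y : Type*} [NormedAddCommGroup X] [MeasurableSpace X]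
    [BorelSpace X] [SecondCountableTopology X] {ν : Measure X} [ν.IsAddRightInvariant] [SFinite ν]
    [MeasurableSpace Y] {μ : Measure Y} [SFinite μ] {θ : Y → ℂ} (hθ : Measurable θ) {F : X → ℂ}
    (hF : Continuous F) {G : Y → X} (hG : Measurable G) {p : ℝ} (hp : 1 ≤ p) :
    eLpNorm (fun x => ∫ y, θ y * F (x - G y) ∂μ) (ENNReal.ofReal p) ν ≤
      eLpNorm θ 1 μ * eLpNorm F (ENNReal.ofReal p) ν := by
  have hp0 : 0 < p := by linarith
  have hFm := hF.measurable
  set A := ∫⁻ y, ‖θ y‖ₑ ∂μ with hA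
  -- Jensen with weight `‖θ‖` reduces the claim to an iterated integral. There translation by `G y`
  -- leaves the integral over `x` unchanged, so no Jacobian of `G` ever appears.
  have h1 : ∀ x, ‖∫ y, θ y * F (x - G y) ∂μ‖ₑ ^ p ≤
      A ^ (p - 1) * ∫⁻ y, ‖θ y‖ₑ * ‖F (x - G y)‖ₑ ^ p ∂μ := fun x => by
    refine (ENNReal.rpow_le_rpow (enorm_integral_le_lintegral_enorm _) hp0.le).trans ?_
    simp only [enorm_mul]
    exact rpow_lintegral_mul_le hp hθ.enorm (hFm.comp (measurable_const.sub hG)).enorm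
  have h2 : ∫⁻ x, ∫⁻ y, ‖θ y‖ₑ * ‖F (x - G y)‖ₑ ^ p ∂μ ∂ν = A * ∫⁻ x, ‖F x‖ₑ ^ p ∂ν := by
    rw [lintegral_lintegral_swap]
    · have : ∀ y, ∫⁻ x, ‖θ y‖ₑ * ‖F (x - G y)‖ₑ ^ p ∂ν = ‖θ y‖ₑ * ∫⁻ x, ‖F x‖ₑ ^ p ∂ν := fun y => by
        rw [lintegral_const_mul _ (by fun_prop)]
        rw [lintegral_sub_right_eq_self (fun x => ‖F x‖ₑ ^ p)]
      simp only [this]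
      rw [lintegral_mul_const _ hθ.enorm]
    · refine Measurable.aemeasurable ?_
      refine ((hθ.comp measurable_snd).enorm).mul (Measurable.pow_const ?_ _)
      exact (hFm.comp (measurable_fst.sub (hG.comp measurable_snd))).enorm
  rw [eLpNorm_ofReal hp, eLpNorm_ofReal hp, eLpNorm_one_eq_lintegral_enorm]
  calc (∫⁻ x, ‖∫ y, θ y * F (x - G y) ∂μ‖ₑ ^ p ∂ν) ^ (1 / p)
      ≤ (A ^ (p - 1) * (A * ∫⁻ x, ‖F x‖ₑ ^ p ∂ν)) ^ (1 / p) := by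
        refine ENNReal.rpow_le_rpow ?_ (by positivity)
        rw [← h2]
        refine (lintegral_mono h1).trans ?_
        rw [lintegral_const_mul'' _ ?_]
        refine (Measurable.lintegral_prod_right ?_).aemeasurable
        refine ((hθ.comp measurable_snd).enorm).mul (Measurable.pow_const ?_ _)
        exact (hFm.comp (measurable_fst.sub (hG.comp measurable_snd))).enorm
    _ = A * (∫⁻ x, ‖F x‖ₑ ^ p ∂ν) ^ (1 / p) := by
        have hAA : A ^ (p - 1) * A = A ^ p := by
          conv_lhs => rw [← ENNReal.rpow_one A, ← ENNReal.rpow_mul, one_mul,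
            ← ENNReal.rpow_add_of_nonneg _ _ (by linarith) zero_le_one]
          ring_nf
        rw [← mul_assoc, hAA, ENNReal.mul_rpow_of_nonneg _ _ (by positivity), ← ENNReal.rpow_mul,
          mul_one_div_cancel hp0.ne', ENNReal.rpow_one]

end Young

/-! ### Characters of the form `B` and multipliers. -/

section Phase

variable {d : ℕ}

/-- The reflection `J` with `B(x, w) = ⟪x, J w⟫`. -/
def signFlip (d : ℕ) : E d →L[ℝ] E d :=
  (2 : ℝ) • (EuclideanSpace.proj (Fin.last (d + 1))).smulRight (basePoint d) -
    ContinuousLinearMap.id ℝ (E d)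

lemma signFlip_apply_last (w : E d) : signFlip d w (Fin.last (d + 1)) = w (Fin.last (d + 1)) := by
  simp [signFlip, basePoint]; ring

lemma signFlip_apply_castSucc (w : E d) (i : Fin (d + 1)) :
    signFlip d w i.castSucc = -w i.castSucc := by
  simp [signFlip, basePoint, (Fin.castSucc_lt_last i).ne]

lemma signFlip_signFlip (w : E d) : signFlip d (signFlip d w) = w := by
  ext i
  refine Fin.lastCases ?_ (fun i => ?_) i
  · rw [signFlip_apply_last, signFlip_apply_last]
  · rw [signFlip_apply_castSucc, signFlip_apply_castSucc, neg_neg]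

lemma lorentzForm_eq_inner (x w : E d) : lorentzForm x w = inner ℝ x (signFlip d w) := by
  rw [PiLp.inner_apply, Fin.sum_univ_castSucc, signFlip_apply_last]
  simp only [signFlip_apply_castSucc, lorentzForm]
  simp [Finset.sum_neg_distrib, mul_comm]
  ring

/-- The functional `B(x, ·)`. -/
def lorentzCLM (x : E d) : E d →L[ℝ] ℝ := (innerSL ℝ x).comp (signFlip d)

lemma lorentzCLM_apply (x w : E d) : lorentzCLM x w = lorentzForm x w :=
  (lorentzForm_eq_inner x w).symm

lemma norm_lorentzCLM_le (x : E d) : ‖lorentzCLM x‖ ≤ ‖signFlip d‖ * ‖x‖ := by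
  refine (ContinuousLinearMap.opNorm_comp_le _ _).trans ?_
  rw [innerSL_apply_norm, mul_comm]

lemma contDiff_lorentzForm : ContDiff ℝ ∞ fun z : E d × E d => lorentzForm z.1 z.2 := by
  simp only [lorentzForm_eq_inner]
  exact contDiff_fst.inner ℝ ((signFlip d).contDiff.comp contDiff_snd)

/-- The character `w ↦ e^{i B(x, w)}`. -/
def phase (x w : E d) : ℂ := Complex.exp (Complex.I * (lorentzForm x w : ℂ))

lemma contDiff_phase : ContDiff ℝ ∞ fun z : E d × E d => phase z.1 z.2 :=
  (contDiff_const.mul (Complex.ofRealCLM.contDiff.comp contDiff_lorentzForm)).cexp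

lemma iteratedDeriv_exp_I (l : ℕ) :
    iteratedDeriv l (fun t : ℝ => Complex.exp (Complex.I * t)) =
      fun t : ℝ => Complex.I ^ l * Complex.exp (Complex.I * t) := by
  induction l with
  | zero => simp
  | succ l ih =>
    rw [iteratedDeriv_succ, ih]
    ext t
    have h : HasDerivAt (fun t : ℝ => Complex.exp (Complex.I * t))
        (Complex.exp (Complex.I * t) * (Complex.I * 1)) t :=
      ((Complex.ofRealCLM.hasDerivAt (x := t)).const_mul Complex.I).cexp
    rw [(h.const_mul _).deriv]
    ring

lemma norm_iteratedFDeriv_phase_le (x w : E d) (l : ℕ) :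
    ‖iteratedFDeriv ℝ l (phase x) w‖ ≤ (‖signFlip d‖ * ‖x‖) ^ l := by
  have h1 : phase x = (fun t : ℝ => Complex.exp (Complex.I * t)) ∘ lorentzCLM x := by
    ext w; simp [phase, lorentzCLM_apply]
  have h2 : ContDiff ℝ l fun t : ℝ => Complex.exp (Complex.I * t) :=
    (contDiff_const.mul Complex.ofRealCLM.contDiff).cexp
  rw [h1, ContinuousLinearMap.iteratedFDeriv_comp_right _ h2 _ le_rfl]
  refine (ContinuousMultilinearMap.norm_compContinuousLinearMap_le _ _).trans ?_
  rw [norm_iteratedFDeriv_eq_norm_iteratedDeriv, iteratedDeriv_exp_I, norm_mul, norm_pow,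
    Complex.norm_I, one_pow, one_mul, mul_comm Complex.I, Complex.norm_exp_ofReal_mul_I, one_mul,
    Finset.prod_const, Finset.card_univ, Fintype.card_fin]
  exact pow_le_pow_left₀ (norm_nonneg _) (norm_lorentzCLM_le x) l

/-- The convolution of the distribution with transform `L` and the function with transform `m`. -/
def multiplier (L : 𝓢(E d, ℂ) →L[ℂ] ℂ) (m : E d → ℂ) (x : E d) : ℂ :=
  L (toSchwartz fun w => phase x w * m w)

/-- Schwartz seminorms of twists by characters grow polynomially. -/
lemma seminorm_twist_le {m : E d → ℂ} (hm : HasCompactSupport m) (hm' : ContDiff ℝ ∞ m)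
    (k l : ℕ) : ∃ C : ℝ, 0 ≤ C ∧ ∀ (c : ℂ) (z : E d),
      SchwartzMap.seminorm ℂ k l (toSchwartz fun w => c * (phase z w * m w)) ≤
        C * (‖c‖ * (1 + ‖z‖) ^ l) := by
  -- The constants of Leibniz's rule: `i` derivatives fall on the character, each costing a factor
  -- `‖signFlip d‖ * ‖z‖`, and the other `l - i` fall on `m`.
  let a : ℕ → ℝ := fun i => l.choose i * (‖signFlip d‖ ^ i * SchwartzMap.seminorm ℂ k (l - i) (toSchwartz m))
  have ha : ∀ i, 0 ≤ a i := fun i => by positivity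
  refine ⟨∑ i ∈ Finset.range (l + 1), a i, Finset.sum_nonneg fun i _ => ha i, fun c z => ?_⟩
  have hph : ContDiff ℝ ∞ (phase z) := contDiff_phase.comp (contDiff_const.prodMk contDiff_id)
  have hcs : HasCompactSupport fun w => c * (phase z w * m w) := (hm.mul_left).mul_left
  have hcd : ContDiff ℝ ∞ fun w => phase z w * m w := hph.mul hm'
  refine SchwartzMap.seminorm_le_bound ℂ k l _
    (mul_nonneg (Finset.sum_nonneg fun i _ => ha i) (by positivity)) fun w => ?_
  rw [coe_toSchwartz hcs (contDiff_const.mul hcd)]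
  have h0 : ‖iteratedFDeriv ℝ l (fun w => c * (phase z w * m w)) w‖ =
      ‖c‖ * ‖iteratedFDeriv ℝ l (fun w => phase z w * m w) w‖ := by
    have := iteratedFDeriv_const_smul_apply (𝕜 := ℝ) (i := l) (x := w) (a := c)
      (f := fun w => phase z w * m w) (hcd.contDiffAt.of_le (by exact_mod_cast le_top))
    rw [← norm_smul, ← this]; rfl
  rw [h0, Finset.sum_mul]
  have h1 := norm_iteratedFDeriv_mul_le (n := l) (hph.of_le (by exact_mod_cast le_top))
    (hm'.of_le (by exact_mod_cast le_top)) w le_rfl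
  calc ‖w‖ ^ k * (‖c‖ * ‖iteratedFDeriv ℝ l (fun w => phase z w * m w) w‖)
      ≤ ‖w‖ ^ k * (‖c‖ * ∑ i ∈ Finset.range (l + 1), (l.choose i : ℝ) *
          ‖iteratedFDeriv ℝ i (phase z) w‖ * ‖iteratedFDeriv ℝ (l - i) m w‖) := by gcongr
    _ = ∑ i ∈ Finset.range (l + 1), (l.choose i : ℝ) * (‖iteratedFDeriv ℝ i (phase z) w‖ *
          (‖w‖ ^ k * ‖iteratedFDeriv ℝ (l - i) m w‖)) * ‖c‖ := by
        rw [Finset.mul_sum, Finset.mul_sum]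
        exact Finset.sum_congr rfl fun i _ => by ring
    _ ≤ ∑ i ∈ Finset.range (l + 1), a i * (‖c‖ * (1 + ‖z‖) ^ l) := by
        refine Finset.sum_le_sum fun i hi => ?_
        have hi' : i ≤ l := Nat.lt_succ_iff.1 (Finset.mem_range.1 hi)
        have hz : ‖z‖ ^ i ≤ (1 + ‖z‖) ^ l :=
          (pow_le_pow_left₀ (norm_nonneg _) (by linarith) i).trans
            (pow_le_pow_right₀ (by linarith [norm_nonneg z]) hi')
        have h2 : ‖w‖ ^ k * ‖iteratedFDeriv ℝ (l - i) m w‖ ≤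
            SchwartzMap.seminorm ℂ k (l - i) (toSchwartz m) := by
          have := (toSchwartz m).le_seminorm ℂ k (l - i) w
          rwa [coe_toSchwartz hm hm'] at this
        have h3 := norm_iteratedFDeriv_phase_le z w i
        rw [mul_pow] at h3
        calc (l.choose i : ℝ) * (‖iteratedFDeriv ℝ i (phase z) w‖ *
              (‖w‖ ^ k * ‖iteratedFDeriv ℝ (l - i) m w‖)) * ‖c‖
            ≤ l.choose i * ((‖signFlip d‖ ^ i * (1 + ‖z‖) ^ l) *
                SchwartzMap.seminorm ℂ k (l - i) (toSchwartz m)) * ‖c‖ := by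
              gcongr
              exact h3.trans (by gcongr)
          _ = _ := by simp only [a]; ring

lemma integrable_mul_one_add_norm_pow (θ : 𝓢(E d, ℂ)) (l : ℕ) :
    Integrable fun y => ‖θ y‖ * (1 + ‖y‖) ^ l := by
  have h1 := (θ.integrable (μ := volume)).norm
  have h2 := θ.integrable_pow_mul volume l
  refine ((h1.add h2).const_mul (2 ^ (l - 1))).mono' ?_ (Eventually.of_forall fun y => ?_)
  · have := θ.continuous
    exact Continuous.aestronglyMeasurable (by fun_prop)
  · rw [Real.norm_of_nonneg (by positivity)]
    have := add_pow_le zero_le_one (norm_nonneg y) l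
    rw [one_pow] at this
    calc ‖θ y‖ * (1 + ‖y‖) ^ l ≤ ‖θ y‖ * (2 ^ (l - 1) * (1 + ‖y‖ ^ l)) := by gcongr
      _ = _ := by simp only [Pi.add_apply]; ring

lemma continuous_multiplier_family (L : 𝓢(E d, ℂ) →L[ℂ] ℂ) {Y V : Type*} [TopologicalSpace Y]
    [NormedAddCommGroup V] [NormedSpace ℝ V] {M : V × E d → ℂ} (hM : ContDiff ℝ ∞ M)
    {α : Y → V} (hα : Continuous α)
    (hK : ∀ y₀, ∃ K : Set (E d), IsCompact K ∧ ∀ᶠ y in 𝓝 y₀, ∀ w ∉ K, M (α y, w) = 0)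
    {b : Y → E d} (hb : Continuous b) :
    Continuous fun y => multiplier L (fun w => M (α y, w)) (b y) := by
  -- Making the evaluation point part of the parameter reduces joint continuity to that of a single
  -- smooth family.
  let N : (V × E d) × E d → ℂ := fun z => phase z.1.2 z.2 * M (z.1.1, z.2)
  have h1 : ContDiff ℝ ∞ fun z : (V × E d) × E d => (z.1.2, z.2) := by fun_prop
  have h2 : ContDiff ℝ ∞ fun z : (V × E d) × E d => (z.1.1, z.2) := by fun_prop
  have hN : ContDiff ℝ ∞ N := ContDiff.mul (contDiff_phase.comp h1) (hM.comp h2)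
  have hs : ∀ y₀, ∃ K : Set (E d), IsCompact K ∧
      ∀ᶠ y in 𝓝 y₀, ∀ w ∉ K, N ((α y, b y), w) = 0 := fun y₀ => by
    obtain ⟨K, hK1, hK2⟩ := hK y₀
    refine ⟨K, hK1, hK2.mono fun y hy w hw => ?_⟩
    simp only [N, hy w hw, mul_zero]
  have hc : Continuous fun y => (α y, b y) := hα.prodMk hb
  have := continuous_toSchwartz hN hc hs
  exact L.continuous.comp this

lemma continuous_multiplier (L : 𝓢(E d, ℂ) →L[ℂ] ℂ) {m : E d → ℂ} (hm : HasCompactSupport m)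
    (hm' : ContDiff ℝ ∞ m) : Continuous (multiplier L m) :=
  continuous_multiplier_family L (V := ℝ) (M := fun z => m z.2) (hm'.comp contDiff_snd)
    (α := fun _ => 0) continuous_const
    (fun _ => ⟨tsupport m, hm, Eventually.of_forall fun _ _ hw => image_eq_zero_of_notMem_tsupport hw⟩)
    continuous_id

/-- A multiplier that is the transform of the image under `G` of an integrable function. -/
lemma multiplier_mul (L : 𝓢(E d, ℂ) →L[ℂ] ℂ) {m₁ m₂ : E d → ℂ} (hm₁ : HasCompactSupport m₁)
    (hm₁' : ContDiff ℝ ∞ m₁) (hm₂ : ContDiff ℝ ∞ m₂) (θ : 𝓢(E d, ℂ)) (G : E d →L[ℝ] E d)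
    (hθ : ∀ w, m₂ w = ∫ y, θ y * Complex.exp (-(Complex.I * (lorentzForm (G y) w : ℂ)))) (x : E d) :
    multiplier L (fun w => m₁ w * m₂ w) x = ∫ y, θ y * multiplier L m₁ (x - G y) := by
  -- The integrand is a smooth family in the parameters `(θ y, x - G y)`; the function `θ` enters
  -- only through its value, as a scalar.
  let N : (ℂ × E d) × E d → ℂ := fun z => z.1.1 * (phase z.1.2 z.2 * m₁ z.2)
  have hN : ContDiff ℝ ∞ N :=
    (contDiff_fst.comp contDiff_fst).mul
      ((contDiff_phase.comp ((contDiff_snd.comp contDiff_fst).prodMk contDiff_snd)).mul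
        (hm₁'.comp contDiff_snd))
  let α : E d → ℂ × E d := fun y => (θ y, x - G y)
  have hα : Continuous α := by have := θ.continuous; fun_prop
  have hΦc : Continuous fun y => toSchwartz fun w => N (α y, w) :=
    continuous_toSchwartz hN hα fun _ => ⟨tsupport m₁, hm₁, Eventually.of_forall fun y w hw => by
      simp only [N, image_eq_zero_of_notMem_tsupport hw, mul_zero]⟩
  have hΦcs : ∀ y, HasCompactSupport fun w => N (α y, w) := fun y => (hm₁.mul_left).mul_left
  have hph : ∀ z : E d, ContDiff ℝ ∞ (phase z) := fun z =>
    contDiff_phase.comp (contDiff_const.prodMk contDiff_id)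
  have key := functional_integral (μ := (volume : Measure (E d))) L hΦc ?_
    (toSchwartz fun w => phase x w * (m₁ w * m₂ w)) ?_
  · rw [multiplier, key]
    refine integral_congr_ae (Eventually.of_forall fun y => ?_)
    have : (toSchwartz fun w => N (α y, w)) = θ y • toSchwartz fun w => phase (x - G y) w * m₁ w := by
      ext w
      rw [toSchwartz_apply (hΦcs y) (contDiff_slice hN _), _root_.smul_apply,
        toSchwartz_apply (m := fun w => phase (x - G y) w * m₁ w) hm₁.mul_left ((hph _).mul hm₁')]
      rfl
    change L (toSchwartz fun w => N (α y, w)) = _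
    rw [this, map_smul, smul_eq_mul]; rfl
  · rintro ⟨k, l⟩
    obtain ⟨C, hC, hC'⟩ := seminorm_twist_le hm₁ hm₁' k l
    refine ⟨fun y => C * (1 + ‖x‖ + ‖G‖) ^ l * (‖θ y‖ * (1 + ‖y‖) ^ l),
      (integrable_mul_one_add_norm_pow θ l).const_mul _, fun y => ?_⟩
    refine (hC' (θ y) (x - G y)).trans ?_
    change _ ≤ C * (1 + ‖x‖ + ‖G‖) ^ l * (‖θ y‖ * (1 + ‖y‖) ^ l)
    rw [mul_assoc]
    refine mul_le_mul_of_nonneg_left ?_ hC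
    -- The polynomial growth of the seminorms in `x - G y` becomes growth in `y`, which the rapid
    -- decay of `θ` absorbs.
    have h1 : 1 + ‖x - G y‖ ≤ (1 + ‖x‖ + ‖G‖) * (1 + ‖y‖) := by
      have := norm_sub_le x (G y)
      have := G.le_opNorm y
      nlinarith [norm_nonneg x, norm_nonneg y, norm_nonneg G]
    calc ‖θ y‖ * (1 + ‖x - G y‖) ^ l ≤ ‖θ y‖ * ((1 + ‖x‖ + ‖G‖) * (1 + ‖y‖)) ^ l := by gcongr
      _ = _ := by rw [mul_pow]; ring
  · intro w
    rw [toSchwartz_apply (m := fun w => phase x w * (m₁ w * m₂ w)) hm₁.mul_right.mul_left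
      ((hph x).mul (hm₁'.mul hm₂)), hθ, ← integral_const_mul,
      ← integral_const_mul]
    refine integral_congr_ae (Eventually.of_forall fun y => ?_)
    change _ = toSchwartz (fun w => N (α y, w)) w
    rw [toSchwartz_apply (hΦcs y) (contDiff_slice hN _)]
    simp only [N, α, phase]
    rw [sub_eq_add_neg x, lorentzForm_add_left, lorentzForm_neg_left, Complex.ofReal_add, mul_add,
      Complex.exp_add]
    push_cast
    rw [mul_neg]
    ring

lemma eLpNorm_multiplier_mul_le (L : 𝓢(E d, ℂ) →L[ℂ] ℂ) {m₁ m₂ : E d → ℂ}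
    (hm₁ : HasCompactSupport m₁) (hm₁' : ContDiff ℝ ∞ m₁) (hm₂ : ContDiff ℝ ∞ m₂) (θ : 𝓢(E d, ℂ))
    (G : E d →L[ℝ] E d)
    (hθ : ∀ w, m₂ w = ∫ y, θ y * Complex.exp (-(Complex.I * (lorentzForm (G y) w : ℂ))))
    {p : ℝ} (hp : 1 ≤ p) :
    eLpNorm (multiplier L fun w => m₁ w * m₂ w) (ENNReal.ofReal p) volume ≤
      eLpNorm θ 1 volume * eLpNorm (multiplier L m₁) (ENNReal.ofReal p) volume := by
  rw [funext (multiplier_mul L hm₁ hm₁' hm₂ θ G hθ)]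
  exact eLpNorm_integral_translate_le θ.continuous.measurable (continuous_multiplier L hm₁ hm₁')
    G.continuous.measurable hp

end Phase

/-! ### The group in logarithmic coordinates, its Haar measure and its action. -/

/-- The group `ℝ₊ A N` in the logarithmic coordinates `(a, t, c)` of `e^a a_t n_c`. -/
def Par (d : ℕ) : Type := ℝ × ℝ × EuclideanSpace ℝ (Fin d)

namespace Par

variable {d : ℕ}

instance : TopologicalSpace (Par d) :=
  inferInstanceAs (TopologicalSpace (ℝ × ℝ × EuclideanSpace ℝ (Fin d)))
instance : T2Space (Par d) := inferInstanceAs (T2Space (ℝ × ℝ × EuclideanSpace ℝ (Fin d)))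
instance : LocallyCompactSpace (Par d) :=
  inferInstanceAs (LocallyCompactSpace (ℝ × ℝ × EuclideanSpace ℝ (Fin d)))
instance : SecondCountableTopology (Par d) :=
  inferInstanceAs (SecondCountableTopology (ℝ × ℝ × EuclideanSpace ℝ (Fin d)))
instance : MeasureSpace (Par d) :=
  inferInstanceAs (MeasureSpace (ℝ × ℝ × EuclideanSpace ℝ (Fin d)))
instance : BorelSpace (Par d) := inferInstanceAs (BorelSpace (ℝ × ℝ × EuclideanSpace ℝ (Fin d)))

/-- The coordinate `a`. -/
def logScale (p : Par d) : ℝ := p.1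
/-- The coordinate `t`. -/
def boost (p : Par d) : ℝ := p.2.1
/-- The coordinate `c`. -/
def shift (p : Par d) : EuclideanSpace ℝ (Fin d) := p.2.2

/-- The element with coordinates `a, t, c`. -/
def mk (a t : ℝ) (c : EuclideanSpace ℝ (Fin d)) : Par d := (a, t, c)

@[simp] lemma logScale_mk (a t : ℝ) (c : EuclideanSpace ℝ (Fin d)) : (mk a t c).logScale = a := rfl
@[simp] lemma boost_mk (a t : ℝ) (c : EuclideanSpace ℝ (Fin d)) : (mk a t c).boost = t := rfl
@[simp] lemma shift_mk (a t : ℝ) (c : EuclideanSpace ℝ (Fin d)) : (mk a t c).shift = c := rfl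

@[ext] lemma ext {p q : Par d} (h1 : p.logScale = q.logScale) (h2 : p.boost = q.boost)
    (h3 : p.shift = q.shift) : p = q := Prod.ext h1 (Prod.ext h2 h3)

lemma continuous_logScale : Continuous (logScale (d := d)) := continuous_fst
lemma continuous_boost : Continuous (boost (d := d)) := continuous_fst.comp continuous_snd
lemma continuous_shift : Continuous (shift (d := d)) := continuous_snd.comp continuous_snd

lemma continuous_mk {Y : Type*} [TopologicalSpace Y] {a t : Y → ℝ}
    {c : Y → EuclideanSpace ℝ (Fin d)} (ha : Continuous a) (ht : Continuous t)
    (hc : Continuous c) : Continuous fun y => mk (a y) (t y) (c y) :=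
  ha.prodMk (ht.prodMk hc)

/-- The law encodes n_c a_t = a_t n_{e^{-t}c} and n_c n_{c'} = n_{c+c'}; `act_mul` confirms it. -/
instance : Mul (Par d) where
  mul p q := mk (p.logScale + q.logScale) (p.boost + q.boost)
    (Real.exp (-q.boost) • p.shift + q.shift)
instance : One (Par d) where
  one := mk 0 0 0
instance : Inv (Par d) where
  inv p := mk (-p.logScale) (-p.boost) (-(Real.exp p.boost • p.shift))

@[simp] lemma logScale_mul (p q : Par d) : (p * q).logScale = p.logScale + q.logScale := rfl
@[simp] lemma boost_mul (p q : Par d) : (p * q).boost = p.boost + q.boost := rfl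
@[simp] lemma shift_mul (p q : Par d) :
    (p * q).shift = Real.exp (-q.boost) • p.shift + q.shift := rfl
@[simp] lemma logScale_one : (1 : Par d).logScale = 0 := rfl
@[simp] lemma boost_one : (1 : Par d).boost = 0 := rfl
@[simp] lemma shift_one : (1 : Par d).shift = 0 := rfl
@[simp] lemma logScale_inv (p : Par d) : p⁻¹.logScale = -p.logScale := rfl
@[simp] lemma boost_inv (p : Par d) : p⁻¹.boost = -p.boost := rfl
@[simp] lemma shift_inv (p : Par d) : p⁻¹.shift = -(Real.exp p.boost • p.shift) := rfl

instance : Group (Par d) :=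
  Group.ofLeftAxioms
    (fun p q r => by
      ext1
      · simp [add_assoc]
      · simp [add_assoc]
      · simp [smul_add, smul_smul, ← Real.exp_add, add_assoc])
    (fun p => by ext1 <;> simp)
    (fun p => by ext1 <;> simp [smul_smul, ← Real.exp_add])

instance : IsTopologicalGroup (Par d) where
  continuous_mul := by
    have h1 := continuous_logScale (d := d)
    have h2 := continuous_boost (d := d)
    have h3 := continuous_shift (d := d)
    exact continuous_mk (by fun_prop) (by fun_prop) (by fun_prop)
  continuous_inv := by
    have h1 := continuous_logScale (d := d)
    have h2 := continuous_boost (d := d)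
    have h3 := continuous_shift (d := d)
    exact continuous_mk (by fun_prop) (by fun_prop) (by fun_prop)

/-- Left translation shifts `a` and `t` and, for fixed `t`, translates `c`: a skew product of
translations preserves Lebesgue measure. Right translation dilates `c`, so for `d ≥ 1` the group is
not unimodular. -/
instance : (volume : Measure (Par d)).IsMulLeftInvariant where
  map_mul_left_eq_self g := by
    have h1 : MeasurePreserving (fun x : ℝ × EuclideanSpace ℝ (Fin d) =>
        (g.boost + x.1, Real.exp (-x.1) • g.shift + x.2)) volume volume := by
      refine (measurePreserving_add_left volume g.boost).skew_product
        (g := fun (t : ℝ) (c : EuclideanSpace ℝ (Fin d)) => Real.exp (-t) • g.shift + c)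
        (by fun_prop) (Eventually.of_forall fun t => ?_)
      exact map_add_left_eq_self volume _
    exact ((measurePreserving_add_left volume g.logScale).prod h1).map_eq

instance : (volume : Measure (Par d)).IsHaarMeasure where
  lt_top_of_isCompact K hK := by
    exact IsCompact.measure_lt_top (α := ℝ × ℝ × EuclideanSpace ℝ (Fin d)) (μ := volume) hK
  open_pos U hU h := by
    exact IsOpen.measure_ne_zero (X := ℝ × ℝ × EuclideanSpace ℝ (Fin d)) volume hU h

/-- The factor is the modular character. Its finiteness suffices, because right translations are
needed only by finitely many elements. -/
lemma exists_lintegral_mul_right (l : Par d) :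
    ∃ κ : ℝ≥0∞, κ ≠ ⊤ ∧ ∀ F : Par d → ℝ≥0∞, Measurable F → ∫⁻ p, F (p * l) = κ * ∫⁻ p, F p := by
  refine ⟨Measure.modularCharacterFun l, ENNReal.coe_ne_top, fun F hF => ?_⟩
  rw [← lintegral_map hF (measurable_mul_const l), Measure.map_right_mul_eq_modularCharacterFun_smul,
    lintegral_smul_measure]
  rfl

/-! ### The action on `ℝⁿ` -/

/-- The element of `H` with given logarithmic coordinates. -/
def toH (p : Par d) : H d := (⟨Real.exp p.logScale, Real.exp_pos _⟩, p.boost, p.shift)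

/-- The action of `e^a a_t n_c` on `ℝⁿ`. -/
def act (p : Par d) : E d ≃L[ℝ] E d := p.toH.act

lemma act_eq (p : Par d) (x : E d) : p.act x = WithLp.toLp 2 (Real.exp p.logScale •
    (aMat d p.boost *ᵥ (nMat p.shift *ᵥ x.ofLp))) := by
  rw [act, H.act_apply, H.mat, Matrix.smul_mulVec, ← Matrix.mulVec_mulVec]; rfl

lemma eq_of_coord {x y : E d} (h0 : x 0 = y 0)
    (hm : ∀ i : Fin d, x i.castSucc.succ = y i.castSucc.succ)
    (hl : x (Fin.last (d + 1)) = y (Fin.last (d + 1))) : x = y := by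
  ext i; exact congrFun (blk_ext h0 hm hl) i

/-- Beyond expanding ‖e^{-t}c + c'‖², the coordinates agree by e^{-t} = cosh t - sinh t and cosh² t
- sinh² t = 1, with `t` the boost of `q`. -/
lemma act_mul (p q : Par d) (x : E d) : (p * q).act x = p.act (q.act x) := by
  have hc := norm_sq_eq p.shift
  have hq := norm_sq_eq q.shift
  have hcs := Real.cosh_sq q.boost
  have hexp : Real.exp (-q.boost) = Real.cosh q.boost - Real.sinh q.boost :=
    (Real.cosh_sub_sinh _).symm
  have hn : ‖Real.exp (-q.boost) • p.shift + q.shift‖ ^ 2 =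
      Real.exp (-q.boost) ^ 2 * ‖p.shift‖ ^ 2 + 2 * Real.exp (-q.boost) *
        (∑ i, p.shift i * q.shift i) + ‖q.shift‖ ^ 2 := by
    rw [norm_sq_eq, hc, hq]
    simp only [Finset.mul_sum, ← Finset.sum_add_distrib, PiLp.add_apply, PiLp.smul_apply, smul_eq_mul]
    exact Finset.sum_congr rfl fun i _ => by ring
  have hs : ∑ i : Fin d, (Real.exp (-q.boost) • p.shift + q.shift) i * x i.castSucc.succ =
      Real.exp (-q.boost) * (∑ i, p.shift i * x i.castSucc.succ) +
        ∑ i, q.shift i * x i.castSucc.succ := by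
    simp only [Finset.mul_sum, ← Finset.sum_add_distrib, PiLp.add_apply, PiLp.smul_apply, smul_eq_mul]
    exact Finset.sum_congr rfl fun i _ => by ring
  have hs2 : ∑ i : Fin d, p.shift i * (Real.exp q.logScale * (x i.castSucc.succ -
      q.shift i * (x (Fin.last (d + 1)) - x 0))) = Real.exp q.logScale *
      ((∑ i, p.shift i * x i.castSucc.succ) - (∑ i, p.shift i * q.shift i) *
        (x (Fin.last (d + 1)) - x 0)) := by
    rw [Finset.sum_mul, ← Finset.sum_sub_distrib, Finset.mul_sum]
    exact Finset.sum_congr rfl fun i _ => by ring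
  refine eq_of_coord ?_ (fun i => ?_) ?_
  · simp only [act_eq, aMat_mulVec, nMat_mulVec, Pi.smul_apply, smul_eq_mul, blk_zero, blk_mid,
      blk_last, logScale_mul, boost_mul, shift_mul, hn, hs, hs2, Real.exp_add, Real.cosh_add,
      Real.sinh_add]
    rw [hexp]
    linear_combination (Real.exp p.logScale * Real.exp q.logScale *
      (Real.cosh p.boost + Real.sinh p.boost) *
      ((Real.cosh q.boost - Real.sinh q.boost) * ‖p.shift‖ ^ 2 / 2 * (x (Fin.last (d + 1)) - x 0) +
        (∑ i, p.shift i * q.shift i) * (x (Fin.last (d + 1)) - x 0) -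
        ∑ i, p.shift i * x i.castSucc.succ)) * hcs
  · simp only [act_eq, aMat_mulVec, nMat_mulVec, Pi.smul_apply, smul_eq_mul, blk_zero, blk_mid,
      blk_last, logScale_mul, shift_mul, Real.exp_add, PiLp.add_apply, PiLp.smul_apply]
    rw [hexp]
    ring
  · simp only [act_eq, aMat_mulVec, nMat_mulVec, Pi.smul_apply, smul_eq_mul, blk_zero, blk_mid,
      blk_last, logScale_mul, boost_mul, shift_mul, hn, hs, hs2, Real.exp_add, Real.cosh_add,
      Real.sinh_add]
    rw [hexp]
    linear_combination (Real.exp p.logScale * Real.exp q.logScale *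
      (Real.cosh p.boost + Real.sinh p.boost) *
      ((Real.cosh q.boost - Real.sinh q.boost) * ‖p.shift‖ ^ 2 / 2 * (x (Fin.last (d + 1)) - x 0) +
        (∑ i, p.shift i * q.shift i) * (x (Fin.last (d + 1)) - x 0) -
        ∑ i, p.shift i * x i.castSucc.succ)) * hcs

end Par

/-! ### Simple transitivity and properness of the action; the determinant. -/

section

namespace Par

variable {d : ℕ}

lemma act_one (x : E d) : (1 : Par d).act x = x := by
  have h := act_mul (1 : Par d) 1 x
  rw [one_mul] at h
  exact ((1 : Par d).act.injective h).symm

lemma act_inv (p : Par d) (x : E d) : p⁻¹.act x = p.act.symm x := by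
  rw [ContinuousLinearEquiv.eq_symm_apply, ← act_mul, mul_inv_cancel, act_one]

lemma act_inv_act (p : Par d) (x : E d) : p⁻¹.act (p.act x) = x := by
  rw [← act_mul, inv_mul_cancel, act_one]

lemma act_act_inv (p : Par d) (x : E d) : p.act (p⁻¹.act x) = x := by
  rw [← act_mul, mul_inv_cancel, act_one]

lemma lorentzForm_act (p : Par d) (x y : E d) :
    lorentzForm (p.act x) (p.act y) = Real.exp p.logScale ^ 2 * lorentzForm x y :=
  LightCone.lorentzForm_act p.toH x y

lemma act_mem_cone (p : Par d) {x : E d} (hx : x ∈ cone d) : p.act x ∈ cone d :=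
  LightCone.act_mem_cone p.toH hx

lemma continuous_actCLM : Continuous fun p : Par d => (p.act : E d →L[ℝ] E d) := by
  rw [continuous_clm_apply]
  intro x
  have h1 := continuous_logScale (d := d)
  have h2 := continuous_boost (d := d)
  have h3 := continuous_shift (d := d)
  have h4 : ∀ i, Continuous fun p : Par d => p.shift i := fun i =>
    (PiLp.continuous_apply 2 _ i).comp h3
  change Continuous fun p : Par d => p.act x
  simp only [act_eq]
  refine (PiLp.continuous_toLp 2 _).comp (continuous_pi fun i => ?_)
  simp only [aMat_mulVec, nMat_mulVec, Pi.smul_apply, smul_eq_mul, blk_zero, blk_mid, blk_last]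
  refine Continuous.mul (by fun_prop) ?_
  refine Fin.cases ?_ (fun j => ?_) i
  · simp only [blk_zero]; fun_prop
  · refine Fin.lastCases ?_ (fun k => ?_) j
    · simp only [Fin.succ_last, blk_last]; fun_prop
    · simp only [blk_mid]; fun_prop

lemma continuous_act : Continuous fun z : Par d × E d => z.1.act z.2 :=
  (continuous_actCLM.comp continuous_fst).clm_apply continuous_snd

lemma continuous_act_const (x : E d) : Continuous fun p : Par d => p.act x :=
  (continuous_clm_apply.1 continuous_actCLM) x

lemma continuous_act_basePoint : Continuous fun p : Par d => p.act (basePoint d) :=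
  continuous_act_const _

lemma basePoint_zero : basePoint d 0 = 0 := by
  simp [basePoint]

lemma basePoint_last : basePoint d (Fin.last (d + 1)) = 1 := by
  simp [basePoint]

lemma basePoint_mid (i : Fin d) : basePoint d i.castSucc.succ = 0 := by
  have : i.castSucc.succ ≠ Fin.last (d + 1) := by
    rw [← Fin.succ_last]; exact fun h => (Fin.castSucc_lt_last i).ne (Fin.succ_injective _ h)
  simp [basePoint, this]

lemma act_basePoint (p : Par d) :
    (p.act (basePoint d)).ofLp = Real.exp p.logScale • blk
      (Real.cosh p.boost * (‖p.shift‖ ^ 2 / 2) + Real.sinh p.boost * (1 + ‖p.shift‖ ^ 2 / 2))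
      (fun i => -p.shift i)
      (Real.sinh p.boost * (‖p.shift‖ ^ 2 / 2) + Real.cosh p.boost * (1 + ‖p.shift‖ ^ 2 / 2)) := by
  rw [act_eq, aMat_mulVec, nMat_mulVec]
  simp only [basePoint_zero, basePoint_last, basePoint_mid, blk_zero, blk_mid, blk_last, mul_zero,
    Finset.sum_const_zero, sub_zero, zero_add, mul_one, zero_sub]

lemma basePoint_mem_cone : basePoint d ∈ cone d := by
  simp [cone, lorentzForm_eq, basePoint_zero, basePoint_last, basePoint_mid]

lemma lorentzForm_basePoint : lorentzForm (basePoint d) (basePoint d) = 1 := by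
  simp [lorentzForm_eq, basePoint_zero, basePoint_last, basePoint_mid]

lemma coneDet_act_basePoint (p : Par d) : coneDet (p.act (basePoint d)) = Real.exp p.logScale := by
  rw [coneDet, lorentzForm_act, lorentzForm_basePoint, mul_one, Real.sqrt_sq (Real.exp_pos _).le]

/-- The element of the group that moves the base point to a given point of the cone. -/
def sec (x : E d) : Par d :=
  -- The coordinates solve x = e^a a_t n_c e: the determinant of x is e^a, its difference x_n - x_1
  -- is e^{a-t}, and its middle block is -e^a c.
  mk (Real.log (coneDet x)) (Real.log (coneDet x) - Real.log (x (Fin.last (d + 1)) - x 0))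
    (-(coneDet x)⁻¹ • WithLp.toLp 2 fun i => x i.castSucc.succ)

lemma coneDet_pos {x : E d} (hx : x ∈ cone d) : 0 < coneDet x := Real.sqrt_pos.2 hx.1

lemma continuous_coneDet : Continuous (coneDet (d := d)) := by
  unfold coneDet lorentzForm; fun_prop

lemma continuousOn_sec : ContinuousOn (sec (d := d)) (cone d) := by
  have h1 : ContinuousOn (fun x : E d => Real.log (coneDet x)) (cone d) :=
    continuous_coneDet.continuousOn.log fun x hx => (coneDet_pos hx).ne'
  have h2 : ContinuousOn (fun x : E d => Real.log (x (Fin.last (d + 1)) - x 0)) (cone d) := by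
    refine ContinuousOn.log (by fun_prop) fun x hx => ?_
    exact ((mem_cone_iff x).1 hx).2.ne'
  have h3 : ContinuousOn (fun x : E d => -(coneDet x)⁻¹ • (WithLp.toLp 2 fun i => x i.castSucc.succ :
      EuclideanSpace ℝ (Fin d))) (cone d) := by
    have hv : Continuous fun x : E d => (WithLp.toLp 2 fun i => x i.castSucc.succ :
        EuclideanSpace ℝ (Fin d)) :=
      (PiLp.continuous_toLp 2 _).comp (continuous_pi fun i => PiLp.continuous_apply 2 _ _)
    have hi : ContinuousOn (fun x : E d => -(coneDet x)⁻¹) (cone d) :=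
      (continuous_coneDet.continuousOn.inv₀ fun x hx => (coneDet_pos hx).ne').neg
    exact hi.smul hv.continuousOn
  exact h1.prodMk ((h1.sub h2).prodMk h3)

lemma sec_act_basePoint (p : Par d) : sec (p.act (basePoint d)) = p := by
  have h := act_basePoint p
  have h0 : (p.act (basePoint d)) 0 = _ := congrFun h 0
  have hl : (p.act (basePoint d)) (Fin.last (d + 1)) = _ := congrFun h (Fin.last (d + 1))
  have hm : ∀ i : Fin d, (p.act (basePoint d)) i.castSucc.succ = _ :=
    fun i => congrFun h i.castSucc.succ
  simp only [Pi.smul_apply, blk_zero, blk_last, blk_mid, smul_eq_mul] at h0 hl hm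
  ext i
  · simp [sec, coneDet_act_basePoint]
  · simp only [sec, coneDet_act_basePoint, Real.log_exp, boost_mk]
    have : (p.act (basePoint d)) (Fin.last (d + 1)) - (p.act (basePoint d)) 0 =
        Real.exp (p.logScale - p.boost) := by
      rw [h0, hl, sub_eq_add_neg p.logScale, Real.exp_add, ← Real.cosh_sub_sinh]; ring
    rw [this, Real.log_exp]; ring
  · simp only [sec, coneDet_act_basePoint, shift_mk, PiLp.smul_apply, smul_eq_mul, hm]
    field_simp

lemma act_basePoint_injective : Function.Injective fun p : Par d => p.act (basePoint d) :=
  Function.LeftInverse.injective sec_act_basePoint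

lemma act_sec {x : E d} (hx : x ∈ cone d) : (sec x).act (basePoint d) = x := by
  have h := act_basePoint (sec x)
  have hD := coneDet_pos hx
  have hs := ((mem_cone_iff x).1 hx).2
  have hsq : coneDet x ^ 2 = lorentzForm x x := Real.sq_sqrt hx.1.le
  set D := coneDet x with hDdef
  set s := x (Fin.last (d + 1)) - x 0 with hsdef
  have e1 : Real.exp (sec x).logScale = D := Real.exp_log hD
  have e2 : Real.exp (sec x).boost = D / s := by
    simp only [sec, boost_mk]; rw [Real.exp_sub, Real.exp_log hD, Real.exp_log hs]
  have e2' : Real.exp (-(sec x).boost) = s / D := by rw [Real.exp_neg, e2, inv_div]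
  have e3 : ∀ i, (sec x).shift i = -D⁻¹ * x i.castSucc.succ := fun i => by
    simp [sec, hDdef]
  have e4 : D ^ 2 * ‖(sec x).shift‖ ^ 2 = ∑ i : Fin d, x i.castSucc.succ * x i.castSucc.succ := by
    rw [norm_sq_eq, Finset.mul_sum]
    refine Finset.sum_congr rfl fun i _ => ?_
    rw [e3]; field_simp
  -- Here B(x,x) is written as (x_n - x_1)(x_n + x_1) minus the squares of the middle block.
  -- Together with the difference `s` this recovers both outer coordinates.
  have e5 : D ^ 2 * (1 + ‖(sec x).shift‖ ^ 2) = s * (x (Fin.last (d + 1)) + x 0) := by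
    rw [mul_add, e4, mul_one, hsq, lorentzForm_eq, hsdef]; ring
  have hc := Real.cosh_eq (sec x).boost
  have hsi := Real.sinh_eq (sec x).boost
  rw [e2, e2'] at hc hsi
  have e6 : ‖(sec x).shift‖ ^ 2 = s * (x (Fin.last (d + 1)) + x 0) / D ^ 2 - 1 := by
    field_simp; linarith
  refine eq_of_coord ?_ (fun i => ?_) ?_
  · rw [h]
    simp only [Pi.smul_apply, blk_zero, smul_eq_mul, e1, hc, hsi, e6]
    have : s = x (Fin.last (d + 1)) - x 0 := hsdef
    field_simp
    linear_combination -D ^ 2 * this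
  · rw [h]
    simp only [Pi.smul_apply, blk_mid, smul_eq_mul, e1, e3]
    field_simp
  · rw [h]
    simp only [Pi.smul_apply, blk_last, smul_eq_mul, e1, hc, hsi, e6]
    have : s = x (Fin.last (d + 1)) - x 0 := hsdef
    field_simp
    linear_combination D ^ 2 * this

/-- The elements of the group that move a point of one compact set to a point of another lie in
a compact set. -/
lemma exists_isCompact_of_act_mem {K₁ K₂ : Set (E d)} (h₁ : IsCompact K₁) (h₂ : IsCompact K₂)
    (hc₁ : K₁ ⊆ cone d) (hc₂ : K₂ ⊆ cone d) :
    ∃ Q : Set (Par d), IsCompact Q ∧ ∀ p : Par d, ∀ x ∈ K₁, p.act x ∈ K₂ → p ∈ Q := by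
  have c₁ := h₁.image_of_continuousOn (continuousOn_sec.mono hc₁)
  have c₂ := h₂.image_of_continuousOn (continuousOn_sec.mono hc₂)
  refine ⟨(fun z : Par d × Par d => z.1 * z.2⁻¹) '' ((sec '' K₂) ×ˢ (sec '' K₁)),
    (c₂.prod c₁).image (by fun_prop), fun p x hx hy => ?_⟩
  -- By simple transitivity `p = sec (p.act x) * (sec x)⁻¹`, and `sec` is continuous on the cone.
  refine ⟨(sec (p.act x), sec x), ⟨⟨_, hy, rfl⟩, ⟨_, hx, rfl⟩⟩, ?_⟩
  have : sec (p.act x) = p * sec x := act_basePoint_injective <| by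
    change (sec (p.act x)).act _ = (p * sec x).act _
    rw [act_sec (hc₂ hy), act_mul, act_sec (hc₁ hx)]
  change sec (p.act x) * (sec x)⁻¹ = p
  rw [this, mul_inv_cancel_right]

/-- The logarithmic coordinates of an element of `H`. -/
def ofH (h : H d) : Par d := mk (Real.log h.scale) h.2.1 h.2.2

lemma toH_ofH (h : H d) : (ofH h).toH = h :=
  Prod.ext (Subtype.ext (Real.exp_log h.scale_pos)) rfl

lemma act_ofH (h : H d) : (ofH h).act = h.act := by rw [act, toH_ofH]

end Par

variable {d : ℕ}

lemma det_toEuclideanLin {n : ℕ} (M : Matrix (Fin n) (Fin n) ℝ) :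
    LinearMap.det (Matrix.toEuclideanLin M) = M.det := by
  rw [Matrix.toEuclideanLin_eq_toLin_orthonormal, LinearMap.det_toLin]

/-- That the action multiplies `B` by γ² reads AᵀJA = γ²J in matrices; determinants give (det A)² =
γ^{2n}. -/
lemma abs_det_act (h : H d) :
    |LinearMap.det (h.act.toLinearEquiv : E d →ₗ[ℝ] E d)| = h.scale ^ (d + 2) := by
  set A : E d →ₗ[ℝ] E d := (h.act.toLinearEquiv : E d →ₗ[ℝ] E d)
  set J : E d →ₗ[ℝ] E d := (signFlip d : E d →ₗ[ℝ] E d)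
  have hJ : LinearMap.det J ≠ 0 := by
    have : J ∘ₗ J = LinearMap.id := LinearMap.ext fun x => signFlip_signFlip x
    have h2 := congrArg LinearMap.det this
    rw [LinearMap.det_comp, LinearMap.det_id] at h2
    exact left_ne_zero_of_mul_eq_one h2
  have key : LinearMap.adjoint A ∘ₗ J ∘ₗ A = h.scale ^ 2 • J := by
    refine LinearMap.ext fun y => ext_inner_left ℝ fun x => ?_
    have := lorentzForm_act h x y
    rw [lorentzForm_eq_inner, lorentzForm_eq_inner] at this
    simp only [LinearMap.comp_apply, LinearMap.adjoint_inner_right, LinearMap.smul_apply,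
      inner_smul_right]
    exact this
  have hdet := congrArg LinearMap.det key
  have hA : A = Matrix.toEuclideanLin h.mat := rfl
  have hadj : LinearMap.det (LinearMap.adjoint A) = LinearMap.det A := by
    rw [hA, ← Matrix.toEuclideanLin_conjTranspose_eq_adjoint, det_toEuclideanLin,
      det_toEuclideanLin, Matrix.det_conjTranspose, star_trivial]
  rw [LinearMap.det_comp, LinearMap.det_comp, LinearMap.det_smul, hadj] at hdet
  simp only [finrank_euclideanSpace, Fintype.card_fin] at hdet
  have h3 : LinearMap.det A ^ 2 = (h.scale ^ (d + 2)) ^ 2 := by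
    apply mul_left_cancel₀ hJ
    rw [← pow_mul, mul_comm (d + 2), pow_mul]
    linear_combination hdet
  rw [← sq_abs] at h3
  exact (sq_eq_sq₀ (abs_nonneg _) (pow_nonneg h.scale_pos.le _)).1 h3

end

/-! ### The balls about the base point, and counting lattice points. -/

section

variable {d : ℕ}

/-- A unit vector extends to an orthonormal basis, but correcting the orientation may flip it. The
sign cannot be avoided for `d = 0`, where the special orthogonal group is trivial. -/
lemma exists_specialOrthogonal_col (v : EuclideanSpace ℝ (Fin (d + 1))) (hv : ‖v‖ = 1) :
    ∃ k ∈ Matrix.specialOrthogonalGroup (Fin (d + 1)) ℝ,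
      (∀ i, k i 0 = v i) ∨ (∀ i, k i 0 = -v i) := by
  have ho : Orthonormal ℝ (({0} : Set (Fin (d + 1))).domRestrict fun _ => v) := by
    refine ⟨fun _ => hv, fun i j hij => absurd (Subsingleton.elim i j) hij⟩
  obtain ⟨b, hb⟩ := ho.exists_orthonormalBasis_extension_of_card_eq (by simp)
  have hb0 : b 0 = v := hb 0 rfl
  let e := EuclideanSpace.basisFun (Fin (d + 1)) ℝ
  let b' := b.adjustToOrientation e.toBasis.orientation
  have hk : ∀ i j, e.toBasis.toMatrix b' i j = b' j i := fun i j => rfl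
  refine ⟨e.toBasis.toMatrix b', ?_, ?_⟩
  · rw [Matrix.mem_specialOrthogonalGroup_iff]
    refine ⟨e.toMatrix_orthonormalBasis_mem_orthogonal b', ?_⟩
    exact e.det_to_matrix_orthonormalBasis_of_same_orientation b'
      (b.orientation_adjustToOrientation _).symm
  · rcases b.adjustToOrientation_apply_eq_or_eq_neg e.toBasis.orientation 0 with h | h
    · left; intro i; rw [hk]; change (b.adjustToOrientation _ 0) i = _; rw [h, hb0]
    · right; intro i; rw [hk]; change (b.adjustToOrientation _ 0) i = _; rw [h, hb0]; rfl

lemma polar_last (k : Matrix (Fin (d + 1)) (Fin (d + 1)) ℝ) (σ τ : ℝ) :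
    Matrix.toEuclideanLin (kMat k * (Real.exp σ • aMat d τ)) (basePoint d) (Fin.last (d + 1)) =
      Real.exp σ * Real.cosh τ := by
  change ((kMat k * (Real.exp σ • aMat d τ)) *ᵥ (basePoint d).ofLp) _ = _
  rw [← Matrix.mulVec_mulVec, Matrix.smul_mulVec, aMat_mulVec, Matrix.mulVec_smul]
  simp only [Pi.smul_apply, smul_eq_mul, Par.basePoint_zero, Par.basePoint_last, mul_zero, mul_one,
    zero_add, Par.basePoint_mid]
  congr 1
  rw [Matrix.mulVec, dotProduct, Fin.sum_univ_castSucc]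
  simp [kMat]

lemma polar_castSucc (k : Matrix (Fin (d + 1)) (Fin (d + 1)) ℝ) (σ τ : ℝ) (i : Fin (d + 1)) :
    Matrix.toEuclideanLin (kMat k * (Real.exp σ • aMat d τ)) (basePoint d) i.castSucc =
      Real.exp σ * Real.sinh τ * k i 0 := by
  change ((kMat k * (Real.exp σ • aMat d τ)) *ᵥ (basePoint d).ofLp) _ = _
  rw [← Matrix.mulVec_mulVec, Matrix.smul_mulVec, aMat_mulVec, Matrix.mulVec_smul]
  simp only [Pi.smul_apply, smul_eq_mul, Par.basePoint_zero, Par.basePoint_last, mul_zero, mul_one,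
    zero_add, Par.basePoint_mid, mul_assoc]
  congr 1
  rw [Matrix.mulVec, dotProduct, Fin.sum_univ_castSucc, Fin.sum_univ_succ]
  have h0 : ∀ (a b : ℝ) (j : Fin d), blk a (fun _ : Fin d => (0 : ℝ)) b j.succ.castSucc = 0 :=
    fun a b j => by rw [← Fin.succ_castSucc, blk_mid]
  simp only [h0, kMat]
  simp [mul_comm]

lemma sum_sq_col {k : Matrix (Fin (d + 1)) (Fin (d + 1)) ℝ}
    (hk : k ∈ Matrix.specialOrthogonalGroup (Fin (d + 1)) ℝ) : ∑ i, k i 0 * k i 0 = 1 := by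
  have h := (Matrix.mem_orthogonalGroup_iff' _ _).1 (Matrix.mem_specialOrthogonalGroup_iff.1 hk).1
  have := congrFun (congrFun h 0) 0
  simpa [Matrix.mul_apply] using this

lemma baseBall_subset_cone (r : ℝ) : baseBall d r ⊆ cone d := by
  rintro x ⟨k, hk, σ, τ, -, rfl⟩
  refine ⟨?_, ?_⟩
  · rw [lorentzForm]
    simp only [polar_last, polar_castSucc]
    have : ∑ i, Real.exp σ * Real.sinh τ * k i 0 * (Real.exp σ * Real.sinh τ * k i 0) =
        (Real.exp σ * Real.sinh τ) ^ 2 := by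
      rw [← mul_one ((Real.exp σ * Real.sinh τ) ^ 2), ← sum_sq_col hk, Finset.mul_sum]
      exact Finset.sum_congr rfl fun i _ => by ring
    rw [this]
    have h := Real.cosh_sq τ
    have : Real.exp σ * Real.cosh τ * (Real.exp σ * Real.cosh τ) - (Real.exp σ * Real.sinh τ) ^ 2 =
        Real.exp σ ^ 2 := by linear_combination Real.exp σ ^ 2 * h
    rw [this]; positivity
  · rw [polar_last]
    exact mul_pos (Real.exp_pos _) (Real.cosh_pos _)

/-- On the cone ‖x‖² ≤ 2x_n², and in polar coordinates x_n = e^σ cosh τ with |σ| and |τ| at most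
|r|. -/
lemma isBounded_baseBall (r : ℝ) : Bornology.IsBounded (baseBall d r) := by
  refine (Metric.isBounded_iff_subset_closedBall 0).2
    ⟨Real.sqrt (2 * (Real.exp |r| * Real.cosh r) ^ 2), ?_⟩
  rintro x hx
  have hcone := baseBall_subset_cone r hx
  rw [mem_closedBall_zero_iff]
  refine Real.le_sqrt_of_sq_le ?_
  have h1 : x (Fin.last (d + 1)) ≤ Real.exp |r| * Real.cosh r := by
    obtain ⟨k, hk, σ, τ, hr, rfl⟩ := hx
    rw [polar_last]
    have hσ : |σ| ≤ |r| := sq_le_sq.1 (by nlinarith [sq_nonneg τ])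
    have hτ : |τ| ≤ |r| := sq_le_sq.1 (by nlinarith [sq_nonneg σ])
    exact mul_le_mul (Real.exp_le_exp.2 ((le_abs_self σ).trans hσ)) (Real.cosh_le_cosh.2 hτ)
      (Real.cosh_pos _).le (Real.exp_pos _).le
  have h2 := hcone.1
  have h3 := hcone.2
  rw [lorentzForm] at h2
  rw [norm_sq_eq, Fin.sum_univ_castSucc]
  nlinarith

lemma isOpen_cone : IsOpen (cone d) := by
  have h1 : Continuous fun x : E d => lorentzForm x x := by unfold lorentzForm; fun_prop
  have h2 : Continuous fun x : E d => x (Fin.last (d + 1)) := PiLp.continuous_apply 2 _ _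
  exact (isOpen_lt continuous_const h1).and (isOpen_lt continuous_const h2)

/-- Polar coordinates near the base point: σ = log Det x and sinh τ = ρ(x) / Det x, where ρ is the
norm of the first n - 1 coordinates. The function σ² + τ² is continuous there and vanishes at the
base point. -/
lemma baseBall_mem_nhds {r : ℝ} (hr : 0 < r) : baseBall d r ∈ 𝓝 (basePoint d) := by
  let ρ : E d → ℝ := fun x => ‖(WithLp.toLp 2 fun i : Fin (d + 1) => x i.castSucc :
    EuclideanSpace ℝ (Fin (d + 1)))‖
  have hρ : Continuous ρ := by
    refine continuous_norm.comp ((PiLp.continuous_toLp 2 _).comp (continuous_pi fun i => ?_))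
    exact PiLp.continuous_apply 2 _ _
  have hρ0 : ρ (basePoint d) = 0 := by
    simp only [ρ, norm_eq_zero]
    ext i
    simp [basePoint, (Fin.castSucc_lt_last i).ne]
  have hd : coneDet (basePoint d) = 1 := by
    rw [coneDet, Par.lorentzForm_basePoint, Real.sqrt_one]
  have hcont : ContinuousAt (fun x : E d => Real.log (coneDet x) ^ 2 +
      Real.arsinh (ρ x / coneDet x) ^ 2) (basePoint d) := by
    have h1 : ContinuousAt (coneDet (d := d)) (basePoint d) := Par.continuous_coneDet.continuousAt
    have h2 : ContinuousAt (fun x : E d => Real.log (coneDet x)) (basePoint d) :=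
      h1.log (by rw [hd]; exact one_ne_zero)
    have h3 : ContinuousAt (fun x : E d => ρ x / coneDet x) (basePoint d) :=
      hρ.continuousAt.div h1 (by rw [hd]; exact one_ne_zero)
    exact (h2.pow 2).add ((Real.continuous_arsinh.continuousAt.comp h3).pow 2)
  have hlt := hcont.eventually_lt (continuousAt_const (y := r ^ 2)) (by
    simp only [hd, hρ0, Real.log_one, zero_div, Real.arsinh_zero]
    nlinarith)
  filter_upwards [hlt, isOpen_cone.mem_nhds Par.basePoint_mem_cone] with x hx hxc
  have hD := Par.coneDet_pos hxc
  have hDsq : coneDet x ^ 2 = lorentzForm x x := Real.sq_sqrt hxc.1.le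
  have hρsq : ρ x ^ 2 = ∑ i : Fin (d + 1), x i.castSucc * x i.castSucc := norm_sq_eq _
  obtain ⟨v, hv, hv'⟩ : ∃ v : EuclideanSpace ℝ (Fin (d + 1)), ‖v‖ = 1 ∧
      ∀ i, x i.castSucc = ρ x * v i := by
    by_cases h : ρ x = 0
    · refine ⟨EuclideanSpace.single 0 1, by simp, fun i => ?_⟩
      have := norm_eq_zero.1 h
      rw [h, zero_mul]
      exact congrArg (fun y : EuclideanSpace ℝ (Fin (d + 1)) => y i) this
    · refine ⟨(ρ x)⁻¹ • WithLp.toLp 2 fun i : Fin (d + 1) => x i.castSucc, ?_, fun i => ?_⟩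
      · rw [norm_smul, norm_inv, norm_norm, inv_mul_cancel₀ h]
      · simp [h]
  have hsinh : Real.sinh (Real.arsinh (ρ x / coneDet x)) = ρ x / coneDet x := Real.sinh_arsinh _
  have hcosh : coneDet x * Real.cosh (Real.arsinh (ρ x / coneDet x)) = x (Fin.last (d + 1)) := by
    have h1 := Real.cosh_sq (Real.arsinh (ρ x / coneDet x))
    rw [hsinh] at h1
    have h2 : (coneDet x * Real.cosh (Real.arsinh (ρ x / coneDet x))) ^ 2 =
        x (Fin.last (d + 1)) ^ 2 := by
      rw [mul_pow, h1, mul_add, div_pow, mul_div_cancel₀ _ (by positivity), mul_one, hρsq, hDsq,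
        lorentzForm]
      ring
    exact (sq_eq_sq₀ (mul_pos hD (Real.cosh_pos _)).le hxc.2.le).1 h2
  obtain ⟨k, hk, hk'⟩ := exists_specialOrthogonal_col v hv
  rcases hk' with hk' | hk'
  · refine ⟨k, hk, Real.log (coneDet x), Real.arsinh (ρ x / coneDet x), hx, ?_⟩
    ext i
    refine Fin.lastCases ?_ (fun i => ?_) i
    · rw [polar_last, Real.exp_log hD, hcosh]
    · rw [polar_castSucc, Real.exp_log hD, hsinh, hk', hv', mul_div_cancel₀ _ hD.ne']
  -- A flipped column of `k` is compensated by changing the sign of τ, under which the disc is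
  -- symmetric.
  · refine ⟨k, hk, Real.log (coneDet x), -Real.arsinh (ρ x / coneDet x), by rwa [neg_sq], ?_⟩
    ext i
    refine Fin.lastCases ?_ (fun i => ?_) i
    · rw [polar_last, Real.exp_log hD, Real.cosh_neg, hcosh]
    · rw [polar_castSucc, Real.exp_log hD, Real.sinh_neg, hsinh, hk', hv', mul_neg, mul_neg,
        mul_div_cancel₀ _ hD.ne', neg_mul, neg_neg]

/-- Points with disjoint translates of a neighbourhood of the base point are uniformly finite in
translates of compact sets. -/
lemma exists_card_le {B : Set (E d)} (hB : B ∈ 𝓝 (basePoint d)) {g : ℕ → Par d}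
    (hg : Pairwise fun i j => Disjoint ((g i).act '' B) ((g j).act '' B))
    {Q : Set (Par d)} (hQ : IsCompact Q) :
    ∃ N : ℕ, ∀ p : Par d, {k | (g k)⁻¹ * p ∈ Q}.Finite ∧ {k | (g k)⁻¹ * p ∈ Q}.ncard ≤ N := by
  -- Finitely many such neighbourhoods cover `Q`, and each index `k` is sent to a centre near `(g
  -- k)⁻¹ * p`. Two indices with the same centre `q` would put the point `(p * q⁻¹).act (basePoint
  -- d)` into two disjoint translates of `B`.
  have hO : ∀ q ∈ Q, {q' : Par d | (q' * q⁻¹).act (basePoint d) ∈ B} ∈ 𝓝[Q] q := fun q _ => by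
    refine mem_nhdsWithin_of_mem_nhds ?_
    have hc := (Par.continuous_act_basePoint (d := d)).comp (continuous_mul_const q⁻¹)
    refine hc.continuousAt.preimage_mem_nhds ?_
    rw [Function.comp_apply, mul_inv_cancel, Par.act_one]
    exact hB
  obtain ⟨t, -, ht⟩ := hQ.elim_nhdsWithin_subcover _ hO
  refine ⟨t.card, fun p => ?_⟩
  have hch : ∀ k ∈ {k | (g k)⁻¹ * p ∈ Q}, ∃ q ∈ t, ((g k)⁻¹ * p * q⁻¹).act (basePoint d) ∈ B :=
    fun k hk => by simpa using ht hk
  choose! f hft hfB using hch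
  have hinj : Set.InjOn f {k | (g k)⁻¹ * p ∈ Q} := by
    intro i hi j hj hij
    by_contra hne
    have hmem : ∀ k ∈ {k | (g k)⁻¹ * p ∈ Q}, (p * (f k)⁻¹).act (basePoint d) ∈ (g k).act '' B :=
      fun k hk => ⟨_, hfB k hk, by
        rw [← Par.act_mul, show g k * ((g k)⁻¹ * p * (f k)⁻¹) = p * (f k)⁻¹ by group]⟩
    have h1 := hmem i hi
    rw [hij] at h1
    exact Set.disjoint_left.1 (hg hne) h1 (hmem j hj)
  have hmaps : ∀ k ∈ {k | (g k)⁻¹ * p ∈ Q}, f k ∈ (t : Set (Par d)) := hft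
  refine ⟨Set.Finite.of_injOn hmaps hinj t.finite_toSet, ?_⟩
  rw [← Set.ncard_coe_finset]
  exact Set.ncard_le_ncard_of_injOn f hmaps hinj t.finite_toSet

end

/-! ### The Fourier transform of `B`, and functionals on the frequency side. -/

section

variable {d : ℕ}

/-- The constant `(2π)^{n/2}`. -/
def fourierConst (d : ℕ) : ℂ := ((Real.sqrt (2 * Real.pi) ^ (d + 2) : ℝ) : ℂ)

lemma fourierConst_ne_zero : fourierConst d ≠ 0 := by
  have := const_ne_zero d
  exact fun h => this (by rw [← fourierConst, h, _root_.inv_zero])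

/-- The change of variables `w ↦ J w / 2π` between the two Fourier transforms. -/
def freqEquiv (d : ℕ) : E d ≃L[ℝ] E d :=
  ContinuousLinearEquiv.equivOfInverse ((2 * Real.pi)⁻¹ • signFlip d) ((2 * Real.pi) • signFlip d)
    (fun x => by
      simp only [_root_.smul_apply, map_smul, signFlip_signFlip, smul_smul]
      rw [inv_mul_cancel₀ (by positivity), one_smul])
    (fun x => by
      simp only [_root_.smul_apply, map_smul, signFlip_signFlip, smul_smul]
      rw [mul_inv_cancel₀ (by positivity), one_smul])

lemma freqEquiv_apply (w : E d) : freqEquiv d w = (2 * Real.pi)⁻¹ • signFlip d w := rfl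

lemma lorentzFourier_eq (f : E d → ℂ) (w : E d) :
    lorentzFourier f w = (fourierConst d)⁻¹ * 𝓕 f (freqEquiv d w) := by
  rw [lorentzFourier, Real.fourier_eq', fourierConst]
  congr 1
  refine integral_congr_ae (Eventually.of_forall fun x => ?_)
  simp only [smul_eq_mul]
  rw [mul_comm, freqEquiv_apply, inner_smul_right, ← lorentzForm_eq_inner]
  congr 2
  have : -2 * Real.pi * ((2 * Real.pi)⁻¹ * lorentzForm x w) = -lorentzForm x w := by
    field_simp
  rw [this]
  push_cast
  ring

/-- The transform `f ↦ f̃` on the Schwartz space. -/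
def lorentzFourierCLM (d : ℕ) : 𝓢(E d, ℂ) →L[ℂ] 𝓢(E d, ℂ) :=
  (fourierConst d)⁻¹ • (SchwartzMap.compCLMOfContinuousLinearEquiv ℂ (freqEquiv d) ∘L
    FourierTransform.fourierCLM ℂ 𝓢(E d, ℂ))

lemma lorentzFourierCLM_apply (f : 𝓢(E d, ℂ)) (w : E d) :
    lorentzFourierCLM d f w = lorentzFourier f w := by
  rw [lorentzFourier_eq]; rfl

lemma coe_lorentzFourierCLM (f : 𝓢(E d, ℂ)) : ⇑(lorentzFourierCLM d f) = lorentzFourier f :=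
  funext (lorentzFourierCLM_apply f)

lemma contDiff_lorentzFourier (f : 𝓢(E d, ℂ)) : ContDiff ℝ ∞ (lorentzFourier f) := by
  rw [← coe_lorentzFourierCLM]
  exact (lorentzFourierCLM d f).smooth ⊤

/-- The inverse of `f ↦ f̃` on the Schwartz space. -/
def lorentzFourierInv (d : ℕ) : 𝓢(E d, ℂ) →L[ℂ] 𝓢(E d, ℂ) :=
  fourierConst d • (FourierTransform.fourierInvCLM ℂ 𝓢(E d, ℂ) ∘L
    SchwartzMap.compCLMOfContinuousLinearEquiv ℂ (freqEquiv d).symm)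

lemma lorentzFourierCLM_inv (m : 𝓢(E d, ℂ)) : lorentzFourierCLM d (lorentzFourierInv d m) = m := by
  have h : lorentzFourierInv d m = fourierConst d • 𝓕⁻
    (SchwartzMap.compCLMOfContinuousLinearEquiv ℂ (freqEquiv d).symm m) := rfl
  rw [h, map_smul]
  ext w
  have h2 : lorentzFourierCLM d (𝓕⁻ (SchwartzMap.compCLMOfContinuousLinearEquiv ℂ
      (freqEquiv d).symm m)) w = (fourierConst d)⁻¹ * 𝓕 (𝓕⁻ (SchwartzMap.compCLMOfContinuousLinearEquiv
        ℂ (freqEquiv d).symm m)) (freqEquiv d w) := rfl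
  rw [_root_.smul_apply, h2, FourierTransform.fourier_fourierInv_eq, smul_eq_mul, ← mul_assoc,
    mul_inv_cancel₀ fourierConst_ne_zero, one_mul, SchwartzMap.compCLMOfContinuousLinearEquiv_apply]
  simp

lemma lorentzFourierInv_CLM (f : 𝓢(E d, ℂ)) : lorentzFourierInv d (lorentzFourierCLM d f) = f := by
  have h : lorentzFourierInv d (lorentzFourierCLM d f) = fourierConst d • 𝓕⁻
    (SchwartzMap.compCLMOfContinuousLinearEquiv ℂ (freqEquiv d).symm (lorentzFourierCLM d f)) := rfl
  have h2 : SchwartzMap.compCLMOfContinuousLinearEquiv ℂ (freqEquiv d).symm (lorentzFourierCLM d f) =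
      (fourierConst d)⁻¹ • 𝓕 f := by
    ext w
    have : lorentzFourierCLM d f ((freqEquiv d).symm w) =
      (fourierConst d)⁻¹ * 𝓕 f (freqEquiv d ((freqEquiv d).symm w)) := rfl
    rw [SchwartzMap.compCLMOfContinuousLinearEquiv_apply, Function.comp_apply, this,
      ContinuousLinearEquiv.apply_symm_apply]
    rfl
  rw [h, h2, FourierTransform.fourierInv_smul, FourierTransform.fourierInv_fourier_eq, smul_smul,
    mul_inv_cancel₀ fourierConst_ne_zero, one_smul]

lemma lorentzFourier_injective {f g : 𝓢(E d, ℂ)}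
    (h : ∀ w, lorentzFourier f w = lorentzFourier g w) : f = g := by
  have : lorentzFourierCLM d f = lorentzFourierCLM d g := by
    ext w; rw [lorentzFourierCLM_apply, lorentzFourierCLM_apply, h]
  rw [← lorentzFourierInv_CLM f, this, lorentzFourierInv_CLM]

/-- Every Schwartz function `m` is the integral of characters against `kernelFn m`. -/
def kernelFn (m : 𝓢(E d, ℂ)) : 𝓢(E d, ℂ) := (fourierConst d)⁻¹ • lorentzFourierInv d m

lemma eq_integral_kernelFn (m : 𝓢(E d, ℂ)) (w : E d) :
    m w = ∫ y, kernelFn m y * Complex.exp (-(Complex.I * (lorentzForm y w : ℂ))) := by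
  conv_lhs => rw [← lorentzFourierCLM_inv m, lorentzFourierCLM_apply, lorentzFourier]
  rw [← fourierConst, ← integral_const_mul]
  refine integral_congr_ae (Eventually.of_forall fun y => ?_)
  simp only [kernelFn, _root_.smul_apply, smul_eq_mul]
  ring

/-- Passing from a symbol to its kernel is continuous from the Schwartz space to L¹. This is the
source of every constant that is uniform over a compact set of symbols. -/
lemma exists_eLpNorm_kernelFn_le {Y : Type*} [TopologicalSpace Y] {Φ : Y → 𝓢(E d, ℂ)}
    (hΦ : Continuous Φ) {K : Set Y} (hK : IsCompact K) :
    ∃ C : NNReal, ∀ y ∈ K, eLpNorm (kernelFn (Φ y)) 1 volume ≤ C := by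
  have h1 : Continuous fun y => kernelFn (Φ y) :=
    ((fourierConst d)⁻¹ • lorentzFourierInv d).continuous.comp hΦ
  have h2 : Continuous fun y => ‖SchwartzMap.toLpCLM ℂ ℂ 1 volume (kernelFn (Φ y))‖ :=
    ((SchwartzMap.toLpCLM ℂ ℂ 1 (volume : Measure (E d))).continuous.comp h1).norm
  obtain ⟨C, hC⟩ := (hK.image h2).bddAbove
  refine ⟨C.toNNReal, fun y hy => ?_⟩
  have h3 := hC ⟨y, hy, rfl⟩
  have h4 : ‖SchwartzMap.toLp (kernelFn (Φ y)) 1 volume‖ ≤ C := h3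
  rw [SchwartzMap.norm_toLp] at h4
  exact (ENNReal.le_ofReal_iff_toReal_le ((kernelFn (Φ y)).eLpNorm_lt_top 1 volume).ne
    ((ENNReal.toReal_nonneg).trans h4)).2 h4

/-- Pointwise complex conjugation of Schwartz functions. -/
def conjSchwartz (d : ℕ) : 𝓢(E d, ℂ) →L⋆[ℂ] 𝓢(E d, ℂ) where
  toFun := SchwartzMap.postcompCLM (𝕜 := ℝ) (Complex.conjCLE : ℂ →L[ℝ] ℂ)
  map_add' := map_add _
  map_smul' a f := by
    ext x
    exact map_mul (starRingEnd ℂ) a (f x)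
  cont := (SchwartzMap.postcompCLM (𝕜 := ℝ) (Complex.conjCLE : ℂ →L[ℝ] ℂ)).continuous

lemma conjSchwartz_apply (m : 𝓢(E d, ℂ)) (w : E d) :
    conjSchwartz d m w = (starRingEnd ℂ) (m w) := rfl

instance : PolynormableSpace ℂ 𝓢(E d, ℂ) := (schwartz_withSeminorms ℂ (E d) ℂ).toPolynormableSpace

/-- A functional on `S_Λ` is given by a linear functional of the conjugate transforms. -/
lemma exists_functional (f : ConeDual d) : ∃ L : 𝓢(E d, ℂ) →L[ℂ] ℂ,
    ∀ (u : ConeSchwartz d) (m : 𝓢(E d, ℂ)),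
      (∀ w, m w = (starRingEnd ℂ) (lorentzFourier (u : 𝓢(E d, ℂ)) w)) → L m = f u := by
  -- Composing with conjugation makes `f` linear, so that Hahn–Banach extends it from `S_Λ`. A
  -- second conjugation, on the side of the symbols, makes the final functional linear too.
  let st : ℂ →L⋆[ℂ] ℂ := (starL ℂ : ℂ ≃L⋆[ℂ] ℂ)
  let f₀ : ConeSchwartz d →L[ℂ] ℂ := st.comp f
  obtain ⟨g, hg⟩ := StrongDual.exists_extension (ConeSchwartz d) f₀
  let L₁ : 𝓢(E d, ℂ) →L⋆[ℂ] ℂ := g.comp ((lorentzFourierInv d).comp (conjSchwartz d))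
  refine ⟨st.comp L₁, fun u m hm => ?_⟩
  have h1 : lorentzFourierInv d (conjSchwartz d m) = u := by
    rw [← lorentzFourierInv_CLM (u : 𝓢(E d, ℂ))]
    congr 1
    ext w
    rw [conjSchwartz_apply, hm, Complex.conj_conj, lorentzFourierCLM_apply]
  change (starRingEnd ℂ) (g (lorentzFourierInv d (conjSchwartz d m))) = f u
  rw [h1, hg]
  exact Complex.conj_conj _

end

/-! ### Convolutions and voice transforms as multipliers. -/

section

variable {d : ℕ}

/-- The conjugation inside the reflected function cancels the outer one. Hence the symbol of a
convolution is ψ̃ itself, whereas that of the voice transform is the conjugate of ũ. -/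
lemma lorentzFourier_schwartzReflect (x : E d) (ψ : 𝓢(E d, ℂ)) (w : E d) :
    (starRingEnd ℂ) (lorentzFourier (schwartzReflect x ψ) w) = phase x w * lorentzFourier ψ w := by
  have key : ∀ y : E d, schwartzReflect x ψ (x - y) *
      Complex.exp (-(Complex.I * (lorentzForm (x - y) w : ℂ))) =
      Complex.exp (-(Complex.I * (lorentzForm x w : ℂ))) *
      (starRingEnd ℂ) (ψ y * Complex.exp (-(Complex.I * (lorentzForm y w : ℂ)))) := by
    intro y
    rw [schwartzReflect_apply, sub_sub_cancel, sub_eq_add_neg, lorentzForm_add_left,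
      lorentzForm_neg_left, map_mul, ← Complex.exp_conj]
    push_cast
    rw [mul_add, neg_add, Complex.exp_add]
    simp only [map_neg, map_mul, Complex.conj_I, Complex.conj_ofReal]
    ring_nf
  rw [lorentzFourier, ← integral_sub_left_eq_self _ volume x]
  simp_rw [key]
  rw [integral_const_mul, integral_conj, map_mul, map_mul, Complex.conj_conj, ← Complex.exp_conj,
    lorentzFourier, phase]
  simp only [map_neg, map_mul, Complex.conj_I, Complex.conj_ofReal, map_inv₀]
  ring_nf

lemma integral_comp_act_eq (h : H d) (g : E d → ℂ) :
    ∫ x, g x = ((h.scale ^ (d + 2) : ℝ) : ℂ) * ∫ y, g (h.act y) := by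
  have hdet : LinearMap.det (h.act.toLinearEquiv : E d →ₗ[ℝ] E d) ≠ 0 :=
    (LinearEquiv.isUnit_det' h.act.toLinearEquiv).ne_zero
  have hm := Measure.map_linearMap_addHaar_eq_smul_addHaar (volume : Measure (E d)) hdet
  have h2 : ∫ y, g (h.act y) = ∫ x, g x ∂(Measure.map h.act volume) :=
    (h.act.toHomeomorph.measurableEmbedding.integral_map g).symm
  have h3 : Measure.map (h.act) (volume : Measure (E d)) =
      ENNReal.ofReal |(LinearMap.det (h.act.toLinearEquiv : E d →ₗ[ℝ] E d))⁻¹| • volume := hm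
  have hpos : 0 < h.scale ^ (d + 2) := pow_pos h.scale_pos _
  rw [h2, h3, integral_smul_measure, abs_inv, abs_det_act,
    ENNReal.toReal_ofReal (inv_nonneg.2 hpos.le), Complex.real_smul, ← mul_assoc,
    ← Complex.ofReal_mul, mul_inv_cancel₀ hpos.ne', Complex.ofReal_one, one_mul]

/-- The substitution x = hy + b has Jacobian γ^n, which turns γ^{-n/2} into γ^{n/2}. Since h
multiplies `B` by γ², one has B(hy, w) = B(y, γ²h⁻¹w). -/
lemma lorentzFourier_schwartzRep (h : H d) (b : E d) (f : 𝓢(E d, ℂ)) (w : E d) :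
    lorentzFourier (schwartzRep h b f) w = ((h.scale ^ (((d : ℝ) + 2) / 2) : ℝ) : ℂ) *
      (Complex.exp (-(Complex.I * (lorentzForm b w : ℂ))) *
        lorentzFourier f (h.scale ^ 2 • h.act.symm w)) := by
  set v := h.act.symm w with hv
  have key : ∀ y : E d, schwartzRep h b f (h.act y + b) *
      Complex.exp (-(Complex.I * (lorentzForm (h.act y + b) w : ℂ))) =
      (((h.scale ^ (-((d : ℝ) + 2) / 2) : ℝ) : ℂ) *
        Complex.exp (-(Complex.I * (lorentzForm b w : ℂ)))) *
      (f y * Complex.exp (-(Complex.I * (lorentzForm y (h.scale ^ 2 • v) : ℂ)))) := by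
    intro y
    have hB : lorentzForm (h.act y) w = lorentzForm y (h.scale ^ 2 • v) := by
      rw [lorentzForm_smul_right, ← lorentzForm_act, hv, ContinuousLinearEquiv.apply_symm_apply]
    rw [schwartzRep_apply, lorentzForm_add_left, hB, add_sub_cancel_right,
      ContinuousLinearEquiv.symm_apply_apply]
    rw [Complex.ofReal_add, mul_add, neg_add (Complex.I * _), Complex.exp_add]
    ring
  have hpow : h.scale ^ (d + 2) * h.scale ^ (-((d : ℝ) + 2) / 2) = h.scale ^ (((d : ℝ) + 2) / 2) := by
    rw [← Real.rpow_natCast, ← Real.rpow_add h.scale_pos]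
    congr 1; push_cast; ring
  rw [lorentzFourier, ← integral_add_right_eq_self _ b, integral_comp_act_eq h]
  simp_rw [key]
  rw [integral_const_mul, lorentzFourier, ← hpow]
  push_cast
  ring

/-- The point of the group in which the voice transform at `h` is localised in frequency. -/
def freqPoint (h : H d) : Par d := Par.mk (-Real.log h.scale) h.2.1 h.2.2

/-- For h = γ a_t n_c the matrix γ⁻²h is γ⁻¹ a_t n_c: the action dual to h under `B` only inverts
the dilation. -/
lemma freqPoint_inv_act (h : H d) (w : E d) :
    (freqPoint h)⁻¹.act w = h.scale ^ 2 • h.act.symm w := by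
  have hg := h.scale_pos
  have h1 : ∀ x : E d, (freqPoint h).act x = (h.scale ^ 2)⁻¹ • h.act x := fun x => by
    have h2 := Par.act_eq (Par.ofH h) x
    rw [Par.act_ofH] at h2
    rw [h2, Par.act_eq]
    simp only [freqPoint, Par.ofH, Par.logScale_mk, Par.boost_mk, Par.shift_mk, Real.exp_neg,
      Real.exp_log hg]
    rw [← WithLp.toLp_smul, smul_smul]
    congr 2
    field_simp
  apply (freqPoint h).act.injective
  rw [Par.act_act_inv, map_smul, h1, ContinuousLinearEquiv.apply_symm_apply, smul_smul,
    mul_inv_cancel₀ (pow_pos hg 2).ne', one_smul]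

lemma convolve_eq_multiplier {f : ConeDual d} {L : 𝓢(E d, ℂ) →L[ℂ] ℂ}
    (hL : ∀ (u : ConeSchwartz d) (m : 𝓢(E d, ℂ)),
      (∀ w, m w = (starRingEnd ℂ) (lorentzFourier (u : 𝓢(E d, ℂ)) w)) → L m = f u)
    (ψ : ConeSchwartz d) (hψ : HasCompactSupport (lorentzFourier (ψ : 𝓢(E d, ℂ)))) :
    convolve f ψ = multiplier L (lorentzFourier (ψ : 𝓢(E d, ℂ))) := by
  ext x
  refine (hL ⟨schwartzReflect x ψ, schwartzReflect_mem x ψ.2⟩ _ fun w => ?_).symm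
  have hph : ContDiff ℝ ∞ (phase x) := contDiff_phase.comp (contDiff_const.prodMk contDiff_id)
  rw [lorentzFourier_schwartzReflect]
  exact toSchwartz_apply (m := fun w => phase x w * lorentzFourier (ψ : 𝓢(E d, ℂ)) w)
    hψ.mul_left (hph.mul (contDiff_lorentzFourier _)) w

lemma contDiff_conj_lorentzFourier (u : 𝓢(E d, ℂ)) :
    ContDiff ℝ ∞ fun w => (starRingEnd ℂ) (lorentzFourier u w) :=
  Complex.conjCLE.contDiff.comp (contDiff_lorentzFourier u)

lemma voice_eq_multiplier {f : ConeDual d} {L : 𝓢(E d, ℂ) →L[ℂ] ℂ}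
    (hL : ∀ (u : ConeSchwartz d) (m : 𝓢(E d, ℂ)),
      (∀ w, m w = (starRingEnd ℂ) (lorentzFourier (u : 𝓢(E d, ℂ)) w)) → L m = f u)
    (u : ConeSchwartz d) (hu : HasCompactSupport (lorentzFourier (u : 𝓢(E d, ℂ))))
    (h : H d) (b : E d) :
    voice u f (h, b) = ((h.scale ^ (((d : ℝ) + 2) / 2) : ℝ) : ℂ) *
      multiplier L (fun w => (starRingEnd ℂ) (lorentzFourier (u : 𝓢(E d, ℂ))
        ((freqPoint h)⁻¹.act w))) b := by
  have hph : ContDiff ℝ ∞ (phase b) := contDiff_phase.comp (contDiff_const.prodMk contDiff_id)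
  let v : E d → ℂ := fun w => (starRingEnd ℂ) (lorentzFourier (u : 𝓢(E d, ℂ))
        ((freqPoint h)⁻¹.act w))
  have hv : ContDiff ℝ ∞ v :=
    (contDiff_conj_lorentzFourier (u : 𝓢(E d, ℂ))).comp (freqPoint h)⁻¹.act.contDiff
  have hvc : HasCompactSupport v := by
    have h1 : HasCompactSupport fun w => (starRingEnd ℂ) (lorentzFourier (u : 𝓢(E d, ℂ)) w) :=
      hu.comp_left (g := starRingEnd ℂ) (map_zero _)
    exact h1.comp_homeomorph (freqPoint h)⁻¹.act.toHomeomorph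
  have h1 : ((h.scale ^ (((d : ℝ) + 2) / 2) : ℝ) : ℂ) * multiplier L v b =
      L (((h.scale ^ (((d : ℝ) + 2) / 2) : ℝ) : ℂ) • toSchwartz fun w => phase b w * v w) := by
    rw [map_smul, smul_eq_mul]; rfl
  change _ = _ * multiplier L v b
  rw [h1]
  refine (hL (rep h b u) _ fun w => ?_).symm
  rw [_root_.smul_apply, toSchwartz_apply (m := fun w => phase b w * v w) hvc.mul_left (hph.mul hv)]
  have h2 : ((rep h b u : ConeSchwartz d) : 𝓢(E d, ℂ)) = schwartzRep h b u := rfl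
  rw [h2, lorentzFourier_schwartzRep, map_mul, map_mul, ← Complex.exp_conj]
  simp only [map_neg, map_mul, Complex.conj_I, Complex.conj_ofReal, v, freqPoint_inv_act, phase,
    smul_eq_mul]
  ring_nf

end

/-! ### Invariant multiplier bounds and smooth partitions of unity. -/

section

variable {d : ℕ}

lemma contDiff_phase_left (x : E d) : ContDiff ℝ ∞ (phase x) :=
  contDiff_phase.comp (contDiff_const.prodMk contDiff_id)

lemma multiplier_sum (L : 𝓢(E d, ℂ) →L[ℂ] ℂ) {ι : Type*} (s : Finset ι) (m : ι → E d → ℂ)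
    (hc : ∀ i, HasCompactSupport (m i)) (hs : ∀ i, ContDiff ℝ ∞ (m i)) :
    multiplier L (fun w => ∑ i ∈ s, m i w) = ∑ i ∈ s, multiplier L (m i) := by
  ext x
  rw [Finset.sum_apply]
  simp only [multiplier]
  rw [← map_sum]
  congr 1
  ext w
  have h1 : ContDiff ℝ ∞ fun w => phase x w * ∑ i ∈ s, m i w :=
    (contDiff_phase_left x).mul (ContDiff.sum fun i _ => hs i)
  have h2 : HasCompactSupport fun w => phase x w * ∑ i ∈ s, m i w := by
    refine HasCompactSupport.mul_left (f' := fun w => ∑ i ∈ s, m i w) ?_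
    refine HasCompactSupport.intro (s.isCompact_biUnion fun i _ => hc i) fun w hw => ?_
    refine Finset.sum_eq_zero fun i hi => image_eq_zero_of_notMem_tsupport fun h => hw ?_
    exact Set.mem_biUnion hi h
  rw [toSchwartz_apply h2 h1, Finset.mul_sum, FunLike.coe_sum, Finset.sum_apply]
  refine Finset.sum_congr rfl fun i _ => ?_
  exact (toSchwartz_apply (m := fun w => phase x w * m i w) (hc i).mul_left
    ((contDiff_phase_left x).mul (hs i)) w).symm

lemma eLpNorm_multiplier_sum_le (L : 𝓢(E d, ℂ) →L[ℂ] ℂ) {ι : Type*} (s : Finset ι)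
    (m : ι → E d → ℂ) (hc : ∀ i, HasCompactSupport (m i)) (hs : ∀ i, ContDiff ℝ ∞ (m i))
    {p : ℝ} (hp : 1 ≤ p) :
    eLpNorm (multiplier L (fun w => ∑ i ∈ s, m i w)) (ENNReal.ofReal p) volume ≤
      ∑ i ∈ s, eLpNorm (multiplier L (m i)) (ENNReal.ofReal p) volume := by
  rw [multiplier_sum L s m hc hs]
  exact eLpNorm_sum_le (fun i _ => (continuous_multiplier L (hc i) (hs i)).aestronglyMeasurable)
    (by simpa using hp)

lemma hasCompactSupport_act {m : E d → ℂ} (hm : HasCompactSupport m) (q : Par d) :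
    HasCompactSupport fun w => m (q.act w) := hm.comp_homeomorph q.act.toHomeomorph

lemma contDiff_act {m : E d → ℂ} (hm : ContDiff ℝ ∞ m) (q : Par d) :
    ContDiff ℝ ∞ fun w => m (q.act w) := hm.comp q.act.contDiff

/-- The convolution norm of a multiplier is invariant under the group. -/
lemma eLpNorm_multiplier_mul_act_le (L : 𝓢(E d, ℂ) →L[ℂ] ℂ) {m₁ m₂ : E d → ℂ}
    (hc₁ : HasCompactSupport m₁) (hs₁ : ContDiff ℝ ∞ m₁) (hc₂ : HasCompactSupport m₂)
    (hs₂ : ContDiff ℝ ∞ m₂) (q : Par d) {p : ℝ} (hp : 1 ≤ p) :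
    eLpNorm (multiplier L fun w => m₁ w * m₂ (q⁻¹.act w)) (ENNReal.ofReal p) volume ≤
      eLpNorm (kernelFn (toSchwartz m₂)) 1 volume *
        eLpNorm (multiplier L m₁) (ENNReal.ofReal p) volume := by
  -- With this `G` one has B(Gy, w) = B(y, q⁻¹w), because `q` multiplies `B` by e^{2a}. Thus all the
  -- translates of `m₂` share the kernel of `m₂`, and only `G` varies.
  let G : E d →L[ℝ] E d := (Real.exp q.logScale ^ 2)⁻¹ • (q.act : E d →L[ℝ] E d)
  refine eLpNorm_multiplier_mul_le L hc₁ hs₁ (contDiff_act hs₂ q⁻¹) (kernelFn (toSchwartz m₂)) G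
    (fun w => ?_) hp
  have h1 := eq_integral_kernelFn (toSchwartz m₂) (q⁻¹.act w)
  rw [toSchwartz_apply hc₂ hs₂] at h1
  rw [h1]
  refine integral_congr_ae (Eventually.of_forall fun y => ?_)
  have h2 : lorentzForm (G y) w = lorentzForm y (q⁻¹.act w) := by
    have h3 : lorentzForm (q.act y) w = Real.exp q.logScale ^ 2 * lorentzForm y (q⁻¹.act w) := by
      rw [← Par.lorentzForm_act, Par.act_act_inv]
    have h4 : lorentzForm (G y) w = (Real.exp q.logScale ^ 2)⁻¹ * lorentzForm (q.act y) w := by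
      rw [lorentzForm_eq_inner, lorentzForm_eq_inner]
      exact real_inner_smul_left _ _ _
    rw [h4, h3, ← mul_assoc, inv_mul_cancel₀ (by positivity), one_mul]
  simp only [h2]

/-- Smoothness on all of ℝ lets symbols with denominators depend smoothly on every parameter, even
where the denominators vanish. -/
lemma exists_contDiff_inv {ε : ℝ} (hε : 0 < ε) :
    ∃ χ : ℝ → ℝ, ContDiff ℝ ∞ χ ∧ ∀ t, ε ≤ t → χ t = t⁻¹ := by
  -- The cutoff is 0 for t ≤ ε/2 and 1 for t ≥ ε, so the interpolation `s t * t + (1 - s t)` between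
  -- 1 and `t` stays positive.
  let s : ℝ → ℝ := fun t => Real.smoothTransition (2 / ε * t - 1)
  have hs : ContDiff ℝ ∞ s := Real.smoothTransition.contDiff.comp (by fun_prop)
  have hpos : ∀ t, 0 < s t * t + (1 - s t) := fun t => by
    have h0 := Real.smoothTransition.nonneg (2 / ε * t - 1)
    have h1 := Real.smoothTransition.le_one (2 / ε * t - 1)
    by_cases ht : t ≤ ε / 2
    · have : s t = 0 := Real.smoothTransition.zero_of_nonpos (by
        have : 2 / ε * t ≤ 2 / ε * (ε / 2) := by gcongr
        have h3 : 2 / ε * (ε / 2) = 1 := by field_simp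
        linarith)
      rw [this]; norm_num
    · have ht' : 0 < t := by push Not at ht; linarith
      rcases h0.lt_or_eq with h | h
      · have : 0 < s t * t := mul_pos h ht'
        have : s t ≤ 1 := h1
        linarith
      · have : s t = 0 := h.symm
        rw [this]; norm_num
  refine ⟨fun t => (s t * t + (1 - s t))⁻¹, ?_, fun t ht => ?_⟩
  · exact ((hs.mul contDiff_id).add (contDiff_const.sub hs)).inv fun t => (hpos t).ne'
  · have : s t = 1 := Real.smoothTransition.one_of_one_le (by
      have : 2 / ε * ε ≤ 2 / ε * t := by gcongr
      have h3 : 2 / ε * ε = 2 := by field_simp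
      linarith)
    simp [this]

/-- A varying set of at most `N` neighbours becomes an `N`-tuple padded with `z`, where `F`
vanishes. One parameter space then serves all members of the partition. -/
lemma exists_fin_enumeration {V : Type*} (z : V) (h : ℕ → V) (S : Finset ℕ) :
    ∀ N : ℕ, S.card ≤ N → ∃ A : Fin N → V, (∀ i, A i = z ∨ ∃ k ∈ S, A i = h k) ∧
      ∀ F : V → ℝ, F z = 0 → ∑ i, F (A i) = ∑ k ∈ S, F (h k) := by
  induction S using Finset.induction_on with
  | empty => exact fun N _ => ⟨fun _ => z, fun _ => Or.inl rfl, fun F hF => by simp [hF]⟩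
  | insert a S ha ih =>
    intro N hN
    rw [Finset.card_insert_of_notMem ha] at hN
    obtain ⟨N, rfl⟩ : ∃ N', N = N' + 1 := ⟨N - 1, by omega⟩
    obtain ⟨A, hA, hA'⟩ := ih N (by omega)
    refine ⟨Fin.cons (h a) A, fun i => ?_, fun F hF => ?_⟩
    · refine Fin.cases ?_ (fun i => ?_) i
      · exact Or.inr ⟨a, Finset.mem_insert_self _ _, rfl⟩
      · rcases hA i with h1 | ⟨k, hk, h1⟩
        · exact Or.inl h1
        · exact Or.inr ⟨k, Finset.mem_insert_of_mem hk, h1⟩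
    · rw [Fin.sum_univ_succ, Finset.sum_insert ha, ← hA' F hF]
      simp

/-- The data of a smooth partition of unity on the cone that is subordinate to translates. -/
structure IsAdmissible (φ : E d → ℝ) (g : ℕ → Par d) : Prop where
  smooth : ContDiff ℝ ∞ φ
  nonneg : ∀ x, 0 ≤ φ x
  compact : IsCompact (tsupport φ)
  subset : tsupport φ ⊆ cone d
  cover : ∀ x ∈ cone d, ∃ k, φ ((g k)⁻¹.act x) = 1
  count : ∀ Q : Set (Par d), IsCompact Q → ∃ N : ℕ, ∀ p : Par d,
    {k | (g k)⁻¹ * p ∈ Q}.Finite ∧ {k | (g k)⁻¹ * p ∈ Q}.ncard ≤ N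

/-- The `j`-th member of the partition of unity. -/
def partitionFn (φ : E d → ℝ) (g : ℕ → Par d) (j : ℕ) (w : E d) : ℂ :=
  ((φ ((g j)⁻¹.act w) / ∑' k, φ ((g k)⁻¹.act w) : ℝ) : ℂ)

namespace IsAdmissible

variable {φ : E d → ℝ} {g : ℕ → Par d}

lemma mem_tsupport {x : E d} (h : φ x ≠ 0) : x ∈ tsupport φ :=
  subset_tsupport φ h

/-- If `φ` does not vanish at `(g k)⁻¹.act w`, then `(g k)⁻¹ * sec w` moves the base point into the
support of `φ`. Such elements lie in a compact set, so the packing bound applies. -/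
lemma finite_support (hφ : IsAdmissible φ g) {w : E d} (hw : w ∈ cone d) :
    (Function.support fun k => φ ((g k)⁻¹.act w)).Finite := by
  obtain ⟨Q, hQ, hQ'⟩ := Par.exists_isCompact_of_act_mem (isCompact_singleton (x := basePoint d))
    hφ.compact (Set.singleton_subset_iff.2 Par.basePoint_mem_cone) hφ.subset
  obtain ⟨N, hN⟩ := hφ.count Q hQ
  refine (hN (Par.sec w)).1.subset fun k hk => hQ' _ _ rfl ?_
  rw [Par.act_mul, Par.act_sec hw]
  exact mem_tsupport hk

lemma one_le_tsum (hφ : IsAdmissible φ g) {w : E d} (hw : w ∈ cone d) :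
    1 ≤ ∑' k, φ ((g k)⁻¹.act w) := by
  obtain ⟨k, hk⟩ := hφ.cover w hw
  rw [← hk]
  exact (summable_of_hasFiniteSupport (hφ.finite_support hw)).le_tsum k fun _ _ => hφ.nonneg _

lemma tsum_eq_sum_of_support {w : E d} {S : Finset ℕ}
    (hS : ∀ k, φ ((g k)⁻¹.act w) ≠ 0 → k ∈ S) :
    ∑' k, φ ((g k)⁻¹.act w) = ∑ k ∈ S, φ ((g k)⁻¹.act w) :=
  tsum_eq_sum fun k hk => by_contra fun h => hk (hS k h)

lemma sum_partitionFn (hφ : IsAdmissible φ g) {w : E d} (hw : w ∈ cone d) {S : Finset ℕ}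
    (hS : ∀ k, φ ((g k)⁻¹.act w) ≠ 0 → k ∈ S) : ∑ j ∈ S, partitionFn φ g j w = 1 := by
  have h1 := hφ.one_le_tsum hw
  simp only [partitionFn]
  rw [← Complex.ofReal_sum, ← Finset.sum_div, ← tsum_eq_sum_of_support hS,
    div_self (by linarith), Complex.ofReal_one]

lemma hasCompactSupport_partitionFn (hφ : IsAdmissible φ g) (j : ℕ) :
    HasCompactSupport (partitionFn φ g j) := by
  refine HasCompactSupport.intro (hφ.compact.image (g j).act.continuous) fun w hw => ?_
  have : φ ((g j)⁻¹.act w) = 0 := by_contra fun h => hw ⟨_, mem_tsupport h, Par.act_act_inv _ _⟩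
  simp [partitionFn, this]

/-- The pieces at the group elements are controlled by neighbouring members of the partition. -/
lemma exists_translate_le (hφ : IsAdmissible φ g) (hsm : ∀ j, ContDiff ℝ ∞ (partitionFn φ g j))
    {v : E d → ℂ} (hv : HasCompactSupport v) (hv' : ContDiff ℝ ∞ v) (hvc : tsupport v ⊆ cone d) :
    ∃ (C : NNReal) (Q : Set (Par d)), IsCompact Q ∧
      ∀ (L : 𝓢(E d, ℂ) →L[ℂ] ℂ) (p : ℝ), 1 ≤ p → ∀ (q : Par d) (S : Finset ℕ),
        (∀ j, (g j)⁻¹ * q ∈ Q → j ∈ S) →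
        eLpNorm (multiplier L fun w => v (q⁻¹.act w)) (ENNReal.ofReal p) volume ≤
          C * ∑ j ∈ S, eLpNorm (multiplier L (partitionFn φ g j)) (ENNReal.ofReal p) volume := by
  obtain ⟨Q, hQ, hQ'⟩ := Par.exists_isCompact_of_act_mem (K₁ := tsupport v) hv
    hφ.compact hvc hφ.subset
  obtain ⟨C, hC⟩ := exists_eLpNorm_kernelFn_le (Y := Unit) (Φ := fun _ => toSchwartz v)
    continuous_const isCompact_univ
  refine ⟨C, Q, hQ, fun L p hp q S hS => ?_⟩
  -- The partition sums to 1 on the support of `v ∘ q⁻¹`, and only members whose support meets it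
  -- contribute; by properness these have `(g j)⁻¹ * q ∈ Q`.
  have hsum : (fun w => v (q⁻¹.act w)) =
      fun w => ∑ j ∈ S, partitionFn φ g j w * v (q⁻¹.act w) := by
    ext w
    by_cases h : v (q⁻¹.act w) = 0
    · simp [h]
    have hx : q⁻¹.act w ∈ tsupport v := subset_tsupport v h
    have hw : w ∈ cone d := by
      rw [← Par.act_act_inv q w]; exact Par.act_mem_cone q (hvc hx)
    rw [← Finset.sum_mul, hφ.sum_partitionFn hw, one_mul]
    intro k hk
    refine hS k (hQ' _ _ hx ?_)
    rw [Par.act_mul, Par.act_act_inv]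
    exact mem_tsupport hk
  rw [hsum]
  refine (eLpNorm_multiplier_sum_le L S _
    (fun j => (hφ.hasCompactSupport_partitionFn j).mul_right)
    (fun j => (hsm j).mul (contDiff_act hv' _)) hp).trans ?_
  rw [Finset.mul_sum]
  refine Finset.sum_le_sum fun j _ => ?_
  refine (eLpNorm_multiplier_mul_act_le L (hφ.hasCompactSupport_partitionFn j) (hsm j) hv hv' q
    hp).trans ?_
  gcongr
  exact hC () trivial

end IsAdmissible

end

/-! ### Division by translates of `v`. -/

section

variable {d : ℕ}

/-- The parameters of the symbols that divide a member of the partition by translates of `v`. -/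
abbrev SymbolParam (d N : ℕ) : Type := (Fin N → (E d →L[ℝ] E d)) × (E d →L[ℝ] E d)

/-- The quotient of a member of the partition and a square function of translates of `v`. -/
def symbolFn {N : ℕ} (φ : E d → ℝ) (v : E d → ℂ) (t : Finset (Par d)) (χ₁ χ₂ : ℝ → ℝ) (l : Par d)
    (z : SymbolParam d N × E d) : ℂ :=
  ((φ z.2 * χ₁ (∑ i, φ (z.1.1 i z.2)) * χ₂ (∑ k ∈ t, ‖v (k⁻¹.act (z.1.2 z.2))‖ ^ 2) : ℝ) : ℂ) *
    (starRingEnd ℂ) (v (l⁻¹.act (z.1.2 z.2)))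

lemma contDiff_symbolFn {N : ℕ} {φ : E d → ℝ} {v : E d → ℂ} (hφ : ContDiff ℝ ∞ φ)
    (hv : ContDiff ℝ ∞ v) (t : Finset (Par d)) {χ₁ χ₂ : ℝ → ℝ} (h₁ : ContDiff ℝ ∞ χ₁)
    (h₂ : ContDiff ℝ ∞ χ₂) (l : Par d) : ContDiff ℝ ∞ (symbolFn (N := N) φ v t χ₁ χ₂ l) := by
  have hA : ∀ i, ContDiff ℝ ∞ fun z : SymbolParam d N × E d => z.1.1 i z.2 := fun i => by
    have h1 : ContDiff ℝ ∞ fun z : SymbolParam d N × E d => z.1.1 i := by fun_prop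
    exact h1.clm_apply contDiff_snd
  have hB : ContDiff ℝ ∞ fun z : SymbolParam d N × E d => z.1.2 z.2 := by
    have h1 : ContDiff ℝ ∞ fun z : SymbolParam d N × E d => z.1.2 := by fun_prop
    exact h1.clm_apply contDiff_snd
  have hk : ∀ k : Par d, ContDiff ℝ ∞ fun z : SymbolParam d N × E d => v (k⁻¹.act (z.1.2 z.2)) :=
    fun k => (contDiff_act hv k⁻¹).comp hB
  have e1 : ContDiff ℝ ∞ fun z : SymbolParam d N × E d => φ z.2 := hφ.comp contDiff_snd
  have e2 : ContDiff ℝ ∞ fun z : SymbolParam d N × E d => χ₁ (∑ i, φ (z.1.1 i z.2)) :=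
    h₁.comp (ContDiff.sum fun i _ => hφ.comp (hA i))
  have e3 : ContDiff ℝ ∞ fun z : SymbolParam d N × E d =>
      χ₂ (∑ k ∈ t, ‖v (k⁻¹.act (z.1.2 z.2))‖ ^ 2) :=
    h₂.comp (ContDiff.sum fun k _ => (hk k).norm_sq ℝ)
  exact (Complex.ofRealCLM.contDiff.comp ((e1.mul e2).mul e3)).mul
    (Complex.conjCLE.contDiff.comp (hk l))

/-- Finitely many translates of `v` have no common zero on a compact subset of the cone. -/
lemma exists_translates_pos {v : E d → ℂ} (hv : Continuous v) {x₀ : E d} (hx₀ : x₀ ∈ cone d)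
    (hvx₀ : v x₀ ≠ 0) {K : Set (E d)} (hK : IsCompact K) (hKc : K ⊆ cone d) :
    ∃ (t : Finset (Par d)) (ε : ℝ), 0 < ε ∧ ∀ y ∈ K, ε ≤ ∑ k ∈ t, ‖v (k⁻¹.act y)‖ ^ 2 := by
  have hc : ∀ k : Par d, Continuous fun y => v (k⁻¹.act y) := fun k => hv.comp k⁻¹.act.continuous
  -- The element `l y` carries `x₀` to `y`, so `v ∘ (l y)⁻¹` is nonzero near `y`; compactness leaves
  -- finitely many.
  let l : E d → Par d := fun y => Par.sec y * (Par.sec x₀)⁻¹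
  have hl : ∀ y ∈ K, (l y)⁻¹.act y = x₀ := fun y hy => by
    have : (l y).act x₀ = y := by
      conv_lhs => rw [← Par.act_sec hx₀, ← Par.act_mul]
      simp only [l, inv_mul_cancel_right]
      exact Par.act_sec (hKc hy)
    have h2 := Par.act_inv_act (l y) x₀
    rwa [this] at h2
  obtain ⟨s, hs, hsK⟩ := hK.elim_nhds_subcover (fun y => {y' | v ((l y)⁻¹.act y') ≠ 0})
    fun y hy => ((hc (l y)).isOpen_preimage _ isOpen_compl_singleton).mem_nhds (by
      change v ((l y)⁻¹.act y) ≠ 0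
      rwa [hl y hy])
  classical
  let t : Finset (Par d) := s.image l
  have hpos : ∀ y ∈ K, 0 < ∑ k ∈ t, ‖v (k⁻¹.act y)‖ ^ 2 := fun y hy => by
    obtain ⟨y', hy', hyy'⟩ := Set.mem_iUnion₂.1 (hsK hy)
    have hne : v ((l y')⁻¹.act y) ≠ 0 := hyy'
    refine Finset.sum_pos' (fun k _ => by positivity) ⟨l y', Finset.mem_image_of_mem l hy', ?_⟩
    have := norm_pos_iff.2 hne
    positivity
  have hcs : Continuous fun y => ∑ k ∈ t, ‖v (k⁻¹.act y)‖ ^ 2 :=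
    continuous_finsetSum _ fun k _ => ((hc k).norm).pow 2
  rcases K.eq_empty_or_nonempty with rfl | hne
  · exact ⟨t, 1, one_pos, fun y hy => hy.elim⟩
  · obtain ⟨y₁, hy₁, hmin⟩ := hK.exists_isMinOn hne hcs.continuousOn
    exact ⟨t, _, hpos y₁ hy₁, fun y hy => hmin hy⟩

namespace IsAdmissible

variable {φ : E d → ℝ} {g : ℕ → Par d}

/-- The members of the partition are controlled by finitely many neighbouring translates
of `v`. -/
lemma exists_partitionFn_le (hφ : IsAdmissible φ g)
    {v : E d → ℂ} (hv : HasCompactSupport v) (hv' : ContDiff ℝ ∞ v) {x₀ : E d} (hx₀ : x₀ ∈ cone d) (hvx₀ : v x₀ ≠ 0)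
    {U : Set (Par d)} (hU : IsCompact U) :
    ∃ (C : NNReal) (t : Finset (Par d)), ∀ (L : 𝓢(E d, ℂ) →L[ℂ] ℂ) (p : ℝ), 1 ≤ p →
      ∀ (j : ℕ), ∀ r ∈ U,
        eLpNorm (multiplier L (partitionFn φ g j)) (ENNReal.ofReal p) volume ≤
          C * ∑ l ∈ t, eLpNorm (multiplier L fun w => v ((g j * r * l)⁻¹.act w))
            (ENNReal.ofReal p) volume := by
  set K := tsupport φ with hK
  -- The set of points r⁻¹x with r in `U` and x in the support of `φ`, on which the square sum over
  -- `t` has to be bounded below.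
  let K' : Set (E d) := (fun z : Par d × E d => z.1⁻¹.act z.2) '' (U ×ˢ K)
  have hK'c : IsCompact K' := by
    refine (hU.prod hφ.compact).image ?_
    exact (Par.continuous_actCLM.comp (continuous_inv.comp continuous_fst)).clm_apply
      continuous_snd
  have hK's : K' ⊆ cone d := by
    rintro _ ⟨z, hz, rfl⟩
    exact Par.act_mem_cone _ (hφ.subset hz.2)
  obtain ⟨t, ε, hε, ht⟩ := exists_translates_pos hv'.continuous hx₀ hvx₀ hK'c hK's
  -- The thresholds 1 and ε are the lower bounds of the two denominators: the sum of the translates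
  -- of `φ` and the square sum of the translates of `v`.
  obtain ⟨χ₁, hχ₁, hχ₁'⟩ := exists_contDiff_inv one_pos
  obtain ⟨χ₂, hχ₂, hχ₂'⟩ := exists_contDiff_inv hε
  obtain ⟨Q, hQ, hQ'⟩ := Par.exists_isCompact_of_act_mem hφ.compact hφ.compact hφ.subset hφ.subset
  obtain ⟨N, hN⟩ := hφ.count Q hQ
  let M : Par d → SymbolParam d N × E d → ℂ := symbolFn φ v t χ₁ χ₂
  have hM : ∀ l, ContDiff ℝ ∞ (M l) := contDiff_symbolFn hφ.smooth hv' t hχ₁ hχ₂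
  have hMs : ∀ l z, ∀ w ∉ K, M l (z, w) = 0 := fun l z w hw => by
    have : φ w = 0 := image_eq_zero_of_notMem_tsupport hw
    simp [M, symbolFn, this]
  have hMc : ∀ l, Continuous fun z : SymbolParam d N => toSchwartz fun w => M l (z, w) := fun l =>
    continuous_toSchwartz (hM l) continuous_id fun _ =>
      ⟨K, hφ.compact, Eventually.of_forall fun z w hw => hMs l z w hw⟩
  -- The parameters that occur: the maps of `(g k)⁻¹ * g j` for neighbouring `k`, or the padding 0,
  -- and the map of `r⁻¹`. Their compactness makes the constants independent of `j` and `r`.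
  let P : Set (SymbolParam d N) :=
    (Set.univ.pi fun _ => insert 0 ((fun q : Par d => (q.act : E d →L[ℝ] E d)) '' Q)) ×ˢ
      ((fun q : Par d => (q⁻¹.act : E d →L[ℝ] E d)) '' U)
  have hP : IsCompact P := by
    refine (isCompact_univ_pi fun _ => ?_).prod ?_
    · exact (hQ.image Par.continuous_actCLM).insert 0
    · exact hU.image (Par.continuous_actCLM.comp continuous_inv)
  choose C hC using fun l => exists_eLpNorm_kernelFn_le (hMc l) hP
  -- The padding contributes `φ 0`, which vanishes because the origin is not in the cone.
  have hφ0 : φ 0 = 0 := by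
    by_contra h
    have := hφ.subset (mem_tsupport h)
    exact lt_irrefl _ this.2
  refine ⟨∑ l ∈ t, C l, t, fun L p hp j r hr => ?_⟩
  have hfin := (hN (g j)).1
  obtain ⟨A, hA, hA'⟩ := exists_fin_enumeration (0 : E d →L[ℝ] E d)
    (fun k => (((g k)⁻¹ * g j).act : E d →L[ℝ] E d)) hfin.toFinset N (by
      rw [← Set.ncard_eq_toFinset_card _ hfin]; exact (hN (g j)).2)
  let z : SymbolParam d N := (A, (r⁻¹.act : E d →L[ℝ] E d))
  have hz : z ∈ P := by
    refine ⟨fun i _ => ?_, ⟨r, hr, rfl⟩⟩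
    rcases hA i with h | ⟨k, hk, h⟩
    · exact Or.inl h
    · exact Or.inr ⟨_, (Set.Finite.mem_toFinset hfin).1 hk, h.symm⟩
  -- In the coordinate x = g_j⁻¹w the factors v · conj v sum over `t` to the square sum in the
  -- denominator, and what is left is the member of the partition.
  have hid : partitionFn φ g j = fun w => ∑ l ∈ t,
      v ((g j * r * l)⁻¹.act w) * M l (z, (g j)⁻¹.act w) := by
    ext w
    set x := (g j)⁻¹.act w with hx
    have hvl : ∀ l : Par d, v ((g j * r * l)⁻¹.act w) = v (l⁻¹.act (r⁻¹.act x)) := fun l => by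
      rw [hx, ← Par.act_mul, ← Par.act_mul]; congr 2; group
    by_cases h0 : φ x = 0
    · have : ∀ l, M l (z, x) = 0 := fun l => by simp [M, symbolFn, h0]
      simp only [this, mul_zero, Finset.sum_const_zero]
      simp [partitionFn, ← hx, h0]
    have hxK : x ∈ K := mem_tsupport h0
    have hw : w ∈ cone d := by
      rw [← Par.act_act_inv (g j) w]; exact Par.act_mem_cone _ (hφ.subset hxK)
    have hsumA : ∑ i, φ (A i x) = ∑' k, φ ((g k)⁻¹.act w) := by
      rw [hA' (fun B => φ (B x)) (by simpa using hφ0),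
        tsum_eq_sum_of_support (S := hfin.toFinset)]
      · refine Finset.sum_congr rfl fun k _ => ?_
        change φ (((g k)⁻¹ * g j).act x) = _
        rw [Par.act_mul, hx, Par.act_act_inv]
      · intro k hk
        refine (Set.Finite.mem_toFinset hfin).2 (hQ' _ x hxK ?_)
        rw [Par.act_mul, hx, Par.act_act_inv]
        exact mem_tsupport hk
    have h1 := hφ.one_le_tsum hw
    have h2 := ht (r⁻¹.act x) ⟨(r, x), ⟨hr, hxK⟩, rfl⟩
    have hMl : ∀ l, M l (z, x) = ((φ x * (∑' k, φ ((g k)⁻¹.act w))⁻¹ *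
        (∑ k ∈ t, ‖v (k⁻¹.act (r⁻¹.act x))‖ ^ 2)⁻¹ : ℝ) : ℂ) *
          (starRingEnd ℂ) (v (l⁻¹.act (r⁻¹.act x))) := fun l => by
      change ((φ x * χ₁ (∑ i, φ (A i x)) * χ₂ (∑ k ∈ t, ‖v (k⁻¹.act (r⁻¹.act x))‖ ^ 2) : ℝ) : ℂ) *
        (starRingEnd ℂ) (v (l⁻¹.act (r⁻¹.act x))) = _
      rw [hsumA, hχ₁' _ h1, hχ₂' _ h2]
    simp only [hvl, hMl]
    have hterm : ∀ l : Par d, ∀ c : ℂ, v (l⁻¹.act (r⁻¹.act x)) *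
        (c * (starRingEnd ℂ) (v (l⁻¹.act (r⁻¹.act x)))) =
        c * ((‖v (l⁻¹.act (r⁻¹.act x))‖ ^ 2 : ℝ) : ℂ) := fun l c => by
      rw [mul_left_comm, Complex.mul_conj, Complex.normSq_eq_norm_sq]
    simp only [hterm]
    rw [← Finset.mul_sum, ← Complex.ofReal_sum, ← Complex.ofReal_mul, mul_assoc,
      inv_mul_cancel₀ (hε.trans_le h2).ne', mul_one]
    rfl
  have hvq : ∀ q : Par d, HasCompactSupport fun w => v (q⁻¹.act w) :=
    fun q => hasCompactSupport_act hv _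
  have hMzc : ∀ l, HasCompactSupport fun w => M l (z, w) :=
    fun l => HasCompactSupport.intro hφ.compact fun w hw => hMs l z w hw
  have hMzs : ∀ l, ContDiff ℝ ∞ fun w => M l (z, w) := fun l => contDiff_slice (hM l) z
  rw [hid]
  refine (eLpNorm_multiplier_sum_le L t _ (fun l => (hvq (g j * r * l)).mul_right)
    (fun l => (contDiff_act hv' _).mul (contDiff_act (hMzs l) _)) hp).trans ?_
  rw [Finset.mul_sum]
  refine Finset.sum_le_sum fun l hl => ?_
  refine (eLpNorm_multiplier_mul_act_le L (hvq (g j * r * l)) (contDiff_act hv' _) (hMzc l)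
    (hMzs l) (g j) hp).trans ?_
  gcongr
  refine (hC l z hz).trans ?_
  exact_mod_cast Finset.single_le_sum (f := C) (fun _ _ => zero_le) hl

end IsAdmissible

end

/-! ### From local bounds to integrals and sums over the group. -/

section

variable {d : ℕ}

lemma continuous_multiplier_act (L : 𝓢(E d, ℂ) →L[ℂ] ℂ) {v : E d → ℂ} (hv : HasCompactSupport v)
    (hv' : ContDiff ℝ ∞ v) :
    Continuous fun z : Par d × E d => multiplier L (fun w => v (z.1⁻¹.act w)) z.2 := by
  have hM : ContDiff ℝ ∞ fun z : (E d →L[ℝ] E d) × E d => v (z.1 z.2) :=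
    hv'.comp (contDiff_fst.clm_apply contDiff_snd)
  refine continuous_multiplier_family L (Y := Par d × E d)
    (M := fun z : (E d →L[ℝ] E d) × E d => v (z.1 z.2)) hM
    (α := fun z => (z.1⁻¹.act : E d →L[ℝ] E d))
    (Par.continuous_actCLM.comp (continuous_inv.comp continuous_fst)) (fun z₀ => ?_) continuous_snd
  obtain ⟨V, hV, hV'⟩ := exists_compact_mem_nhds z₀.1
  refine ⟨(fun z : Par d × E d => z.1.act z.2) '' (V ×ˢ tsupport v),
    (hV.prod hv).image Par.continuous_act, ?_⟩
  filter_upwards [continuous_fst.continuousAt.preimage_mem_nhds hV'] with z hz w hw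
  by_contra h
  exact hw ⟨(z.1, z.1⁻¹.act w), ⟨hz, subset_tsupport v h⟩, Par.act_act_inv _ _⟩

lemma measurable_eLpNorm_multiplier_act (L : 𝓢(E d, ℂ) →L[ℂ] ℂ) {v : E d → ℂ}
    (hv : HasCompactSupport v) (hv' : ContDiff ℝ ∞ v) {p : ℝ} (hp : 1 ≤ p) :
    Measurable fun q : Par d =>
      eLpNorm (multiplier L fun w => v (q⁻¹.act w)) (ENNReal.ofReal p) volume := by
  simp only [eLpNorm_ofReal hp]
  have h := (continuous_multiplier_act L hv hv').measurable
  exact (Measurable.lintegral_prod_right' (h.enorm.pow_const p)).pow_const _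

/-- A mixed norm over the group is bounded by the norm of a sequence that controls the integrand
locally. -/
lemma exists_lintegral_le_tsum {W : Par d → ℝ≥0∞} (hW : Measurable W)
    (hmul : ∀ p q, W (p * q) = W p * W q) {g : ℕ → Par d} {Q : Set (Par d)} (hQ : IsCompact Q)
    (hWQ : ∫⁻ p in Q, W p ≠ ⊤) {N : ℕ} (hN : ∀ p : Par d,
      {k | (g k)⁻¹ * p ∈ Q}.Finite ∧ {k | (g k)⁻¹ * p ∈ Q}.ncard ≤ N)
    {q : ℝ} (hq : 1 ≤ q) (C : NNReal) :
    ∃ C' : ℝ≥0∞, C' ≠ ⊤ ∧ ∀ (F : Par d → ℝ≥0∞) (B : ℕ → ℝ≥0∞),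
      (∀ (p : Par d) (S : Finset ℕ), (∀ j, (g j)⁻¹ * p ∈ Q → j ∈ S) → F p ≤ C * ∑ j ∈ S, B j) →
      ∫⁻ p, W p * F p ^ q ≤ C' * ∑' j, W (g j) * B j ^ q := by
  have hq0 : 0 ≤ q := by linarith
  have hQm : MeasurableSet Q := hQ.measurableSet
  set A : ℝ≥0∞ := (C : ℝ≥0∞) ^ q * (N : ℝ≥0∞) ^ (q - 1) with hA
  have hAt : A ≠ ⊤ := ENNReal.mul_ne_top (ENNReal.rpow_ne_top_of_nonneg hq0 ENNReal.coe_ne_top)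
    (ENNReal.rpow_ne_top_of_nonneg (by linarith) (ENNReal.natCast_ne_top N))
  refine ⟨A * ∫⁻ p in Q, W p, ENNReal.mul_ne_top hAt hWQ, fun F B hF => ?_⟩
  -- At most `N` terms contribute, so Hölder's inequality costs N^{q-1}. The weight splits as `W p =
  -- W (g j) * W ((g j)⁻¹ * p)`, whose second factor lives on `Q`.
  have hpt : ∀ p, W p * F p ^ q ≤
      A * ∑' j, Q.indicator W ((g j)⁻¹ * p) * (W (g j) * B j ^ q) := fun p => by
    obtain ⟨hfin, hcard⟩ := hN p
    set S := hfin.toFinset with hS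
    have hcS : (S.card : ℝ≥0∞) ≤ N := by
      rw [hS, ← Set.ncard_eq_toFinset_card _ hfin]; exact_mod_cast hcard
    have h1 : F p ^ q ≤ A * ∑ j ∈ S, B j ^ q := by
      calc F p ^ q ≤ (C * ∑ j ∈ S, B j) ^ q := by
            gcongr; exact hF p S fun j hj => hfin.mem_toFinset.2 hj
        _ = C ^ q * (∑ j ∈ S, B j) ^ q := ENNReal.mul_rpow_of_nonneg _ _ hq0
        _ ≤ C ^ q * ((S.card : ℝ≥0∞) ^ (q - 1) * ∑ j ∈ S, B j ^ q) := by
            gcongr; exact ENNReal.rpow_sum_le_const_mul_sum_rpow S B hq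
        _ ≤ C ^ q * ((N : ℝ≥0∞) ^ (q - 1) * ∑ j ∈ S, B j ^ q) := by
            gcongr
        _ = _ := by rw [hA, mul_assoc]
    calc W p * F p ^ q ≤ W p * (A * ∑ j ∈ S, B j ^ q) := by gcongr
      _ = A * ∑ j ∈ S, W p * B j ^ q := by rw [mul_left_comm, Finset.mul_sum]
      _ = A * ∑ j ∈ S, Q.indicator W ((g j)⁻¹ * p) * (W (g j) * B j ^ q) := by
          congr 1
          refine Finset.sum_congr rfl fun j hj => ?_
          rw [Set.indicator_of_mem (show (g j)⁻¹ * p ∈ Q from hfin.mem_toFinset.1 hj), ← mul_assoc, mul_comm (W _) (W (g j)),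
            ← hmul, mul_inv_cancel_left]
      _ ≤ _ := by gcongr; exact ENNReal.sum_le_tsum S
  have hm : ∀ j, Measurable fun p => Q.indicator W ((g j)⁻¹ * p) := fun j =>
    (hW.indicator hQm).comp (measurable_const_mul _)
  calc ∫⁻ p, W p * F p ^ q
      ≤ ∫⁻ p, A * ∑' j, Q.indicator W ((g j)⁻¹ * p) * (W (g j) * B j ^ q) := lintegral_mono hpt
    _ = A * ∑' j, (∫⁻ p in Q, W p) * (W (g j) * B j ^ q) := by
        rw [lintegral_const_mul' _ _ hAt, lintegral_tsum fun j => ((hm j).mul_const _).aemeasurable]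
        congr 1
        refine tsum_congr fun j => ?_
        -- By left invariance every `j` contributes the same integral of `W` over `Q`.
        rw [lintegral_mul_const _ (hm j), lintegral_mul_left_eq_self, lintegral_indicator hQm]
    _ = _ := by rw [ENNReal.tsum_mul_left, ← mul_assoc]

/-- The norm of a sequence is bounded by a mixed norm over the group that controls it
locally. -/
lemma exists_tsum_le_lintegral {W : Par d → ℝ≥0∞} (hW : Measurable W) (hW0 : ∀ p, W p ≠ ⊤)
    (hmul : ∀ p q, W (p * q) = W p * W q) {g : ℕ → Par d} {U : Set (Par d)}
    (hU : IsCompact U) (hU0 : volume U ≠ 0) {M : ℝ≥0∞} (hM : M ≠ ⊤) (hMU : ∀ r ∈ U, W r⁻¹ ≤ M)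
    {N : ℕ} (hN : ∀ p : Par d,
      {k | (g k)⁻¹ * p ∈ U}.Finite ∧ {k | (g k)⁻¹ * p ∈ U}.ncard ≤ N)
    {q : ℝ} (hq : 1 ≤ q) (C : NNReal) (t : Finset (Par d)) :
    ∃ C' : ℝ≥0∞, C' ≠ ⊤ ∧ ∀ (F : Par d → ℝ≥0∞) (B : ℕ → ℝ≥0∞), Measurable F →
      (∀ (j : ℕ), ∀ r ∈ U, B j ≤ C * ∑ l ∈ t, F (g j * r * l)) →
      ∑' j, W (g j) * B j ^ q ≤ C' * ∫⁻ p, W p * F p ^ q := by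
  have hq0 : 0 ≤ q := by linarith
  have hUm : MeasurableSet U := hU.measurableSet
  choose κ hκ hκ' using Par.exists_lintegral_mul_right (d := d)
  set A : ℝ≥0∞ := (C : ℝ≥0∞) ^ q * (t.card : ℝ≥0∞) ^ (q - 1) with hA
  have hAt : A ≠ ⊤ := ENNReal.mul_ne_top (ENNReal.rpow_ne_top_of_nonneg hq0 ENNReal.coe_ne_top)
    (ENNReal.rpow_ne_top_of_nonneg (by linarith) (ENNReal.natCast_ne_top _))
  refine ⟨(volume U)⁻¹ * (A * ∑ l ∈ t, W l⁻¹ * (N * M * κ l)), ?_, fun F B hF hB => ?_⟩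
  · refine ENNReal.mul_ne_top (ENNReal.inv_ne_top.2 hU0) (ENNReal.mul_ne_top hAt ?_)
    exact (ENNReal.sum_ne_top.2 fun l _ => ENNReal.mul_ne_top (hW0 _)
      (ENNReal.mul_ne_top (ENNReal.mul_ne_top (ENNReal.natCast_ne_top N) hM) (hκ l)))
  set Θ : Par d → ℝ≥0∞ := fun p => W p * F p ^ q with hΘ
  have hΘm : Measurable Θ := hW.mul (hF.pow_const q)
  -- The local bound holds for every `r ∈ U`, so it is averaged over `U`. `J` records this set
  -- together with the bound `M` for `W r⁻¹` on it.
  set J : Par d → ℝ≥0∞ := U.indicator fun _ => M with hJ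
  have hJm : Measurable J := measurable_const.indicator hUm
  have hpt : ∀ j, ∀ r ∈ U, W (g j) * B j ^ q ≤
      A * ∑ l ∈ t, W l⁻¹ * (J r * Θ (g j * r * l)) := fun j r hr => by
    have h1 : B j ^ q ≤ A * ∑ l ∈ t, F (g j * r * l) ^ q := by
      calc B j ^ q ≤ (C * ∑ l ∈ t, F (g j * r * l)) ^ q := by gcongr; exact hB j r hr
        _ = C ^ q * (∑ l ∈ t, F (g j * r * l)) ^ q := ENNReal.mul_rpow_of_nonneg _ _ hq0
        _ ≤ C ^ q * ((t.card : ℝ≥0∞) ^ (q - 1) * ∑ l ∈ t, F (g j * r * l) ^ q) := by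
            gcongr; exact ENNReal.rpow_sum_le_const_mul_sum_rpow t _ hq
        _ = _ := by rw [hA, mul_assoc]
    have h2 : ∀ l, W (g j) ≤ W l⁻¹ * (J r * W (g j * r * l)) := fun l => by
      have : W (g j) = W l⁻¹ * (W r⁻¹ * W (g j * r * l)) := by
        rw [mul_left_comm, mul_comm (W l⁻¹), ← hmul, mul_inv_cancel_right, mul_comm, ← hmul,
          mul_inv_cancel_right]
      rw [this, hJ, Set.indicator_of_mem hr]
      gcongr
      exact hMU r hr
    calc W (g j) * B j ^ q ≤ W (g j) * (A * ∑ l ∈ t, F (g j * r * l) ^ q) := by gcongr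
      _ = A * ∑ l ∈ t, W (g j) * F (g j * r * l) ^ q := by rw [mul_left_comm, Finset.mul_sum]
      _ ≤ A * ∑ l ∈ t, W l⁻¹ * (J r * W (g j * r * l)) * F (g j * r * l) ^ q := by
          gcongr with l; exact h2 l
      _ = _ := by simp only [hΘ, mul_assoc]
  have hm1 : ∀ (j : ℕ) (l : Par d), Measurable fun r => J r * Θ (g j * r * l) := fun j l =>
    hJm.mul (hΘm.comp ((measurable_mul_const l).comp (measurable_const_mul (g j))))
  have hm2 : ∀ (j : ℕ), Measurable fun r => J ((g j)⁻¹ * r) := fun j =>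
    hJm.comp (measurable_const_mul _)
  have hm3 : ∀ l : Par d, Measurable fun r => Θ (r * l) := fun l => hΘm.comp (measurable_mul_const l)
  have hj : ∀ j, volume U * (W (g j) * B j ^ q) ≤
      A * ∑ l ∈ t, W l⁻¹ * ∫⁻ r, J ((g j)⁻¹ * r) * Θ (r * l) := fun j => by
    calc volume U * (W (g j) * B j ^ q) = ∫⁻ r in U, W (g j) * B j ^ q := by
          rw [setLIntegral_const, mul_comm]
      _ ≤ ∫⁻ r in U, A * ∑ l ∈ t, W l⁻¹ * (J r * Θ (g j * r * l)) :=
          setLIntegral_mono' hUm (hpt j)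
      _ ≤ ∫⁻ r, A * ∑ l ∈ t, W l⁻¹ * (J r * Θ (g j * r * l)) := setLIntegral_le_lintegral _ _
      _ = A * ∑ l ∈ t, W l⁻¹ * ∫⁻ r, J r * Θ (g j * r * l) := by
          rw [lintegral_const_mul' _ _ hAt,
            lintegral_finsetSum _ fun l _ => (hm1 j l).const_mul _]
          congr 1
          exact Finset.sum_congr rfl fun l _ => lintegral_const_mul _ (hm1 j l)
      _ = _ := by
          congr 1
          refine Finset.sum_congr rfl fun l _ => ?_
          congr 1
          rw [← lintegral_mul_left_eq_self (fun r => J ((g j)⁻¹ * r) * Θ (r * l)) (g j)]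
          simp only [inv_mul_cancel_left]
  -- Bounded overlap of the translates of `U`: this replaces the sum over `j` by a single integral
  -- over the group.
  have hJsum : ∀ r, ∑' j, J ((g j)⁻¹ * r) ≤ N * M := fun r => by
    obtain ⟨hfin, hcard⟩ := hN r
    have h0 : ∀ j ∉ hfin.toFinset, J ((g j)⁻¹ * r) = 0 := fun j hj =>
      Set.indicator_of_notMem (s := U) (fun h => hj (hfin.mem_toFinset.2 h)) _
    rw [tsum_eq_sum h0]
    refine (Finset.sum_le_card_nsmul _ _ M fun j _ => Set.indicator_le_self' (s := U) (by simp) _).trans ?_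
    rw [nsmul_eq_mul, ← Set.ncard_eq_toFinset_card _ hfin]
    gcongr
  -- The right translation by `l` is removed at the cost of the modular factor `κ l`.
  have hl : ∀ l : Par d, ∑' j, ∫⁻ r, J ((g j)⁻¹ * r) * Θ (r * l) ≤ N * M * (κ l * ∫⁻ p, Θ p) :=
    fun l => by
    have hm4 : ∀ j, AEMeasurable (fun r => J ((g j)⁻¹ * r) * Θ (r * l)) volume := fun j =>
      ((hm2 j).mul (hm3 l)).aemeasurable
    rw [← lintegral_tsum hm4, ← hκ' l Θ hΘm]
    simp only [ENNReal.tsum_mul_right]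
    rw [← lintegral_const_mul _ (hm3 l)]
    gcongr with r
    exact hJsum r
  have hsum : volume U * ∑' j, W (g j) * B j ^ q ≤
      A * ∑ l ∈ t, W l⁻¹ * (N * M * (κ l * ∫⁻ p, Θ p)) := by
    rw [← ENNReal.tsum_mul_left]
    refine (ENNReal.tsum_le_tsum hj).trans ?_
    rw [ENNReal.tsum_mul_left, Summable.tsum_finsetSum fun _ _ => ENNReal.summable]
    gcongr with l
    rw [ENNReal.tsum_mul_left]
    gcongr
    exact hl l
  have hUt : volume U ≠ ⊤ := hU.measure_lt_top.ne
  calc ∑' j, W (g j) * B j ^ q = (volume U)⁻¹ * (volume U * ∑' j, W (g j) * B j ^ q) := by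
        rw [← mul_assoc, ENNReal.inv_mul_cancel hU0 hUt, one_mul]
    _ ≤ (volume U)⁻¹ * (A * ∑ l ∈ t, W l⁻¹ * (N * M * (κ l * ∫⁻ p, Θ p))) := by gcongr
    _ = _ := by
        simp only [mul_assoc, Finset.sum_mul]

end

/-! ### The weight, and the two norms in terms of multipliers. -/

section

variable {d : ℕ}

/-- The power `Det^{-σ}` on the group. -/
def weight (σ : ℝ) (r : Par d) : ℝ≥0∞ := ENNReal.ofReal (Real.exp (-σ * r.logScale))

lemma weight_mul (σ : ℝ) (r l : Par d) : weight σ (r * l) = weight σ r * weight σ l := by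
  rw [weight, weight, weight, ← ENNReal.ofReal_mul (Real.exp_pos _).le, ← Real.exp_add,
    Par.logScale_mul, mul_add]

lemma continuous_weight (σ : ℝ) : Continuous (weight (d := d) σ) := by
  have := Par.continuous_logScale (d := d)
  unfold weight
  exact ENNReal.continuous_ofReal.comp (by fun_prop)

lemma weight_ne_top (σ : ℝ) (r : Par d) : weight σ r ≠ ⊤ := ENNReal.ofReal_ne_top

lemma exists_weight_le (σ : ℝ) {Q : Set (Par d)} (hQ : IsCompact Q) :
    ∃ M : ℝ≥0∞, M ≠ ⊤ ∧ ∀ r ∈ Q, weight σ r ≤ M := by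
  rcases Q.eq_empty_or_nonempty with rfl | hne
  · exact ⟨0, ENNReal.zero_ne_top, fun r hr => hr.elim⟩
  · obtain ⟨r₀, _, h⟩ := hQ.exists_isMaxOn hne (continuous_weight σ).continuousOn
    exact ⟨weight σ r₀, weight_ne_top σ r₀, fun r hr => h hr⟩

lemma setLIntegral_weight_ne_top (σ : ℝ) {Q : Set (Par d)} (hQ : IsCompact Q) :
    ∫⁻ r in Q, weight σ r ≠ ⊤ := by
  obtain ⟨M, hM, hM'⟩ := exists_weight_le σ hQ
  refine ((setLIntegral_mono' hQ.measurableSet hM').trans_lt ?_).ne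
  rw [setLIntegral_const]
  exact ENNReal.mul_lt_top hM.lt_top hQ.measure_lt_top

lemma weight_freqPoint (σ : ℝ) (h : H d) :
    weight σ (freqPoint h) = ENNReal.ofReal (h.scale ^ σ) := by
  rw [weight, freqPoint, Par.logScale_mk, neg_mul_neg, Real.rpow_def_of_pos h.scale_pos, mul_comm]

lemma continuous_scale : Continuous (H.scale (d := d)) :=
  continuous_subtype_val.comp continuous_fst

lemma continuous_freqPoint : Continuous (freqPoint (d := d)) :=
  Par.continuous_mk (continuous_scale.log fun h => h.scale_pos.ne').neg
    (continuous_fst.comp continuous_snd) (continuous_snd.comp continuous_snd)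

/-- The substitution is γ = e^{-a}, with the minus sign because `freqPoint` inverts the dilation. -/
lemma lintegral_Ioi_eq_lintegral_exp_neg (Φ : ℝ → ℝ≥0∞) :
    ∫⁻ γ in Set.Ioi 0, Φ γ = ∫⁻ a, ENNReal.ofReal (Real.exp (-a)) * Φ (Real.exp (-a)) := by
  have himg : (fun a : ℝ => Real.exp (-a)) '' Set.univ = Set.Ioi 0 := by
    rw [Set.image_univ]
    ext γ
    refine ⟨fun ⟨a, h⟩ => h ▸ Real.exp_pos _, fun h => ⟨-Real.log γ, ?_⟩⟩
    simp only [neg_neg]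
    exact Real.exp_log h
  have hd : ∀ a ∈ (Set.univ : Set ℝ),
      HasDerivWithinAt (fun a : ℝ => Real.exp (-a)) (-Real.exp (-a)) Set.univ a := fun a _ => by
    simpa using (hasDerivAt_neg a).exp
  have hi : Set.InjOn (fun a : ℝ => Real.exp (-a)) Set.univ := fun a _ b _ h =>
    neg_injective (Real.exp_injective h)
  rw [← himg, lintegral_image_eq_lintegral_abs_deriv_mul MeasurableSet.univ hd hi]
  simp

/-- The measure `dγ dt dc / γ` in the logarithmic frequency coordinates. -/
lemma lintegral_freqPoint {F : Par d → ℝ≥0∞} (hF : Measurable F) :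
    ∫⁻ h, F (freqPoint h) * ENNReal.ofReal (h.scale)⁻¹ ∂(H.lebesgue d) = ∫⁻ r, F r := by
  have hm : Measurable fun h : H d => F (freqPoint h) * ENNReal.ofReal (h.scale)⁻¹ :=
    (hF.comp continuous_freqPoint.measurable).mul
      (ENNReal.measurable_ofReal.comp continuous_scale.measurable.inv)
  let Ψ : ℝ → ℝ≥0∞ := fun a => ∫⁻ x : ℝ × EuclideanSpace ℝ (Fin d), F (Par.mk a x.1 x.2)
  have hF' : Measurable fun z : ℝ × ℝ × EuclideanSpace ℝ (Fin d) => F (Par.mk z.1 z.2.1 z.2.2) := hF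
  have h1 : ∫⁻ r, F r = ∫⁻ a, Ψ a := lintegral_prod _ hF'.aemeasurable
  have h2 : ∫⁻ h, F (freqPoint h) * ENNReal.ofReal (h.scale)⁻¹ ∂(H.lebesgue d) =
      ∫⁻ γ : {γ : ℝ // 0 < γ}, Ψ (-Real.log γ) * ENNReal.ofReal (γ : ℝ)⁻¹
        ∂(Measure.comap Subtype.val volume) := by
    rw [H.lebesgue, lintegral_prod _ hm.aemeasurable]
    refine lintegral_congr fun γ => ?_
    have h4 : Measurable fun x : ℝ × EuclideanSpace ℝ (Fin d) =>
      F (Par.mk (-Real.log γ) x.1 x.2) := hF'.comp measurable_prodMk_left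
    exact lintegral_mul_const (ENNReal.ofReal (γ : ℝ)⁻¹) h4
  have h3 : ∫⁻ γ : {γ : ℝ // 0 < γ}, Ψ (-Real.log γ) * ENNReal.ofReal (γ : ℝ)⁻¹
        ∂(Measure.comap Subtype.val volume) =
      ∫⁻ γ in Set.Ioi 0, Ψ (-Real.log γ) * ENNReal.ofReal γ⁻¹ :=
    lintegral_subtype_comap (s := Set.Ioi (0 : ℝ)) measurableSet_Ioi
      (fun γ => Ψ (-Real.log γ) * ENNReal.ofReal γ⁻¹)
  rw [h2, h3, h1, lintegral_Ioi_eq_lintegral_exp_neg]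
  refine lintegral_congr fun a => ?_
  rw [Real.log_exp, neg_neg, mul_left_comm, ← ENNReal.ofReal_mul (Real.exp_pos _).le,
    mul_inv_cancel₀ (Real.exp_pos _).ne', ENNReal.ofReal_one, mul_one]

/-- The conjugate of the Fourier transform, the symbol of the voice transform. -/
def voiceSymbol (u : ConeSchwartz d) (w : E d) : ℂ :=
  (starRingEnd ℂ) (lorentzFourier (u : 𝓢(E d, ℂ)) w)

lemma hasCompactSupport_voiceSymbol {u : ConeSchwartz d}
    (hu : HasCompactSupport (lorentzFourier (u : 𝓢(E d, ℂ)))) :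
    HasCompactSupport (voiceSymbol u) :=
  hu.comp_left (g := starRingEnd ℂ) (map_zero _)

/-- The voice transform is in fact jointly continuous, so measurability imposes no condition on
members of the coorbit space. -/
lemma measurable_voice {f : ConeDual d} {L : 𝓢(E d, ℂ) →L[ℂ] ℂ}
    (hL : ∀ (u : ConeSchwartz d) (m : 𝓢(E d, ℂ)),
      (∀ w, m w = (starRingEnd ℂ) (lorentzFourier (u : 𝓢(E d, ℂ)) w)) → L m = f u)
    (u : ConeSchwartz d) (hu : HasCompactSupport (lorentzFourier (u : 𝓢(E d, ℂ)))) :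
    Measurable (voice u f) := by
  have h1 := continuous_multiplier_act L (hasCompactSupport_voiceSymbol hu)
    (contDiff_conj_lorentzFourier (u : 𝓢(E d, ℂ)))
  have h2 : Continuous fun z : H d × E d => (freqPoint z.1, z.2) :=
    (continuous_freqPoint.comp continuous_fst).prodMk continuous_snd
  have h3 : Continuous fun z : H d × E d => z.1.scale ^ (((d : ℝ) + 2) / 2) :=
    (continuous_scale.comp continuous_fst).rpow_const fun z => Or.inl z.1.scale_pos.ne'
  have h4 := (Complex.continuous_ofReal.comp h3).mul (h1.comp h2)
  refine Eq.subst (motive := Measurable) ?_ h4.measurable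
  ext z
  exact (voice_eq_multiplier hL u hu z.1 z.2).symm

lemma coorbitNorm_eq {f : ConeDual d} {L : 𝓢(E d, ℂ) →L[ℂ] ℂ}
    (hL : ∀ (u : ConeSchwartz d) (m : 𝓢(E d, ℂ)),
      (∀ w, m w = (starRingEnd ℂ) (lorentzFourier (u : 𝓢(E d, ℂ)) w)) → L m = f u)
    (u : ConeSchwartz d) (hu : HasCompactSupport (lorentzFourier (u : 𝓢(E d, ℂ))))
    {p q : ℝ} (hp : 1 ≤ p) (hq : 1 ≤ q) (s : ℝ) :
    coorbitNorm u p q s f =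
      (∫⁻ r : Par d, weight (s + ((d : ℝ) + 2) * q / 2 - ((d : ℝ) + 2)) r *
        eLpNorm (multiplier L fun w => voiceSymbol u (r⁻¹.act w)) (ENNReal.ofReal p) volume ^ q) ^
          (1 / q) := by
  have hN := measurable_eLpNorm_multiplier_act L (hasCompactSupport_voiceSymbol hu)
    (contDiff_conj_lorentzFourier (u : 𝓢(E d, ℂ))) hp
  have hF : Measurable fun r : Par d => weight (s + ((d : ℝ) + 2) * q / 2 - ((d : ℝ) + 2)) r *
      eLpNorm (multiplier L fun w => voiceSymbol u (r⁻¹.act w)) (ENNReal.ofReal p) volume ^ q :=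
    (continuous_weight _).measurable.mul (hN.pow_const q)
  rw [coorbitNorm, mixedNorm, ← lintegral_freqPoint hF]
  congr 1
  refine lintegral_congr fun h => ?_
  have hγ := h.scale_pos
  have h1 : (∫⁻ b : E d, ‖voice u f (h, b)‖ₑ ^ p) ^ (q / p) =
      (ENNReal.ofReal (h.scale ^ (((d : ℝ) + 2) / 2)) *
        eLpNorm (multiplier L fun w => voiceSymbol u ((freqPoint h)⁻¹.act w)) (ENNReal.ofReal p)
          volume) ^ q := by
    have h2 : (fun b => voice u f (h, b)) = ((h.scale ^ (((d : ℝ) + 2) / 2) : ℝ) : ℂ) •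
        multiplier L fun w => voiceSymbol u ((freqPoint h)⁻¹.act w) := by
      ext b
      exact voice_eq_multiplier hL u hu h b
    have h3 := eLpNorm_const_smul ((h.scale ^ (((d : ℝ) + 2) / 2) : ℝ) : ℂ)
      (multiplier L fun w => voiceSymbol u ((freqPoint h)⁻¹.act w)) (ENNReal.ofReal p) volume
    rw [← h2, eLpNorm_ofReal hp, ← ofReal_norm, Complex.norm_real, Real.norm_of_nonneg
      (by positivity)] at h3
    rw [← h3, ← ENNReal.rpow_mul]
    congr 1
    ring
  rw [h1, ENNReal.mul_rpow_of_nonneg _ _ (by linarith), weight_freqPoint,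
    ENNReal.ofReal_rpow_of_pos (by positivity)]
  -- Here `d + 3 = n + 1`. Of the power γ^{-(n+1)}, the part γ^{-n} enters the weight and γ⁻¹ is the
  -- Haar density; the factor γ^{nq/2} comes from the normalisation of the representation.
  have h4 : h.scale ^ s / h.scale ^ (d + 3) * (h.scale ^ (((d : ℝ) + 2) / 2)) ^ q =
      h.scale ^ (s + ((d : ℝ) + 2) * q / 2 - ((d : ℝ) + 2)) * h.scale⁻¹ := by
    rw [← Real.rpow_natCast, ← Real.rpow_mul hγ.le, ← Real.rpow_sub hγ, ← Real.rpow_add hγ,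
      ← Real.rpow_neg_one, ← Real.rpow_add hγ]
    congr 1
    push_cast
    ring
  have h5 := congrArg ENNReal.ofReal h4
  rw [ENNReal.ofReal_mul (by positivity), ENNReal.ofReal_mul (by positivity)] at h5
  generalize eLpNorm (multiplier L fun w => voiceSymbol u ((freqPoint h)⁻¹.act w))
    (ENNReal.ofReal p) volume ^ q = X
  rw [mul_right_comm, mul_comm (ENNReal.ofReal _) (ENNReal.ofReal _), h5, mul_right_comm]

lemma besovNorm_eq {f : ConeDual d} {L : 𝓢(E d, ℂ) →L[ℂ] ℂ}
    (hL : ∀ (u : ConeSchwartz d) (m : 𝓢(E d, ℂ)),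
      (∀ w, m w = (starRingEnd ℂ) (lorentzFourier (u : 𝓢(E d, ℂ)) w)) → L m = f u)
    {φ : E d → ℝ} {g : ℕ → Par d} (hφ : IsAdmissible φ g) {w : ℕ → E d}
    (hw : ∀ j, (g j).act (basePoint d) = w j) {ψ : ℕ → ConeSchwartz d}
    (hψ : ∀ j, lorentzFourier (ψ j : 𝓢(E d, ℂ)) = partitionFn φ g j) (p q σ : ℝ) :
    besovNorm w ψ p q σ f = (∑' j, weight σ (g j) *
      eLpNorm (multiplier L (partitionFn φ g j)) (ENNReal.ofReal p) volume ^ q) ^ (1 / q) := by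
  rw [besovNorm]
  congr 1
  refine tsum_congr fun j => ?_
  rw [convolve_eq_multiplier hL (ψ j) (by rw [hψ]; exact hφ.hasCompactSupport_partitionFn j), hψ,
    ← hw, Par.coneDet_act_basePoint, weight, ← Real.exp_mul, mul_comm (-σ)]

end

/-! ### Littlewood–Paley decompositions as admissible partitions. -/

section

variable {d : ℕ}

lemma Par.ofH_inv_act (h : H d) (x : E d) : (Par.ofH h)⁻¹.act x = h.act.symm x := by
  rw [Par.act_inv, Par.act_ofH]

/-- A Littlewood–Paley decomposition comes from a smooth partition of unity. -/
lemma IsLittlewoodPaley.exists_isAdmissible {δ : ℝ} (hδ : 0 < δ) {w : ℕ → E d}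
    (hw : IsWhitneyCover δ w) {ψ : ℕ → ConeSchwartz d} (hψ : IsLittlewoodPaley δ w ψ) :
    ∃ (φ : E d → ℝ) (g : ℕ → Par d), IsAdmissible φ g ∧ (∀ j, (g j).act (basePoint d) = w j) ∧
      ∀ j, lorentzFourier (ψ j : 𝓢(E d, ℂ)) = partitionFn φ g j := by
  obtain ⟨φ, g, hsm, h01, hsupp, hone, hg, hFψ⟩ := hψ
  have hgw : ∀ j, (Par.ofH (g j)).act (basePoint d) = w j := fun j => by rw [Par.act_ofH, hg]
  refine ⟨φ, fun j => Par.ofH (g j), ⟨hsm, fun x => (h01 x).1, ?_, ?_, ?_, ?_⟩, hgw, fun j => ?_⟩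
  · exact Metric.isCompact_of_isClosed_isBounded (isClosed_tsupport φ)
      ((isBounded_baseBall (2 * δ)).subset hsupp)
  · exact hsupp.trans (baseBall_subset_cone _)
  · intro x hx
    obtain ⟨k, h, hh, y, hy, rfl⟩ := Set.mem_iUnion.1 (hw.cover hx)
    refine ⟨k, ?_⟩
    -- The ball about `w k` is formed with some `h` carrying the base point to `w k`; simple
    -- transitivity identifies it with `g k`.
    have hk : Par.ofH h = Par.ofH (g k) := Par.act_basePoint_injective <| by
      change (Par.ofH h).act (basePoint d) = (Par.ofH (g k)).act (basePoint d)
      rw [hgw, Par.act_ofH, hh]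
    rw [← Par.act_ofH h, hk, Par.act_inv_act]
    exact hone y hy
  · intro Q hQ
    -- The count comes from packing: the balls of radius `δ / 2` are disjoint translates of a
    -- neighbourhood of the base point.
    refine exists_card_le (baseBall_mem_nhds (half_pos hδ)) (fun i j hij => ?_) hQ
    have hsub : ∀ k, (Par.ofH (g k)).act '' baseBall d (δ / 2) ⊆ coneBall (δ / 2) (w k) :=
      fun k x hx => ⟨g k, hg k, by rwa [Par.act_ofH] at hx⟩
    exact (hw.disjoint hij).mono (hsub i) (hsub j)
  · ext x
    rw [hFψ, partitionFn]
    simp only [Par.ofH_inv_act]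

end

end LightCone

end

/-! ### The equivalence of the norms. -/

theorem mainTheorem3 (d : ℕ) (p q s : ℝ) (hp : 1 ≤ p) (hq : 1 ≤ q)
    (u : ConeSchwartz d) (hu : u ≠ 0)
    (hu_compact : HasCompactSupport (lorentzFourier (u : 𝓢(E d, ℂ))))
    (hu_supp : tsupport (lorentzFourier (u : 𝓢(E d, ℂ))) ⊆ cone d)
    (δ : ℝ) (hδ : 0 < δ) (w : ℕ → E d) (hw : IsWhitneyCover δ w)
    (ψ : ℕ → ConeSchwartz d) (hψ : IsLittlewoodPaley δ w ψ) :
    besovSpace w ψ p q (s + ((d : ℝ) + 2) * q / 2 - ((d : ℝ) + 2)) = coorbitSpace u p q s ∧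
    ∃ C : NNReal, 0 < C ∧ ∀ f ∈ coorbitSpace u p q s,
      besovNorm w ψ p q (s + ((d : ℝ) + 2) * q / 2 - ((d : ℝ) + 2)) f ≤
        C * coorbitNorm u p q s f ∧
      coorbitNorm u p q s f ≤
        C * besovNorm w ψ p q (s + ((d : ℝ) + 2) * q / 2 - ((d : ℝ) + 2)) f := by
  set σ := s + ((d : ℝ) + 2) * q / 2 - ((d : ℝ) + 2) with hσ
  obtain ⟨φ, g, hφ, hg, hFψ⟩ := hψ.exists_isAdmissible hδ hw
  -- Smoothness on all of ℝⁿ, including the boundary of the cone, is inherited from the Schwartz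
  -- functions ψ_j.
  have hsm : ∀ j, ContDiff ℝ ∞ (partitionFn φ g j) := fun j => by
    rw [← hFψ]; exact contDiff_lorentzFourier _
  have hv := hasCompactSupport_voiceSymbol hu_compact
  have hv' : ContDiff ℝ ∞ (voiceSymbol u) := contDiff_conj_lorentzFourier (u : 𝓢(E d, ℂ))
  have hvs : tsupport (voiceSymbol u) ⊆ cone d := by
    have h : Function.support (voiceSymbol u) ⊆
        Function.support (lorentzFourier (u : 𝓢(E d, ℂ))) := fun x hx h0 =>
      hx (by simp [voiceSymbol, h0])
    exact (closure_mono h).trans hu_supp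
  obtain ⟨x₀, hx₀⟩ : ∃ x₀, voiceSymbol u x₀ ≠ 0 := by
    by_contra! h
    refine hu (Subtype.ext (lorentzFourier_injective fun x => ?_))
    have h1 : lorentzFourier (u : 𝓢(E d, ℂ)) x = 0 := by
      simpa [voiceSymbol] using h x
    rw [h1]
    simp [lorentzFourier]
  have hx₀c : x₀ ∈ cone d := hvs (subset_tsupport _ hx₀)
  have hq0 : 0 < q := by linarith
  have hW : Measurable (weight (d := d) σ) := (continuous_weight σ).measurable
  -- the coorbit norm is bounded by the Besov norm
  obtain ⟨C₁, Q, hQ, hC₁⟩ := hφ.exists_translate_le hsm hv hv' hvs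
  obtain ⟨N₁, hN₁⟩ := hφ.count Q hQ
  obtain ⟨A₁, hA₁, hle₁⟩ := exists_lintegral_le_tsum hW (weight_mul σ) hQ
    (setLIntegral_weight_ne_top σ hQ) hN₁ hq C₁
  -- the Besov norm is bounded by the coorbit norm
  obtain ⟨U, hU, hU1⟩ := exists_compact_mem_nhds (1 : Par d)
  obtain ⟨C₂, t, hC₂⟩ := hφ.exists_partitionFn_le hv hv' hx₀c hx₀ hU
  obtain ⟨N₂, hN₂⟩ := hφ.count U hU
  obtain ⟨M, hM, hMU⟩ := exists_weight_le σ hU.inv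
  obtain ⟨A₂, hA₂, hle₂⟩ := exists_tsum_le_lintegral hW (weight_ne_top σ) (weight_mul σ) hU
    (Measure.measure_pos_of_mem_nhds volume hU1).ne' hM (fun r hr => hMU _ (Set.inv_mem_inv.2 hr)) hN₂ hq
    C₂ t
  -- One constant for both directions; the summand 1 makes it positive.
  set A : ℝ≥0∞ := A₁ ^ (1 / q) + A₂ ^ (1 / q) + 1 with hA
  have hroot : 0 ≤ 1 / q := by positivity
  have hAt : A ≠ ⊤ := by
    simp only [hA, ne_eq, ENNReal.add_eq_top, not_or]
    exact ⟨⟨ENNReal.rpow_ne_top_of_nonneg hroot hA₁, ENNReal.rpow_ne_top_of_nonneg hroot hA₂⟩,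
      ENNReal.one_ne_top⟩
  -- Both inequalities hold in [0, ∞] for every functional `f`, whether or not its norms are finite,
  -- and therefore give the equality of the two spaces as well.
  have key : ∀ f : ConeDual d, Measurable (voice u f) ∧
      besovNorm w ψ p q σ f ≤ A * coorbitNorm u p q s f ∧
      coorbitNorm u p q s f ≤ A * besovNorm w ψ p q σ f := fun f => by
    obtain ⟨L, hL⟩ := exists_functional f
    refine ⟨measurable_voice hL u hu_compact, ?_, ?_⟩
    · rw [besovNorm_eq hL hφ hg hFψ, coorbitNorm_eq hL u hu_compact hp hq]
      refine (ENNReal.rpow_le_rpow (hle₂ _ _ (measurable_eLpNorm_multiplier_act L hv hv' hp)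
        (hC₂ L p hp)) hroot).trans ?_
      rw [ENNReal.mul_rpow_of_nonneg _ _ hroot]
      gcongr
      exact le_add_right le_add_self
    · rw [besovNorm_eq hL hφ hg hFψ, coorbitNorm_eq hL u hu_compact hp hq]
      refine (ENNReal.rpow_le_rpow (hle₁ _ _ (hC₁ L p hp)) hroot).trans ?_
      rw [ENNReal.mul_rpow_of_nonneg _ _ hroot]
      gcongr
      exact le_add_right le_self_add
  refine ⟨Set.ext fun f => ⟨fun hf => ⟨(key f).1, ?_⟩, fun hf => ?_⟩, A.toNNReal, ?_, fun f _ => ?_⟩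
  · exact (key f).2.2.trans_lt (ENNReal.mul_lt_top hAt.lt_top hf)
  · exact (key f).2.1.trans_lt (ENNReal.mul_lt_top hAt.lt_top hf.2)
  · exact ENNReal.toNNReal_pos (ne_of_gt (one_pos.trans_le le_add_self)) hAt
  · rw [ENNReal.coe_toNNReal hAt]
    exact (key f).2
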